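/- Let $G=(V,E)$ be a strongly connected digraph without self-loops on $n\ge 2$ nodes, with random walk transition matrix $P=D^{-1}A$ (from $i$ the walker moves to a uniformly random out-neighbour of $i$), and assume that $P$ is aperiodic. Let $\pi$ be its stationary distribution and let $K=\sum_{i}\pi_iH(u,i)$ be Kemeny's constant, where $H(u,i)$ is the expected number of steps after which the walk from $u$ is at $i$ for the first time (so $H(i,i)=0$) and $u$ is any node; $K$ is finite. Let $\lambda<1$ be the second largest modulus of an eigenvalue of $P$ (with multiplicity). For $\epsilon>0$ put $$l=\max\Big\{0,\Big\lceil\tfrac{\log(3/(\epsilon-\epsilon\lambda))}{\log(1/\lambda)}\Big\rceil\Big\},\qquad r=\Big\lceil\tfrac94\epsilon^{-2}l^2\log(2n)\Big\rceil,\qquad k=\min\Big\{\Big\lceil\tfrac32\epsilon^{-1}l\,n^{1/2}\log^{1/2}n\Big\rceil,\,n\Big\}.$$ For $m\ge1$ let $f(m,X_{\mathrm{var}},X_{\mathrm{sup}},\delta)=\sqrt{2X_{\mathrm{var}}\log(3/\delta)/m}+3X_{\mathrm{sup}}\log(3/\delta)/m$ be the empirical Bernstein bound. Algorithm ImprovedMC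 (with $\lambda$ given) works as follows. It draws a uniformly random set $\tilde V\subseteq V$ of $k$ nodes. For every $i\in\tilde V$ it simulates independent walks of $l$ steps from $i$, at most $r$ of them. Let $t_i^{(j)}$ be the number of times $1,\dots,l$ at which the $j$-th walk is at $i$. After the $j$-th walk the simulation from $i$ stops if $f(j,\hat t_{\mathrm{var}},l/2,1/n)\le\epsilon/3$, where $\hat t_{\mathrm{var}}$ is the empirical variance (with normalization $1/j$) of $t_i^{(1)},\dots,t_i^{(j)}$. Let $\bar t_i$ be the empirical mean of the numbers of returns of the walks simulated from $i$. The output is $$\tilde K=n-l-1+\frac{n}{k}\sum_{i\in\tilde V}\bar t_i$$ (the last term being $0$ if $k=0$). Count one unit of time for each move to a random out-neighbour, each draw of a random node, and each elementary operation on numbers. Then: 1. There is an absolute constant $C$ such that for all such $G$ and all $0<\epsilon\le1$, every run of ImprovedMC takes at most $C\,\epsilon^{-3}\,l^4\,n^{1/2}\log^{3/2}n$ time. 2. For all such $G$ and all $\epsilon>0$, with probability at least $1-1/n$ the output satisfies $|\tilde K-K|\le2\epsilon K$. -/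

import Mathlib

open scoped ENNReal NNReal

namespace KemenyMC

noncomputable section

/-! ## Random walks on a digraph -/

/-- Every node can be reached from every node along directed edges. -/
def StronglyConnected {n : ℕ} (G : Digraph (Fin n)) : Prop :=
  ∀ i j, Relation.ReflTransGen G.Adj i j

open Classical in
/-- The set of out-neighbours of `i`. -/
def outNbrs {n : ℕ} (G : Digraph (Fin n)) (i : Fin n) : Finset (Fin n) :=
  Finset.univ.filter (fun j => G.Adj i j)

open Classical in
/-- The transition matrix `P = D⁻¹ A`: `P i j = 1 / d_i` if there is an edge from `i` to `j`. -/
def transition {n : ℕ} (G : Digraph (Fin n)) : Matrix (Fin n) (Fin n) ℝ :=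
  Matrix.of fun i j => if G.Adj i j then 1 / ((outNbrs G i).card : ℝ) else 0

/-- The walk is aperiodic: at every node, the only common divisor of all possible return times
is `1`. -/
def Aperiodic {n : ℕ} (G : Digraph (Fin n)) : Prop :=
  ∀ (i : Fin n) (d : ℕ), (∀ k, 1 ≤ k → 0 < (transition G ^ k) i i → d ∣ k) → d = 1

/-- `π` is a stationary distribution of the walk. -/
structure IsStationary {n : ℕ} (G : Digraph (Fin n)) (π : Fin n → ℝ) : Prop where
  nonneg : ∀ i, 0 ≤ π i
  sum_eq_one : ∑ i, π i = 1
  vecMul_eq : Matrix.vecMul π (transition G) = π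

/-- `λ = |λ₂|`: list the complex eigenvalues of `P` with multiplicity, remove the eigenvalue `1`
once, and take the largest modulus among the others. -/
def secondModulus {n : ℕ} (G : Digraph (Fin n)) : ℝ :=
  (((((transition G).map (algebraMap ℝ ℂ)).charpoly.roots.erase 1).map
    (fun z => ‖z‖₊)).sup : ℝ≥0)

/-- One step of the walk: a uniformly random out-neighbour. (A node without out-neighbours
does not occur in a strongly connected digraph with at least two nodes.) -/
def nextNode {n : ℕ} (G : Digraph (Fin n)) (i : Fin n) : PMF (Fin n) :=
  if h : (outNbrs G i).Nonempty then PMF.uniformOfFinset (outNbrs G i) h else PMF.pure i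

/-- The law of the list `X₀, X₁, …, X_k` of the first `k + 1` nodes of the walk with `X₀ = i`. -/
def walk {n : ℕ} (G : Digraph (Fin n)) : ℕ → Fin n → PMF (List (Fin n))
  | 0, i => PMF.pure [i]
  | k + 1, i => (nextNode G i).bind fun v => (walk G k v).map fun w => i :: w

/-- The hitting time `H(i, j) = 𝔼 τ = ∑_{k ≥ 0} ℙ(τ > k)`, where `τ` is the first time at which
the walk from `i` is at `j`; thus `τ > k` means that `j` is not among `X₀, …, X_k`. -/
def hittingTime {n : ℕ} (G : Digraph (Fin n)) (i j : Fin n) : ℝ≥0∞ :=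
  ∑' k : ℕ, (walk G k i).toOuterMeasure {w | j ∉ w}

/-- Kemeny's constant `K = ∑ i, π_i H(u, i)`, computed from the starting node `u`. -/
def kemeny {n : ℕ} (G : Digraph (Fin n)) (π : Fin n → ℝ) (u : Fin n) : ℝ≥0∞ :=
  ∑ i, ENNReal.ofReal (π i) * hittingTime G u i

/-! ## Randomized algorithms with a step count -/

/-- A randomized computation: the joint law of its result and of the number of elementary steps
it has used. -/
structure RandAlg (α : Type) where
  law : PMF (α × ℕ)

/-- Returning a value is free; running one computation after another adds up the steps. -/
instance : Monad RandAlg where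
  pure a := ⟨PMF.pure (a, 0)⟩
  bind m f := ⟨m.law.bind fun x => (f x.1).law.map fun y => (y.1, x.2 + y.2)⟩

/-- Charge `c` elementary steps. -/
def tick (c : ℕ) : RandAlg Unit := ⟨PMF.pure ((), c)⟩

/-- Move to a random out-neighbour of `i`: one step. -/
def moveFrom {n : ℕ} (G : Digraph (Fin n)) (i : Fin n) : RandAlg (Fin n) :=
  ⟨(nextNode G i).map fun v => (v, 1)⟩

/-- Draw a uniformly random set of `k` nodes: one step for each node drawn. -/
def drawSubset (n k : ℕ) (h : k ≤ n) : RandAlg (Finset (Fin n)) :=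
  ⟨(PMF.uniformOfFinset (Finset.powersetCard k (Finset.univ : Finset (Fin n)))
    (Finset.powersetCard_nonempty.2 (by simpa using h))).map fun S => (S, k)⟩

/-! ## The algorithm

Elementary steps are: a move to a random out-neighbour, the draw of one random node, an arithmetic
operation or elementary function of reals, a comparison, an assignment. The modulus `λ` belongs to
the input and its computation is not charged. -/

/-- The truncation length `l = ⌈log (3 / (ε - ε λ)) / log (1 / λ)⌉`. -/
def walkLength {n : ℕ} (G : Digraph (Fin n)) (ε : ℝ) : ℕ :=
  ⌈Real.log (3 / (ε - ε * secondModulus G)) / Real.log (1 / secondModulus G)⌉₊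

/-- The maximal number of walks from a node, `r = ⌈9 ε⁻² l² log (2n) / 4⌉`. -/
def maxWalks {n : ℕ} (G : Digraph (Fin n)) (ε : ℝ) : ℕ :=
  ⌈9 * ε⁻¹ ^ 2 * (walkLength G ε : ℝ) ^ 2 * Real.log (2 * n) / 4⌉₊

/-- The size `min {⌈3 ε⁻¹ l n^{1/2} log^{1/2} n / 2⌉, n}` of the random node set. -/
def subsetSize {n : ℕ} (G : Digraph (Fin n)) (ε : ℝ) : ℕ :=
  min ⌈3 * ε⁻¹ * (walkLength G ε : ℝ) * √(n : ℝ) * √(Real.log n) / 2⌉₊ n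

theorem subsetSize_le {n : ℕ} (G : Digraph (Fin n)) (ε : ℝ) : subsetSize G ε ≤ n :=
  min_le_right _ _

/-- The empirical Bernstein bound
`f(m, X_var, X_sup, δ) = √(2 X_var log (3/δ) / m) + 3 X_sup log (3/δ) / m`. -/
def bernstein (m : ℕ) (Xvar Xsup δ : ℝ) : ℝ :=
  √(2 * Xvar * Real.log (3 / δ) / m) + 3 * Xsup * Real.log (3 / δ) / m

/-- `countReturns G s k i c`: walk `k` more steps from the current node `i`, adding to the counter
`c` the number of visits to `s` on the way. A step of the walk costs one unit for the move and two
for the comparison with `s` and the update of the counter. -/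
def countReturns {n : ℕ} (G : Digraph (Fin n)) (s : Fin n) : ℕ → Fin n → ℕ → RandAlg ℕ
  | 0, _, c => pure c
  | k + 1, i, c => do
    let v ← moveFrom G i
    tick 2
    countReturns G s k v (if v = s then c + 1 else c)

/-- `simulate G ε s m j a b`: the state after `j` walks from `s`, whose numbers of returns have sum
`a` and sum of squares `b`; at most `m` further walks are allowed. The next walk is simulated and
`j`, `a`, `b` are updated (so that `b / j - (a / j)²` is the empirical variance); the loop ends
when the empirical Bernstein bound is at most `ε / 3`, or when no walk is left. The result is the
empirical mean. A round costs `30` units besides its walk: this covers the updates, the bound and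
the test. -/
def simulate {n : ℕ} (G : Digraph (Fin n)) (ε : ℝ) (s : Fin n) :
    ℕ → ℕ → ℝ → ℝ → RandAlg ℝ
  | 0, j, a, _ => do
    tick 1
    pure (a / j)
  | m + 1, j, a, b => do
    let t ← countReturns G s (walkLength G ε) s 0
    tick 30
    let j' := j + 1
    let a' := a + (t : ℝ)
    let b' := b + (t : ℝ) ^ 2
    if bernstein j' (b' / j' - (a' / j') ^ 2) ((walkLength G ε : ℝ) / 2) (1 / n) ≤ ε / 3 then
      tick 1
      pure (a' / j')
    else
      simulate G ε s m j' a' b'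

/-- The sum of the empirical means over a list of nodes; per node, five units for the
initialization and the addition. -/
def sumMeans {n : ℕ} (G : Digraph (Fin n)) (ε : ℝ) : List (Fin n) → RandAlg ℝ
  | [] => pure 0
  | i :: L => do
    let x ← simulate G ε i (maxWalks G ε) 0 0 0
    tick 5
    let y ← sumMeans G ε L
    pure (x + y)

/-- The algorithm ImprovedMC: compute the parameters, draw the random node set `S`, and return
`n - l - 1 + (n / |S|) * ∑_{i ∈ S} mean_i`. The `50` units cover the arithmetic outside the
loops. -/
def improvedMC {n : ℕ} (G : Digraph (Fin n)) (ε : ℝ) : RandAlg ℝ := do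
  tick 50
  let S ← drawSubset n (subsetSize G ε) (subsetSize_le G ε)
  let y ← sumMeans G ε S.toList
  pure ((n : ℝ) - walkLength G ε - 1 + (n : ℝ) / S.card * y)

/-- The probability of an event about the result and the number of steps. -/
def RandAlg.prob {α : Type} (A : RandAlg α) (E : Set (α × ℕ)) : ℝ≥0∞ :=
  A.law.toOuterMeasure E

/-- All pairs (result, number of steps) that occur with positive probability. -/
def RandAlg.outcomes {α : Type} (A : RandAlg α) : Set (α × ℕ) := A.law.support

end

end KemenyMC

/-! Spectral part. Let D = P − 1π. The eigenvalues of D are those of P with one copy of 1 replaced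
by 0 (`roots_deviationC`). Aperiodicity makes P primitive, so D^k → 0 and all these eigenvalues have
modulus below 1. With Z = (1 − D)⁻¹ the hitting times satisfy π_j H(i,j) = Z_jj − Z_ij, and the rows
of Z sum to 1. Hence K = tr Z − 1 = ∑ 1/(1 − z) over the eigenvalues z of P other than one copy of 1
(`kemeny_eq_sum`). If μ_i is the expected number of returns to i within l steps, then n − l − 1 + ∑
μ_i is the truncation ∑_z ∑_{t ≤ l} z^t of this series. The error budget is settled eigenvalue by
eigenvalue: by `norm_pow_div_add_le`, 2ε Re 1/(1 − z) exceeds the truncation error |z^(l+1)/(1 − z)|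
by at least (35/36)ε. Summing over the n − 1 eigenvalues leaves (35/36)(n − 1)ε for the sampling
error (`truncation_error`).

Sampling part. The data-dependent stopping rule may bias the empirical mean at a node. What is
controlled is its mean square error about μ_i, bias included, which is at most 0.2 ε²
(`second_moment_le`). Runs that last until a deterministic time T contribute at most 2v/T, v being
the variance of one return count. For small v the linear term of the Bernstein bound already
prevents early stopping. For large v, stopping before T forces the empirical variance well below v,
and a self-normalised exponential supermartingale pays for that event. It remains to sum over the
sampled nodes (`sample_error`). If all nodes are sampled, Chebyshev's inequality suffices. Otherwise
Hoeffding's method is used; sampling without replacement is reduced to independent sampling by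
Maclaurin's inequality, since the moment generating function of the sampled sum is an elementary
symmetric mean.

The running time is a worst-case count: k nodes, at most r walks from each, 3l + O(1) units per
walk. -/

open scoped ENNReal NNReal

namespace KemenyMC

noncomputable section

/-! ## Expectations of finitely supported laws -/

/-- The expectation of a real function under a probability mass function. -/
def expect {α : Type*} (p : PMF α) (f : α → ℝ) : ℝ := ∑' a, (p a).toReal * f a

section expect

variable {α β : Type*} {p : PMF α}

/-- Every law in the algorithm has finite support. Passing to finite sums avoids summability
questions for the real `tsum`, which is 0 by default when the family is not summable. -/
theorem expect_eq_sum {s : Finset α} (hs : p.support ⊆ s) (f : α → ℝ) :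
    expect p f = ∑ a ∈ s, (p a).toReal * f a := by
  refine tsum_eq_sum fun a ha => ?_
  have : p a = 0 := (p.apply_eq_zero_iff a).2 fun h => ha (hs h)
  simp [this]

theorem expect_pure (a : α) (f : α → ℝ) : expect (PMF.pure a) f = f a := by
  classical
  rw [expect_eq_sum (s := {a}) (by simp)]
  simp

theorem sum_toReal_eq_one {s : Finset α} (hs : p.support ⊆ s) :
    ∑ a ∈ s, (p a).toReal = 1 := by
  rw [← ENNReal.toReal_sum fun a _ => p.apply_ne_top a, ← p.toOuterMeasure_apply_finset,
    (p.toOuterMeasure_apply_eq_one_iff _).2 hs, ENNReal.toReal_one]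

theorem expect_const (hp : p.support.Finite) (c : ℝ) : expect p (fun _ => c) = c := by
  have hs : p.support ⊆ hp.toFinset := by simp
  rw [expect_eq_sum hs, ← Finset.sum_mul, sum_toReal_eq_one hs, one_mul]

theorem expect_add (hp : p.support.Finite) (f g : α → ℝ) :
    expect p (fun a => f a + g a) = expect p f + expect p g := by
  have hs : p.support ⊆ hp.toFinset := by simp
  simp only [expect_eq_sum hs, mul_add, Finset.sum_add_distrib]

theorem expect_sub (hp : p.support.Finite) (f g : α → ℝ) :
    expect p (fun a => f a - g a) = expect p f - expect p g := by
  have hs : p.support ⊆ hp.toFinset := by simp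
  simp only [expect_eq_sum hs, mul_sub, Finset.sum_sub_distrib]

theorem expect_const_mul (c : ℝ) (f : α → ℝ) :
    expect p (fun a => c * f a) = c * expect p f := by
  simp only [expect, mul_left_comm _ c, tsum_mul_left]

theorem expect_mul_const (c : ℝ) (f : α → ℝ) :
    expect p (fun a => f a * c) = expect p f * c := by
  simp only [mul_comm _ c, expect_const_mul]

theorem expect_sum (hp : p.support.Finite) {ι : Type*} (s : Finset ι) (f : ι → α → ℝ) :
    expect p (fun a => ∑ i ∈ s, f i a) = ∑ i ∈ s, expect p (f i) := by
  classical
  induction s using Finset.induction_on with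
  | empty => simpa using expect_const hp 0
  | insert i s hi ih => simp only [Finset.sum_insert hi, expect_add hp, ih]

theorem expect_mono (hp : p.support.Finite) {f g : α → ℝ} (h : ∀ a ∈ p.support, f a ≤ g a) :
    expect p f ≤ expect p g := by
  have hs : p.support ⊆ hp.toFinset := by simp
  rw [expect_eq_sum hs, expect_eq_sum hs]
  exact Finset.sum_le_sum fun a ha =>
    mul_le_mul_of_nonneg_left (h a (by simpa using ha)) ENNReal.toReal_nonneg

theorem expect_congr {f g : α → ℝ} (h : ∀ a ∈ p.support, f a = g a) :
    expect p f = expect p g := by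
  refine tsum_congr fun a => ?_
  by_cases ha : a ∈ p.support
  · rw [h a ha]
  · simp [(p.apply_eq_zero_iff a).2 ha]

theorem expect_nonneg {f : α → ℝ} (h : ∀ a ∈ p.support, 0 ≤ f a) : 0 ≤ expect p f := by
  refine tsum_nonneg fun a => ?_
  by_cases ha : a ∈ p.support
  · exact mul_nonneg ENNReal.toReal_nonneg (h a ha)
  · simp [(p.apply_eq_zero_iff a).2 ha]

theorem expect_bind (hp : p.support.Finite) {q : α → PMF β}
    (hq : ∀ a ∈ p.support, (q a).support.Finite) (f : β → ℝ) :
    expect (p.bind q) f = expect p (fun a => expect (q a) f) := by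
  classical
  set s := hp.toFinset with hsdef
  have hs : p.support ⊆ s := by simp [hsdef]
  have ht : (⋃ a ∈ p.support, (q a).support).Finite := hp.biUnion hq
  set t := ht.toFinset with htdef
  have hbt : (p.bind q).support ⊆ t := by simp [htdef, PMF.support_bind]
  have hqt : ∀ a ∈ p.support, (q a).support ⊆ t := by
    intro a ha
    rw [htdef, Set.Finite.coe_toFinset]
    exact Set.subset_biUnion_of_mem (u := fun a => (q a).support) ha
  rw [expect_eq_sum hbt, expect_eq_sum hs]
  have h1 : ∀ b, ((p.bind q) b).toReal = ∑ a ∈ s, (p a).toReal * (q a b).toReal := by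
    intro b
    rw [PMF.bind_apply, tsum_eq_sum (s := s), ENNReal.toReal_sum]
    · simp only [ENNReal.toReal_mul]
    · exact fun a _ => ENNReal.mul_ne_top (p.apply_ne_top a) ((q a).apply_ne_top b)
    · intro a ha
      have : p a = 0 := (p.apply_eq_zero_iff a).2 fun h => ha (hs h)
      simp [this]
  simp only [h1, Finset.sum_mul]
  rw [Finset.sum_comm]
  refine Finset.sum_congr rfl fun a ha => ?_
  rw [expect_eq_sum (hqt a (by simpa [hsdef] using ha)), Finset.mul_sum]
  simp only [mul_assoc]

theorem expect_map (hp : p.support.Finite) (g : α → β) (f : β → ℝ) :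
    expect (p.map g) f = expect p (fun a => f (g a)) := by
  rw [PMF.map, expect_bind hp (by simp)]
  simp [expect_pure]

theorem finite_support_bind (hp : p.support.Finite) {q : α → PMF β}
    (hq : ∀ a, (q a).support.Finite) : (p.bind q).support.Finite := by
  rw [PMF.support_bind]
  exact hp.biUnion fun a _ => hq a

theorem finite_support_map (hp : p.support.Finite) (g : α → β) :
    (p.map g).support.Finite := by
  rw [PMF.support_map]
  exact hp.image g

/-- Markov's inequality. -/
theorem toOuterMeasure_le_expect (hp : p.support.Finite) {E : Set α} {f : α → ℝ}
    (h0 : ∀ a ∈ p.support, 0 ≤ f a) (h1 : ∀ a ∈ p.support, a ∈ E → 1 ≤ f a) :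
    p.toOuterMeasure E ≤ ENNReal.ofReal (expect p f) := by
  have hs : p.support ⊆ hp.toFinset := by simp
  rw [expect_eq_sum hs, ENNReal.ofReal_sum_of_nonneg, PMF.toOuterMeasure_apply,
    tsum_eq_sum (s := hp.toFinset)]
  · refine Finset.sum_le_sum fun a ha => ?_
    have ha' : a ∈ p.support := by simpa using ha
    by_cases haE : a ∈ E
    · rw [Set.indicator_of_mem haE, ENNReal.ofReal_mul ENNReal.toReal_nonneg,
        ENNReal.ofReal_toReal (p.apply_ne_top a)]
      exact le_mul_of_one_le_right' (by simpa using h1 a ha' haE)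
    · simp [haE]
  · intro a ha
    have : p a = 0 := (p.apply_eq_zero_iff a).2 fun h => ha (hs h)
    simp [Set.indicator, this]
  · exact fun a ha => mul_nonneg ENNReal.toReal_nonneg (h0 a (by simpa using ha))

/-- A lower bound for the probability of an event from an upper bound for its complement. -/
theorem one_sub_le_toOuterMeasure {E : Set α} {δ : ℝ} (hδ : 0 ≤ δ)
    (h : p.toOuterMeasure Eᶜ ≤ ENNReal.ofReal δ) :
    ENNReal.ofReal (1 - δ) ≤ p.toOuterMeasure E := by
  rw [ENNReal.ofReal_sub _ hδ, ENNReal.ofReal_one, tsub_le_iff_right]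
  have h1 : p.toOuterMeasure Set.univ = 1 := (p.toOuterMeasure_apply_eq_one_iff _).2 (by simp)
  calc (1 : ℝ≥0∞) = p.toOuterMeasure (E ∪ Eᶜ) := by rw [Set.union_compl_self, h1]
    _ ≤ p.toOuterMeasure E + p.toOuterMeasure Eᶜ := MeasureTheory.measure_union_le _ _
    _ ≤ _ := by gcongr

end expect

/-! ## Laws and supports of randomized computations -/

namespace RandAlg

/-- The law of the result alone. -/
def val {α : Type} (A : RandAlg α) : PMF α := A.law.map Prod.fst

theorem val_pure {α : Type} (a : α) : (pure a : RandAlg α).val = PMF.pure a := PMF.pure_map _ _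

/-- A continuation never reads the step counter, so the counter can be dropped before composing.
Accuracy is therefore a statement about `val` alone. -/
theorem val_bind {α β : Type} (m : RandAlg α) (f : α → RandAlg β) :
    (m >>= f).val = m.val.bind fun a => (f a).val := by
  change PMF.map Prod.fst (m.law.bind fun x => (f x.1).law.map fun y => (y.1, x.2 + y.2)) = _
  rw [PMF.map_bind, val, PMF.bind_map]
  congr 1
  funext x
  rw [PMF.map_comp]
  rfl

theorem val_tick (c : ℕ) : (tick c).val = PMF.pure () := PMF.pure_map _ _

theorem prob_fst {α : Type} (A : RandAlg α) (E : Set α) :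
    A.prob {x | x.1 ∈ E} = A.val.toOuterMeasure E :=
  (PMF.toOuterMeasure_map_apply _ _ _).symm

theorem mem_outcomes_pure {α : Type} {a : α} {x : α × ℕ} :
    x ∈ (pure a : RandAlg α).outcomes ↔ x = (a, 0) := PMF.mem_support_pure_iff _ _

theorem mem_outcomes_tick {c : ℕ} {x : Unit × ℕ} :
    x ∈ (tick c).outcomes ↔ x = ((), c) := PMF.mem_support_pure_iff _ _

theorem mem_outcomes_bind {α β : Type} {m : RandAlg α} {f : α → RandAlg β} {x : β × ℕ} :
    x ∈ (m >>= f).outcomes ↔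
      ∃ y ∈ m.outcomes, ∃ z ∈ (f y.1).outcomes, x = (z.1, y.2 + z.2) := by
  change x ∈ (m.law.bind fun x => (f x.1).law.map fun y => (y.1, x.2 + y.2)).support ↔ _
  simp only [PMF.mem_support_bind_iff, PMF.mem_support_map_iff, outcomes, eq_comm]

end RandAlg

theorem val_moveFrom {n : ℕ} (G : Digraph (Fin n)) (i : Fin n) :
    (moveFrom G i).val = nextNode G i := by
  simp only [RandAlg.val, moveFrom, PMF.map_comp]
  exact PMF.map_id _

theorem val_drawSubset (n k : ℕ) (h : k ≤ n) :
    (drawSubset n k h).val = PMF.uniformOfFinset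
      (Finset.powersetCard k (Finset.univ : Finset (Fin n)))
      (Finset.powersetCard_nonempty.2 (by simpa using h)) := by
  simp only [RandAlg.val, drawSubset, PMF.map_comp]
  exact PMF.map_id _

theorem val_countReturns_succ {n : ℕ} (G : Digraph (Fin n)) (s : Fin n) (k : ℕ) (i : Fin n)
    (c : ℕ) : (countReturns G s (k + 1) i c).val =
      (nextNode G i).bind fun v => (countReturns G s k v (if v = s then c + 1 else c)).val := by
  simp only [countReturns, RandAlg.val_bind, val_moveFrom, RandAlg.val_tick, PMF.pure_bind]

theorem val_simulate_zero {n : ℕ} (G : Digraph (Fin n)) (ε : ℝ) (s : Fin n) (j : ℕ) (a b : ℝ) :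
    (simulate G ε s 0 j a b).val = PMF.pure (a / j) := by
  simp only [simulate, RandAlg.val_bind, RandAlg.val_tick, PMF.pure_bind, RandAlg.val_pure]

/-- The stopping condition of the simulation. -/
def Stops {n : ℕ} (G : Digraph (Fin n)) (ε : ℝ) (j : ℕ) (a b : ℝ) : Prop :=
  bernstein j (b / j - (a / j) ^ 2) ((walkLength G ε : ℝ) / 2) (1 / n) ≤ ε / 3

open Classical in
theorem val_simulate_succ {n : ℕ} (G : Digraph (Fin n)) (ε : ℝ) (s : Fin n) (m j : ℕ)
    (a b : ℝ) : (simulate G ε s (m + 1) j a b).val =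
      (countReturns G s (walkLength G ε) s 0).val.bind fun t =>
        if Stops G ε (j + 1) (a + t) (b + (t : ℝ) ^ 2) then PMF.pure ((a + t) / (j + 1 : ℕ))
        else (simulate G ε s m (j + 1) (a + t) (b + (t : ℝ) ^ 2)).val := by
  simp only [simulate, RandAlg.val_bind, RandAlg.val_tick, PMF.pure_bind]
  congr 1
  funext t
  split_ifs with h1 h2 h2
  · simp only [RandAlg.val_bind, RandAlg.val_tick, PMF.pure_bind, RandAlg.val_pure]
  · exact absurd h1 h2
  · exact absurd h2 h1
  · rfl

theorem val_sumMeans_nil {n : ℕ} (G : Digraph (Fin n)) (ε : ℝ) :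
    (sumMeans G ε []).val = PMF.pure 0 := RandAlg.val_pure _

theorem val_sumMeans_cons {n : ℕ} (G : Digraph (Fin n)) (ε : ℝ) (i : Fin n)
    (L : List (Fin n)) : (sumMeans G ε (i :: L)).val =
      (simulate G ε i (maxWalks G ε) 0 0 0).val.bind fun x =>
        (sumMeans G ε L).val.map fun y => x + y := by
  simp only [sumMeans, RandAlg.val_bind, RandAlg.val_tick, PMF.pure_bind, RandAlg.val_pure]
  rfl

theorem val_improvedMC {n : ℕ} (G : Digraph (Fin n)) (ε : ℝ) :
    (improvedMC G ε).val = (drawSubset n (subsetSize G ε) (subsetSize_le G ε)).val.bind fun S =>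
      (sumMeans G ε S.toList).val.map fun y =>
        (n : ℝ) - walkLength G ε - 1 + (n : ℝ) / S.card * y := by
  simp only [improvedMC, RandAlg.val_bind, RandAlg.val_tick, PMF.pure_bind, RandAlg.val_pure]
  rfl

theorem finite_support_nextNode {n : ℕ} (G : Digraph (Fin n)) (i : Fin n) :
    (nextNode G i).support.Finite := Set.toFinite _

theorem finite_support_countReturns {n : ℕ} (G : Digraph (Fin n)) (s : Fin n) (k : ℕ)
    (i : Fin n) (c : ℕ) : (countReturns G s k i c).val.support.Finite := by
  induction k generalizing i c with
  | zero => simp [countReturns, RandAlg.val_pure]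
  | succ k ih =>
    rw [val_countReturns_succ]
    exact finite_support_bind (finite_support_nextNode G i) fun v => ih v _

theorem finite_support_simulate {n : ℕ} (G : Digraph (Fin n)) (ε : ℝ) (s : Fin n) (m j : ℕ)
    (a b : ℝ) : (simulate G ε s m j a b).val.support.Finite := by
  classical
  induction m generalizing j a b with
  | zero => simp [val_simulate_zero]
  | succ m ih =>
    rw [val_simulate_succ]
    refine finite_support_bind (finite_support_countReturns G s _ _ _) fun t => ?_
    split_ifs
    · simp
    · exact ih _ _ _

theorem finite_support_sumMeans {n : ℕ} (G : Digraph (Fin n)) (ε : ℝ) (L : List (Fin n)) :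
    (sumMeans G ε L).val.support.Finite := by
  induction L with
  | nil => simp [val_sumMeans_nil]
  | cons i L ih =>
    rw [val_sumMeans_cons]
    exact finite_support_bind (finite_support_simulate G ε i _ _ _ _) fun x =>
      finite_support_map ih _

/-! ## Return counts of a walk -/

section returns

variable {n : ℕ} {G : Digraph (Fin n)}

theorem mem_outNbrs {i j : Fin n} : j ∈ outNbrs G i ↔ G.Adj i j := by
  simp [outNbrs]

theorem mem_support_nextNode {i v : Fin n} (h : (outNbrs G i).Nonempty)
    (hv : v ∈ (nextNode G i).support) : G.Adj i v := by
  rw [nextNode, dif_pos h, PMF.mem_support_uniformOfFinset_iff] at hv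
  exact mem_outNbrs.1 hv

theorem nextNode_toReal {i v : Fin n} (h : (outNbrs G i).Nonempty) :
    (nextNode G i v).toReal = transition G i v := by
  classical
  rw [nextNode, dif_pos h, PMF.uniformOfFinset_apply, transition, Matrix.of_apply]
  by_cases hv : G.Adj i v
  · rw [if_pos (mem_outNbrs.2 hv), if_pos hv]
    simp
  · rw [if_neg (fun h => hv (mem_outNbrs.1 h)), if_neg hv]
    simp

theorem expect_nextNode {i : Fin n} (h : (outNbrs G i).Nonempty) (f : Fin n → ℝ) :
    expect (nextNode G i) f = ∑ v, transition G i v * f v := by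
  rw [expect_eq_sum (s := Finset.univ) (by simp)]
  simp only [nextNode_toReal h]

theorem transition_nonneg (G : Digraph (Fin n)) (i j : Fin n) : 0 ≤ transition G i j := by
  classical
  rw [transition, Matrix.of_apply]
  split_ifs <;> positivity

theorem transition_pos {i j : Fin n} (h : G.Adj i j) : 0 < transition G i j := by
  classical
  rw [transition, Matrix.of_apply, if_pos h]
  have : 0 < (outNbrs G i).card := Finset.card_pos.2 ⟨j, mem_outNbrs.2 h⟩
  positivity

theorem sum_transition (hG : ∀ i, (outNbrs G i).Nonempty) (i : Fin n) :
    ∑ j, transition G i j = 1 := by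
  have := expect_nextNode (hG i) (fun _ => 1)
  rw [expect_const (finite_support_nextNode G i)] at this
  simpa using this.symm

theorem expect_countReturns (hG : ∀ i, (outNbrs G i).Nonempty) (s : Fin n) (k : ℕ) (i : Fin n)
    (c : ℕ) : expect (countReturns G s k i c).val (fun t => (t : ℝ)) =
      c + ∑ t ∈ Finset.range k, (transition G ^ (t + 1)) i s := by
  induction k generalizing i c with
  | zero => simp [countReturns, RandAlg.val_pure, expect_pure]
  | succ k ih =>
    rw [val_countReturns_succ, expect_bind (finite_support_nextNode G i)
      fun v _ => finite_support_countReturns G s k v _]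
    simp only [ih]
    rw [expect_add (finite_support_nextNode G i), expect_sum (finite_support_nextNode G i)]
    simp only [expect_nextNode (hG i)]
    rw [Finset.sum_range_succ', add_comm (∑ t ∈ Finset.range k, _), ← add_assoc]
    congr 1
    · have : ∀ v, transition G i v * ((if v = s then c + 1 else c : ℕ) : ℝ) =
          transition G i v * c + (if v = s then transition G i v else 0) := by
        intro v
        split_ifs <;> push_cast <;> ring
      simp only [this, Finset.sum_add_distrib, ← Finset.sum_mul, sum_transition hG]
      simp
    · refine Finset.sum_congr rfl fun t _ => ?_
      rw [pow_succ' _ (t + 1), Matrix.mul_apply]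

/-- Without loops two visits to `s` are at least two steps apart. The last summand is the one step
that is saved when the walk does not currently stand at `s`. -/
theorem countReturns_le (hG : ∀ i, (outNbrs G i).Nonempty) (hloop : ∀ i, ¬ G.Adj i i)
    {s : Fin n} {k : ℕ} {i : Fin n} {c t : ℕ}
    (ht : t ∈ (countReturns G s k i c).val.support) :
    2 * t ≤ 2 * c + k + (if i = s then 0 else 1) := by
  induction k generalizing i c with
  | zero =>
    simp only [countReturns, RandAlg.val_pure, PMF.mem_support_pure_iff] at ht
    omega
  | succ k ih =>
    rw [val_countReturns_succ, PMF.mem_support_bind_iff] at ht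
    obtain ⟨v, hiv, hv⟩ := ht
    have h1 := mem_support_nextNode (hG i) hiv
    have := ih hv
    by_cases hvs : v = s
    · have his : i ≠ s := by
        rintro rfl
        exact hloop i (hvs ▸ h1)
      simp only [hvs, if_true, his, if_false] at this ⊢
      omega
    · simp only [hvs, if_false] at this
      omega

/-- The law of the number of returns of one walk of the algorithm. -/
def returnLaw (G : Digraph (Fin n)) (ε : ℝ) (s : Fin n) : PMF ℕ :=
  (countReturns G s (walkLength G ε) s 0).val

/-- The expected number of returns of one walk of the algorithm. -/
def returnMean (G : Digraph (Fin n)) (ε : ℝ) (s : Fin n) : ℝ :=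
  expect (returnLaw G ε s) fun t => (t : ℝ)

/-- The variance of the number of returns of one walk of the algorithm. -/
def returnVar (G : Digraph (Fin n)) (ε : ℝ) (s : Fin n) : ℝ :=
  expect (returnLaw G ε s) fun t => ((t : ℝ) - returnMean G ε s) ^ 2

theorem finite_support_returnLaw (G : Digraph (Fin n)) (ε : ℝ) (s : Fin n) :
    (returnLaw G ε s).support.Finite := finite_support_countReturns G s _ _ _

theorem returnMean_eq (hG : ∀ i, (outNbrs G i).Nonempty) (ε : ℝ) (s : Fin n) :
    returnMean G ε s = ∑ t ∈ Finset.range (walkLength G ε), (transition G ^ (t + 1)) s s := by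
  rw [returnMean, returnLaw, expect_countReturns hG]
  simp

theorem returns_le (hG : ∀ i, (outNbrs G i).Nonempty) (hloop : ∀ i, ¬ G.Adj i i) {ε : ℝ}
    {s : Fin n} {t : ℕ} (ht : t ∈ (returnLaw G ε s).support) :
    (t : ℝ) ≤ (walkLength G ε : ℝ) / 2 := by
  have := countReturns_le hG hloop ht
  simp only [if_true] at this
  have h2 : ((2 * t : ℕ) : ℝ) ≤ (walkLength G ε : ℝ) := by exact_mod_cast (by omega)
  push_cast at h2
  linarith

theorem returnMean_nonneg (G : Digraph (Fin n)) (ε : ℝ) (s : Fin n) : 0 ≤ returnMean G ε s :=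
  expect_nonneg fun t _ => t.cast_nonneg

theorem returnMean_le (hG : ∀ i, (outNbrs G i).Nonempty) (hloop : ∀ i, ¬ G.Adj i i) (ε : ℝ)
    (s : Fin n) : returnMean G ε s ≤ (walkLength G ε : ℝ) / 2 :=
  (expect_mono (finite_support_returnLaw G ε s) fun _ ht => returns_le hG hloop ht).trans_eq
    (expect_const (finite_support_returnLaw G ε s) _)

theorem returnVar_nonneg (G : Digraph (Fin n)) (ε : ℝ) (s : Fin n) : 0 ≤ returnVar G ε s :=
  expect_nonneg fun _ _ => sq_nonneg _

theorem expect_sub_returnMean (G : Digraph (Fin n)) (ε : ℝ) (s : Fin n) :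
    expect (returnLaw G ε s) (fun t => (t : ℝ) - returnMean G ε s) = 0 := by
  rw [expect_sub (finite_support_returnLaw G ε s),
    expect_const (finite_support_returnLaw G ε s), ← returnMean, sub_self]

/-- Popoviciu's bound: for 0 ≤ t ≤ b the square (t − μ)² lies below the affine function b²/4 + (b −
2μ)(t − μ), whose mean is b²/4. -/
theorem returnVar_le (hG : ∀ i, (outNbrs G i).Nonempty) (hloop : ∀ i, ¬ G.Adj i i) (ε : ℝ)
    (s : Fin n) : returnVar G ε s ≤ ((walkLength G ε : ℝ) / 2) ^ 2 / 4 := by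
  have hf := finite_support_returnLaw G ε s
  set b : ℝ := (walkLength G ε : ℝ) / 2 with hb
  set μ := returnMean G ε s with hμ
  have h : returnVar G ε s ≤ expect (returnLaw G ε s)
      fun t => b ^ 2 / 4 + (b - 2 * μ) * ((t : ℝ) - μ) := by
    refine expect_mono hf fun t ht => ?_
    have h1 := returns_le hG hloop ht
    have h2 : (0 : ℝ) ≤ t := t.cast_nonneg
    have h3 : 0 ≤ (t : ℝ) * (b - t) := mul_nonneg h2 (sub_nonneg.2 h1)
    nlinarith [sq_nonneg (b - 2 * μ)]
  rwa [expect_add hf, expect_const hf, expect_const_mul, expect_sub_returnMean, mul_zero,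
    add_zero] at h

theorem abs_returns_sub_le (hG : ∀ i, (outNbrs G i).Nonempty) (hloop : ∀ i, ¬ G.Adj i i)
    {ε : ℝ} {s : Fin n} {t : ℕ} (ht : t ∈ (returnLaw G ε s).support) :
    |(t : ℝ) - returnMean G ε s| ≤ (walkLength G ε : ℝ) / 2 := by
  have h1 := returns_le hG hloop ht
  have h2 := returnMean_le hG hloop ε s
  have h3 := returnMean_nonneg G ε s
  have h4 : (0 : ℝ) ≤ t := t.cast_nonneg
  rw [abs_le]
  constructor <;> linarith

end returns

/-! ## Supermartingales along the simulation -/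

section simulation

variable {n : ℕ} {G : Digraph (Fin n)} {ε : ℝ} {s : Fin n}

/-- Optional stopping in potential form: Φ is a supermartingale along the pair (sum, sum of squares)
and dominates the payoff `g` wherever the loop may end. The predicate `I` is an invariant of the
reachable states. -/
theorem expect_simulate_le {g : ℝ → ℝ} {Φ : ℕ → ℝ → ℝ → ℝ} {I : ℕ → ℝ → ℝ → Prop} {r : ℕ}
    (hI : ∀ j a b, I j a b → ∀ t ∈ (returnLaw G ε s).support,
      I (j + 1) (a + t) (b + (t : ℝ) ^ 2))
    (hstep : ∀ j a b, I j a b →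
      expect (returnLaw G ε s) (fun t => Φ (j + 1) (a + t) (b + (t : ℝ) ^ 2)) ≤ Φ j a b)
    (hend : ∀ j a b, I j a b → 0 < j → (Stops G ε j a b ∨ j = r) → g (a / j) ≤ Φ j a b)
    (hr : 0 < r) (m j : ℕ) (a b : ℝ) (hj : j + m = r) (hjab : I j a b) :
    expect (simulate G ε s m j a b).val g ≤ Φ j a b := by
  classical
  induction m generalizing j a b with
  | zero =>
    rw [val_simulate_zero, expect_pure]
    exact hend j a b hjab (by omega) (Or.inr (by omega))
  | succ m ih =>
    rw [val_simulate_succ, ← returnLaw, expect_bind (finite_support_returnLaw G ε s)]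
    · refine (expect_mono (finite_support_returnLaw G ε s) fun t ht => ?_).trans
        (hstep j a b hjab)
      split_ifs with h
      · rw [expect_pure]
        exact hend _ _ _ (hI j a b hjab t ht) (by omega) (Or.inl h)
      · exact ih _ _ _ (by omega) (hI j a b hjab t ht)
    · intro t _
      split_ifs
      · simp
      · exact finite_support_simulate G ε s _ _ _ _

theorem mem_support_simulate (hG : ∀ i, (outNbrs G i).Nonempty) (hloop : ∀ i, ¬ G.Adj i i)
    {m j : ℕ} {a b : ℝ} (ha : 0 ≤ a) (ha' : a ≤ j * ((walkLength G ε : ℝ) / 2)) {y : ℝ}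
    (hy : y ∈ (simulate G ε s m j a b).val.support) :
    0 ≤ y ∧ y ≤ (walkLength G ε : ℝ) / 2 := by
  classical
  have key : ∀ (j : ℕ) (a : ℝ), 0 ≤ a → a ≤ j * ((walkLength G ε : ℝ) / 2) →
      0 ≤ a / j ∧ a / j ≤ (walkLength G ε : ℝ) / 2 := by
    intro j a ha ha'
    refine ⟨by positivity, ?_⟩
    rcases Nat.eq_zero_or_pos j with rfl | hj
    · simp only [Nat.cast_zero, div_zero]
      positivity
    · rwa [div_le_iff₀ (by positivity), mul_comm]
  induction m generalizing j a b with
  | zero =>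
    rw [val_simulate_zero, PMF.mem_support_pure_iff] at hy
    exact hy ▸ key j a ha ha'
  | succ m ih =>
    rw [val_simulate_succ, ← returnLaw, PMF.mem_support_bind_iff] at hy
    obtain ⟨t, ht, hy⟩ := hy
    have h1 := returns_le hG hloop ht
    have ht0 : 0 ≤ a + t := by positivity
    have ht1 : a + t ≤ (j + 1 : ℕ) * ((walkLength G ε : ℝ) / 2) := by push_cast; linarith
    split_ifs at hy
    · rw [PMF.mem_support_pure_iff] at hy
      exact hy ▸ key _ _ ht0 ht1
    · exact ih ht0 ht1 hy

/-- Each of the two summands of the Bernstein bound is at most ε/3. The linear one bounds `j` from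
below; the squared root one bounds the centred sum of squares b − a²/j from above. -/
theorem Stops.bounds (hn : 0 < n) {j : ℕ} {a b : ℝ} (hj : 0 < j)
    (h : Stops G ε j a b) :
    9 * ((walkLength G ε : ℝ) / 2) * Real.log (3 * n) ≤ j * ε ∧
      18 * Real.log (3 * n) * (b - a ^ 2 / j) ≤ (j : ℝ) ^ 2 * ε ^ 2 := by
  have hj' : (0 : ℝ) < j := by exact_mod_cast hj
  have hn' : (1 : ℝ) ≤ n := by exact_mod_cast hn
  have hL : 0 ≤ Real.log (3 * n) := Real.log_nonneg (by linarith)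
  unfold Stops bernstein at h
  rw [show (3 : ℝ) / (1 / n) = 3 * n by field_simp] at h
  constructor
  · have h1 : 3 * ((walkLength G ε : ℝ) / 2) * Real.log (3 * n) / j ≤ ε / 3 :=
      le_trans (le_add_of_nonneg_left (Real.sqrt_nonneg _)) h
    rw [div_le_iff₀ hj'] at h1
    linarith
  · have h2 : √(2 * (b / j - (a / j) ^ 2) * Real.log (3 * n) / j) ≤ ε / 3 :=
      le_trans (le_add_of_nonneg_right (by positivity)) h
    rw [Real.sqrt_le_iff, div_le_iff₀ hj'] at h2
    have h3 := h2.2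
    have h4 : (b - a ^ 2 / j) = (b / j - (a / j) ^ 2) * j := by field_simp
    rw [h4]
    nlinarith

/-- The expected squared error of the empirical mean at the stopping time, given a supermartingale
that controls the runs stopping before time `T`. -/
theorem expect_sq_simulate_le (hG : ∀ i, (outNbrs G i).Nonempty) (hloop : ∀ i, ¬ G.Adj i i)
    {r T : ℕ} (hT : 0 < T) (hTr : T ≤ r) {Ψ : ℕ → ℝ → ℝ → ℝ} (hΨ : ∀ j a b, 0 ≤ Ψ j a b)
    (hstep : ∀ j a b,
      expect (returnLaw G ε s) (fun t => Ψ (j + 1) (a + t) (b + (t : ℝ) ^ 2)) ≤ Ψ j a b)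
    (hend : ∀ (j : ℕ) (a b : ℝ),
      |a - j * returnMean G ε s| ≤ j * ((walkLength G ε : ℝ) / 2) → 0 < j → j < T →
      Stops G ε j a b → (a / j - returnMean G ε s) ^ 2 ≤ Ψ j a b) :
    expect (simulate G ε s r 0 0 0).val (fun y => (y - returnMean G ε s) ^ 2) ≤
      2 * returnVar G ε s / T + Ψ 0 0 0 := by
  have hf := finite_support_returnLaw G ε s
  set μ := returnMean G ε s with hμ
  set v := returnVar G ε s with hv
  have hv0 : 0 ≤ v := returnVar_nonneg G ε s
  have hT' : (0 : ℝ) < T := by exact_mod_cast hT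
  -- Weights as in the Hájek–Rényi inequality: dividing by max(j, T) reproduces the squared error of
  -- the mean for j ≥ T and caps the cost of the earlier steps.
  set w : ℕ → ℝ := fun j => ((max j T : ℕ) : ℝ) with hw
  have hwpos : ∀ j, 0 < w j := fun j => by
    simp only [hw]
    exact_mod_cast lt_max_of_lt_right hT
  -- An upper bound for the future increments ∑_{i > j} 1/w_i². For j ≥ T it comes from ∑_{i > j}
  -- 1/i² ≤ 1/j; before T it adds (T − j)/T². Its value 2/T at j = 0 is the first term of the claim.
  set β : ℕ → ℝ := fun j => if T ≤ j then 1 / (j : ℝ) else 2 / T - j / (T : ℝ) ^ 2 with hβ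
  have hβ0 : ∀ j, 0 ≤ β j := by
    intro j
    simp only [hβ]
    split_ifs with h
    · positivity
    · have h' : (j : ℝ) ≤ T := by exact_mod_cast (not_le.1 h).le
      rw [sub_nonneg, div_le_div_iff₀ (by positivity) hT']
      nlinarith [mul_le_mul_of_nonneg_right h' hT'.le]
  have hβstep : ∀ j, 1 / w (j + 1) ^ 2 + β (j + 1) ≤ β j := by
    intro j
    simp only [hβ, hw]
    by_cases h : T ≤ j
    · have hj : (0 : ℝ) < j := by exact_mod_cast hT.trans_le h
      rw [if_pos (by omega), if_pos h, max_eq_left (by omega)]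
      push_cast
      have e : 1 / (j : ℝ) - (1 / ((j : ℝ) + 1) ^ 2 + 1 / ((j : ℝ) + 1)) =
          1 / ((j : ℝ) * ((j : ℝ) + 1) ^ 2) := by field_simp; ring
      have : 0 ≤ 1 / ((j : ℝ) * ((j : ℝ) + 1) ^ 2) := by positivity
      linarith
    · rw [if_neg h, max_eq_right (by omega)]
      by_cases h1 : T ≤ j + 1
      · have hTj : T = j + 1 := by omega
        rw [if_pos h1]
        have e : (j : ℝ) = T - 1 := by rw [hTj]; push_cast; ring
        have e' : ((j + 1 : ℕ) : ℝ) = T := by rw [hTj]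
        rw [e', e]
        apply le_of_eq
        field_simp
        ring
      · rw [if_neg h1]
        push_cast
        apply le_of_eq
        field_simp
        ring
  have key := expect_simulate_le (G := G) (ε := ε) (s := s) (r := r)
    (g := fun y => (y - μ) ^ 2)
    (Φ := fun j a b => (a - j * μ) ^ 2 / w j ^ 2 + v * β j + Ψ j a b)
    (I := fun j a _ => |a - j * μ| ≤ j * ((walkLength G ε : ℝ) / 2))
    (by
      intro j a _ h t ht
      have h1 := abs_returns_sub_le hG hloop ht
      have e : a + t - (j + 1 : ℕ) * μ = (a - j * μ) + (t - μ) := by push_cast; ring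
      rw [e]
      refine (abs_add_le _ _).trans ?_
      push_cast
      linarith)
    (by
      intro j a b _
      rw [expect_add hf, expect_add hf, expect_const hf]
      simp only [div_eq_mul_inv]
      rw [expect_mul_const]
      have e : expect (returnLaw G ε s) (fun t => (a + t - (j + 1 : ℕ) * μ) ^ 2) =
          (a - j * μ) ^ 2 + v := by
        have : ∀ t : ℕ, (a + t - (j + 1 : ℕ) * μ) ^ 2 =
            (a - j * μ) ^ 2 + (2 * (a - j * μ)) * ((t : ℝ) - μ) + ((t : ℝ) - μ) ^ 2 := by
          intro t
          push_cast
          ring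
        simp only [this]
        rw [expect_add hf, expect_add hf, expect_const hf, expect_const_mul,
          expect_sub_returnMean, hv, returnVar]
        ring
      rw [e]
      have h1 := hβstep j
      have h2 : (w (j + 1) ^ 2)⁻¹ ≤ (w j ^ 2)⁻¹ := by
        have := hwpos j
        have h3 : w j ≤ w (j + 1) := by
          simp only [hw]
          exact_mod_cast max_le_max (by omega) le_rfl
        gcongr
      have h4 := hstep j a b
      rw [one_div] at h1
      nlinarith [mul_le_mul_of_nonneg_left h1 hv0,
        mul_le_mul_of_nonneg_left h2 (sq_nonneg (a - j * μ))])
    (by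
      intro j a b hI hj h
      have hj' : (0 : ℝ) < j := by exact_mod_cast hj
      by_cases hjT : j < T
      · have h' : Stops G ε j a b := h.resolve_right (by omega)
        have h1 := hend j a b hI hj hjT h'
        have h2 : 0 ≤ (a - j * μ) ^ 2 / w j ^ 2 := by positivity
        have h3 := mul_nonneg hv0 (hβ0 j)
        linarith
      · have e : w j = j := by simp only [hw]; rw [max_eq_left (by omega)]
        have e2 : (a / j - μ) ^ 2 = (a - j * μ) ^ 2 / w j ^ 2 := by
          rw [e]
          field_simp
        have h3 := mul_nonneg hv0 (hβ0 j)
        have h4 := hΨ j a b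
        linarith)
    (by omega) r 0 0 0 (by omega) (by simp)
  refine key.trans (le_of_eq ?_)
  have : β 0 = 2 / T := by simp [hβ, hT.ne']
  rw [this]
  simp
  ring

end simulation

/-! ## The second moment of the empirical mean at the stopping time -/

/-! ### Numerical inequalities for the second moment -/

section numeric

theorem log_three_mul_ge {n : ℕ} (hn : 3 ≤ n) : 2.19 ≤ Real.log (3 * n) := by
  have h3 : (3 : ℝ) ≤ n := by exact_mod_cast hn
  have h1 : Real.log 9 ≤ Real.log (3 * n) := Real.log_le_log (by norm_num) (by linarith)
  have h2 : Real.log 9 = 3 * Real.log 2 + Real.log (9 / 8) := by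
    rw [Real.log_div (by norm_num) (by norm_num), show (8 : ℝ) = 2 ^ 3 by norm_num, Real.log_pow]
    push_cast
    ring
  have h4 := Real.one_sub_inv_le_log_of_pos (show (0 : ℝ) < 9 / 8 by norm_num)
  have h5 := Real.log_two_gt_d9
  norm_num at h4
  linarith

theorem one_le_log_two_mul {n : ℕ} (hn : 3 ≤ n) : 1 ≤ Real.log (2 * n) := by
  have h3 : (3 : ℝ) ≤ n := by exact_mod_cast hn
  rw [Real.le_log_iff_exp_le (by linarith)]
  have := Real.exp_one_lt_d9
  linarith

theorem log_three_mul_le {n : ℕ} (hn : 3 ≤ n) : Real.log (3 * n) ≤ 2 * Real.log (2 * n) := by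
  have h3 : (3 : ℝ) ≤ n := by exact_mod_cast hn
  rw [show 2 * Real.log (2 * (n : ℝ)) = Real.log ((2 * n) ^ 2) by rw [Real.log_pow]; push_cast; ring]
  exact Real.log_le_log (by linarith) (by nlinarith)

/-- The self-normalising inequality: the penalty 0.15 y² in the exponent outweighs the second-order
term of exp and still leaves a gain of 0.06 y². -/
theorem exp_linear_sub_sq_le {y : ℝ} (hy : |y| ≤ 1) :
    Real.exp (0.3 * y - 0.15 * y ^ 2) ≤ 1 + 0.3 * y - 0.06 * y ^ 2 := by
  obtain ⟨h1, h2⟩ := abs_le.1 hy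
  set w : ℝ := 0.3 - 0.15 * y with hw
  have hw1 : 0.15 ≤ w := by linarith
  have hw2 : w ≤ 0.45 := by linarith
  have hu : 0.3 * y - 0.15 * y ^ 2 = y * w := by rw [hw]; ring
  rw [hu]
  have habs : |y * w| ≤ 1 := by
    rw [abs_mul, abs_of_nonneg (by linarith : 0 ≤ w)]
    nlinarith [abs_nonneg y]
  have hb := (abs_le.1 (Real.exp_bound habs (n := 4) (by norm_num))).2
  have h4 : |y * w| ^ 4 = (y * w) ^ 4 := by
    rw [show 4 = 2 * 2 by norm_num, pow_mul, sq_abs, pow_mul]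
  rw [h4] at hb
  norm_num [Finset.sum_range_succ, Nat.factorial] at hb
  -- The exponent is u = y w, and its own quadratic part is −0.15 y². After division by y², the
  -- Taylor terms of order two and more may use up 0.15 − 0.06 = 0.09.
  have hpoly : w ^ 2 / 2 + y * w ^ 3 / 6 + y ^ 2 * w ^ 4 * (5 / 96) ≤ 0.09 + 0.0125 - 0.0125 := by
    have hy' : y = (0.3 - w) / 0.15 := by rw [hw]; ring
    rw [hy']
    have hw0 : 0 ≤ w := by linarith
    nlinarith [mul_nonneg (sub_nonneg.2 hw1) (sub_nonneg.2 hw2), pow_nonneg hw0 2,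
      pow_nonneg hw0 3, mul_nonneg (mul_nonneg (sub_nonneg.2 hw1) (sub_nonneg.2 hw2)) hw0,
      mul_nonneg (mul_nonneg (sub_nonneg.2 hw1) (sub_nonneg.2 hw2)) (pow_nonneg hw0 2),
      mul_nonneg (mul_nonneg (sub_nonneg.2 hw1) (sub_nonneg.2 hw2)) (pow_nonneg hw0 3),
      mul_nonneg (mul_nonneg (sub_nonneg.2 hw1) (sub_nonneg.2 hw2)) (pow_nonneg hw0 4)]
  nlinarith [mul_le_mul_of_nonneg_left hpoly (sq_nonneg y)]

/-- The maximum of y exp(−3y/8) is 8/(3e) < 0.99, and 0.9801 = 0.99². -/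
theorem sq_le_exp_of_quarter {y : ℝ} (hy : 0 ≤ y) :
    y ^ 2 ≤ 0.9801 * Real.exp (y - y / 4) := by
  have h1 := Real.add_one_le_exp (3 * y / 8 - 1)
  have h2 : Real.exp (3 * y / 8 - 1) * Real.exp 1 = Real.exp (3 * y / 8) := by
    rw [← Real.exp_add]
    congr 1
    ring
  have h3 := Real.exp_one_gt_d9
  have h4 : y ≤ 0.99 * Real.exp (3 * y / 8) := by
    rw [← h2]
    nlinarith [Real.exp_pos (3 * y / 8 - 1)]
  have h5 : Real.exp (y - y / 4) = Real.exp (3 * y / 8) ^ 2 := by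
    rw [← Real.exp_nat_mul]
    congr 1
    push_cast
    ring
  rw [h5]
  nlinarith

theorem sq_le_exp_of_half {y : ℝ} (hy : 20 ≤ y) :
    y ^ 2 ≤ 0.9801 * Real.exp (y - y / 2) := by
  have h1 := Real.pow_div_factorial_le_exp (y / 2) (by linarith) 4
  have e : y - y / 2 = y / 2 := by ring
  rw [e]
  norm_num [Nat.factorial] at h1
  have : 400 ≤ y ^ 2 := by nlinarith
  nlinarith

/-- With y = 0.3|S|/b, the subtracted term is y · |S|/(2xb). It is at most y/4 if |S| ≤ xb/2.
Otherwise it is at most y/2, but then y ≥ 0.075 · 149 is not needed to be small: the fourth Taylor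
term of exp(y/2) wins as soon as y ≥ 20, and here y ≥ 0.15 · 149. -/
theorem sq_le_exp_sub {b x S : ℝ} (hb : 0 < b) (hx : 149 ≤ x) (hS : |S| ≤ x * b) :
    (0.3 * (|S| / b)) ^ 2 ≤
      0.9801 * Real.exp (0.3 * (|S| / b) - 0.15 * (S ^ 2 / x / b ^ 2)) := by
  have hx0 : 0 < x := by linarith
  have hpm : 0.15 * (S ^ 2 / x / b ^ 2) = 0.3 * (|S| / b) * (|S| / (2 * x * b)) := by
    rw [← sq_abs S]
    field_simp
    norm_num
    ring
  rw [hpm]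
  set y := 0.3 * (|S| / b) with hy
  have hy0 : 0 ≤ y := by positivity
  rcases le_total (|S|) (x * b / 2) with hm | hm
  · refine (sq_le_exp_of_quarter hy0).trans ?_
    have h1 : |S| / (2 * x * b) ≤ 1 / 4 := by
      rw [div_le_div_iff₀ (by positivity) (by norm_num)]
      linarith
    have h2 : y * (|S| / (2 * x * b)) ≤ y / 4 := by
      linarith [mul_le_mul_of_nonneg_left h1 hy0]
    gcongr
  · have hy20 : 20 ≤ y := by
      have h1 : 1 / 2 * x ≤ |S| / b := by
        rw [le_div_iff₀ hb]
        linarith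
      rw [hy]
      linarith
    refine (sq_le_exp_of_half hy20).trans ?_
    have h1 : |S| / (2 * x * b) ≤ 1 / 2 := by
      rw [div_le_div_iff₀ (by positivity) (by norm_num)]
      linarith
    have h2 : y * (|S| / (2 * x * b)) ≤ y / 2 := by
      linarith [mul_le_mul_of_nonneg_left h1 hy0]
    gcongr

end numeric

/-! ### Mean square error of the stopped mean: small and large variance -/

section secondMoment

variable {n : ℕ} {G : Digraph (Fin n)} {ε : ℝ} {s : Fin n}

theorem maxWalks_ge (G : Digraph (Fin n)) (ε : ℝ) :
    9 * ((walkLength G ε : ℝ) / 2) ^ 2 / ε ^ 2 * Real.log (2 * n) ≤ maxWalks G ε := by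
  refine le_trans (le_of_eq ?_) (Nat.le_ceil _)
  rw [inv_pow, div_eq_mul_inv _ (ε ^ 2)]
  ring

/-- The linear Bernstein term excludes stopping before 9bL/ε, where b = l/2 and L = log(3n). So no
correction Ψ is needed and the error is at most 2v/T. -/
theorem second_moment_of_small_var (hn : 3 ≤ n) (hG : ∀ i, (outNbrs G i).Nonempty)
    (hloop : ∀ i, ¬ G.Adj i i) (hε : 0 < ε) (hl : 0 < walkLength G ε)
    (hv : returnVar G ε s ≤ 1.9 * ((walkLength G ε : ℝ) / 2) * ε) :
    expect (simulate G ε s (maxWalks G ε) 0 0 0).val (fun y => (y - returnMean G ε s) ^ 2) ≤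
      0.2 * ε ^ 2 := by
  set b : ℝ := (walkLength G ε : ℝ) / 2 with hb
  have hb0 : 0 < b := by positivity
  have hL := log_three_mul_ge hn
  have hL2 := one_le_log_two_mul hn
  have hv0 := returnVar_nonneg G ε s
  have hvb := returnVar_le hG hloop ε s
  rw [← hb] at hvb
  set L := Real.log (3 * n) with hLdef
  have hr := maxWalks_ge G ε
  rw [← hb] at hr
  have hr' : 9 * b ^ 2 / ε ^ 2 ≤ maxWalks G ε :=
    le_trans (le_mul_of_one_le_right (by positivity) hL2) hr
  have hrpos : (0 : ℝ) < maxWalks G ε := lt_of_lt_of_le (by positivity) hr'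
  have hj0 : 0 < 9 * b * L / ε := by positivity
  set T := min ⌈9 * b * L / ε⌉₊ (maxWalks G ε) with hT
  have hTpos : 0 < T := lt_min (Nat.ceil_pos.2 hj0) (by exact_mod_cast hrpos)
  have h := expect_sq_simulate_le (s := s) hG hloop hTpos (min_le_right _ _)
    (Ψ := fun _ _ _ => 0) (fun _ _ _ => le_rfl)
    (fun _ _ _ => (expect_const (finite_support_returnLaw G ε s) 0).le)
    (by
      intro j a c _ hj hjT hs
      have h1 := (hs.bounds (by omega) hj).1
      have h2 : 9 * b * L / ε ≤ j := by rwa [div_le_iff₀ hε]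
      have h3 := Nat.ceil_le.2 h2
      exact absurd (hjT.trans_le ((min_le_left _ _).trans h3)) (lt_irrefl _))
  refine h.trans ?_
  have hT' : (0 : ℝ) < T := by exact_mod_cast hTpos
  rw [add_zero, div_le_iff₀ hT']
  rcases min_choice ⌈9 * b * L / ε⌉₊ (maxWalks G ε) with h1 | h1
  · have h2 : 9 * b * L / ε ≤ T := by rw [hT, h1]; exact Nat.le_ceil _
    have h3 : 0.2 * ε ^ 2 * (9 * b * L / ε) ≤ 0.2 * ε ^ 2 * T := by gcongr
    -- The threshold 1.9 fits here: since L ≥ 2.19, 1.8 bεL exceeds 3.8 bε ≥ 2v.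
    have h4 : 0.2 * ε ^ 2 * (9 * b * L / ε) = 1.8 * (b * ε) * L := by field_simp; ring
    nlinarith [mul_pos hb0 hε]
  · have h2 : 9 * b ^ 2 / ε ^ 2 ≤ T := by rw [hT, h1]; exact hr'
    have h3 : 0.2 * ε ^ 2 * (9 * b ^ 2 / ε ^ 2) ≤ 0.2 * ε ^ 2 * T := by gcongr
    have h4 : 0.2 * ε ^ 2 * (9 * b ^ 2 / ε ^ 2) = 1.8 * b ^ 2 := by field_simp; ring
    nlinarith

/-- The one-step supermartingale estimate: take the mean of `exp_linear_sub_sq_le`, in which the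
linear term vanishes, and use 1 − x ≤ exp(−x). -/
theorem expect_exp_le (hG : ∀ i, (outNbrs G i).Nonempty) (hloop : ∀ i, ¬ G.Adj i i)
    (hl : 0 < walkLength G ε) {σ : ℝ} (hσ : |σ| = 1) :
    expect (returnLaw G ε s) (fun t => Real.exp
      (0.3 * (σ * ((t : ℝ) - returnMean G ε s) / ((walkLength G ε : ℝ) / 2)) -
        0.15 * (((t : ℝ) - returnMean G ε s) / ((walkLength G ε : ℝ) / 2)) ^ 2)) ≤
      Real.exp (-(0.06 * (returnVar G ε s / ((walkLength G ε : ℝ) / 2) ^ 2))) := by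
  have hf := finite_support_returnLaw G ε s
  set b : ℝ := (walkLength G ε : ℝ) / 2 with hb
  have hb0 : 0 < b := by positivity
  set μ := returnMean G ε s
  have hσ2 : σ ^ 2 = 1 := by rw [← sq_abs, hσ, one_pow]
  have h : expect (returnLaw G ε s) (fun t => Real.exp
      (0.3 * (σ * ((t : ℝ) - μ) / b) - 0.15 * (((t : ℝ) - μ) / b) ^ 2)) ≤
      expect (returnLaw G ε s) (fun t => 1 + (0.3 * σ / b) * ((t : ℝ) - μ) +
        (-(0.06 / b ^ 2)) * ((t : ℝ) - μ) ^ 2) := by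
    refine expect_mono hf fun t ht => ?_
    have h1 := abs_returns_sub_le hG hloop ht
    have h2 : |σ * ((t : ℝ) - μ) / b| ≤ 1 := by
      rw [abs_div, abs_mul, hσ, one_mul, abs_of_pos hb0, div_le_one hb0]
      exact h1
    have h3 := exp_linear_sub_sq_le h2
    have e : (σ * ((t : ℝ) - μ) / b) ^ 2 = (((t : ℝ) - μ) / b) ^ 2 := by
      rw [mul_div_assoc, mul_pow, hσ2, one_mul]
    rw [e] at h3
    refine h3.trans (le_of_eq ?_)
    ring
  refine h.trans ?_
  rw [expect_add hf, expect_add hf, expect_const hf, expect_const_mul, expect_const_mul,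
    expect_sub_returnMean]
  have h4 := Real.add_one_le_exp (-(0.06 * (returnVar G ε s / b ^ 2)))
  refine le_trans (le_of_eq ?_) h4
  rw [returnVar]
  ring

-- Stopping before T requires an empirical variance far below v. In that event the supermartingales
-- `E 1` and `E (-1)`, which both start at 1, dominate the squared error up to the factor B; so
-- early stopping costs at most 2B in the mean.
set_option maxHeartbeats 1000000 in
theorem second_moment_of_large_var (hn : 3 ≤ n) (hG : ∀ i, (outNbrs G i).Nonempty)
    (hloop : ∀ i, ¬ G.Adj i i) (hε : 0 < ε) (hl : 0 < walkLength G ε)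
    (hv : 1.9 * ((walkLength G ε : ℝ) / 2) * ε ≤ returnVar G ε s) :
    expect (simulate G ε s (maxWalks G ε) 0 0 0).val (fun y => (y - returnMean G ε s) ^ 2) ≤
      0.2 * ε ^ 2 := by
  have hf := finite_support_returnLaw G ε s
  have hexp := fun σ (hσ : |σ| = 1) => expect_exp_le (s := s) hG hloop hl hσ
  set b : ℝ := (walkLength G ε : ℝ) / 2 with hb
  have hb0 : 0 < b := by positivity
  have hL := log_three_mul_ge hn
  have hL2 := one_le_log_two_mul hn
  have hL3 := log_three_mul_le hn
  have hvb := returnVar_le hG hloop ε s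
  rw [← hb] at hvb
  set L := Real.log (3 * n) with hLdef
  have hr := maxWalks_ge G ε
  rw [← hb] at hr
  set v := returnVar G ε s with hvdef
  set μ := returnMean G ε s with hμ
  have hvpos : 0 < v := lt_of_lt_of_le (by positivity) hv
  have hbε : 7.6 * ε ≤ b := by nlinarith
  have hTr0 : 0 < 7.2 * L * v / ε ^ 2 := by positivity
  clear_value b L v μ
  -- Here 7.2 = 18 · 0.4: a stop before T makes the centred sum of squares about the empirical mean
  -- at most 0.4 vj.
  set T := ⌈7.2 * L * v / ε ^ 2⌉₊ with hT
  have hTpos : 0 < T := Nat.ceil_pos.2 hTr0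
  have hTr : T ≤ maxWalks G ε := by
    refine Nat.ceil_le.2 (le_trans ?_ hr)
    rw [div_mul_eq_mul_div]
    refine div_le_div_of_nonneg_right ?_ (by positivity)
    nlinarith [mul_le_mul hvb hL3 (by linarith) (by positivity)]
  -- The factor 0.9801 comes from `sq_le_exp_sub`; the rest is (b/(0.3 j))² at the smallest possible
  -- stopping time 9bL/ε.
  set B : ℝ := 0.9801 * (b / (0.3 * (9 * b * L / ε))) ^ 2 with hB
  have hB0 : 0 ≤ B := by positivity
  -- The expression c − 2μa + jμ² is the sum of the (t − μ)². The compensator 0.06 v j/b² restores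
  -- the loss in `expect_exp_le`.
  set E : ℝ → ℕ → ℝ → ℝ → ℝ := fun σ j a c => Real.exp (0.3 * (σ * (a - j * μ) / b) -
    0.15 * ((c - 2 * μ * a + j * μ ^ 2) / b ^ 2) + 0.06 * (v / b ^ 2) * j) with hE
  have hEstep : ∀ σ, |σ| = 1 → ∀ (j : ℕ) (a c : ℝ),
      expect (returnLaw G ε s) (fun t => E σ (j + 1) (a + t) (c + (t : ℝ) ^ 2)) ≤ E σ j a c := by
    intro σ hσ j a c
    have h1 : ∀ t : ℕ, E σ (j + 1) (a + t) (c + (t : ℝ) ^ 2) =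
        E σ j a c * Real.exp (0.06 * (v / b ^ 2)) * Real.exp (0.3 * (σ * ((t : ℝ) - μ) / b) -
          0.15 * (((t : ℝ) - μ) / b) ^ 2) := by
      intro t
      simp only [hE, ← Real.exp_add]
      congr 1
      push_cast
      field_simp
      ring
    simp only [h1]
    rw [expect_const_mul]
    calc _ ≤ E σ j a c * Real.exp (0.06 * (v / b ^ 2)) * Real.exp (-(0.06 * (v / b ^ 2))) :=
          mul_le_mul_of_nonneg_left (hexp σ hσ) (by simp only [hE]; positivity)
      _ = E σ j a c := by rw [mul_assoc, ← Real.exp_add, add_neg_cancel, Real.exp_zero, mul_one]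
  have h := expect_sq_simulate_le (s := s) hG hloop hTpos hTr
    (Ψ := fun j a c => B * (E 1 j a c + E (-1) j a c))
    (fun j a c => by simp only [hE]; positivity)
    (by
      intro j a c
      rw [expect_const_mul, expect_add hf]
      exact mul_le_mul_of_nonneg_left
        (add_le_add (hEstep 1 (by simp) j a c) (hEstep (-1) (by simp) j a c)) hB0)
    (by
      intro j a c hI hj hjT hs
      have hj' : (0 : ℝ) < j := by exact_mod_cast hj
      obtain ⟨hs1, hs2⟩ := hs.bounds (by omega) hj
      rw [← hb, ← hLdef] at hs1
      rw [← hb, ← hμ] at hI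
      rw [← hμ]
      have hj0 : 9 * b * L / ε ≤ j := by rwa [div_le_iff₀ hε]
      have hjT' : (j : ℝ) * ε ^ 2 < 7.2 * L * v := by
        have := Nat.lt_ceil.1 hjT
        rwa [lt_div_iff₀ (by positivity)] at this
      set S := a - j * μ with hS
      set Q := c - 2 * μ * a + j * μ ^ 2 with hQ
      have hQle : Q ≤ 0.4 * v * j + S ^ 2 / j := by
        have e : c - a ^ 2 / j = Q - S ^ 2 / j := by
          rw [hQ, hS]
          field_simp
          ring
        rw [← hLdef, e] at hs2
        have h1 : 18 * L * (Q - S ^ 2 / j) ≤ 18 * L * (0.4 * v * j) := by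
          nlinarith [mul_le_mul_of_nonneg_right hjT'.le hj'.le]
        have := le_of_mul_le_mul_left h1 (by positivity)
        linarith
      set y := 0.3 * (|S| / b) with hy
      have hy0 : 0 ≤ y := by positivity
      set p := 0.15 * (S ^ 2 / j / b ^ 2) with hp
      have hEy : Real.exp (y - p) ≤ E 1 j a c + E (-1) j a c := by
        -- Since 0.15 · 0.4 = 0.06, the compensator cancels the variance part of Q exactly, and only
        -- the term from the deviation S of the mean survives.
        have hlow : -p ≤ - 0.15 * (Q / b ^ 2) + 0.06 * (v / b ^ 2) * j := by
          have : Q / b ^ 2 ≤ (0.4 * v * j + S ^ 2 / j) / b ^ 2 := by gcongr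
          have e : (0.4 * v * j + S ^ 2 / j) / b ^ 2 =
            0.4 * (v / b ^ 2) * j + S ^ 2 / j / b ^ 2 := by ring
          rw [e] at this
          rw [hp]
          linarith
        rcases abs_cases S with ⟨hSa, _⟩ | ⟨hSa, _⟩
        · have h1 : Real.exp (y - p) ≤ E 1 j a c := by
            refine Real.exp_le_exp.2 ?_
            rw [hy, hSa, one_mul]
            linarith
          have h2 : 0 ≤ E (-1) j a c := (Real.exp_pos _).le
          linarith
        · have h1 : Real.exp (y - p) ≤ E (-1) j a c := by
            refine Real.exp_le_exp.2 ?_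
            rw [hy, hSa, neg_one_mul]
            linarith
          have h2 : 0 ≤ E 1 j a c := (Real.exp_pos _).le
          linarith
      -- From 1.9 bε ≤ v ≤ b²/4 follows b ≥ 7.6 ε, and 9 · 7.6 · 2.19 > 149.
      have hj149 : 149 ≤ (j : ℝ) := by
        refine le_trans ?_ hj0
        rw [le_div_iff₀ hε]
        have := mul_le_mul hbε hL (by norm_num) hb0.le
        linarith
      have hpy : y ^ 2 ≤ 0.9801 * Real.exp (y - p) := sq_le_exp_sub hb0 hj149 hI
      have hYeq : (a / j - μ) ^ 2 = (b / (0.3 * j)) ^ 2 * y ^ 2 := by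
        have : a / j - μ = S / j := by rw [hS]; field_simp
        rw [this, hy, mul_pow, div_pow |S|, sq_abs]
        field_simp
      rw [hYeq, hB]
      have h5 : (b / (0.3 * j)) ^ 2 ≤ (b / (0.3 * (9 * b * L / ε))) ^ 2 := by gcongr
      calc (b / (0.3 * j)) ^ 2 * y ^ 2
          ≤ (b / (0.3 * (9 * b * L / ε))) ^ 2 * (0.9801 * Real.exp (y - p)) := by gcongr
        _ ≤ (b / (0.3 * (9 * b * L / ε))) ^ 2 * (0.9801 * (E 1 j a c + E (-1) j a c)) := by
          gcongr
        _ = _ := by ring)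
  rw [← hvdef, ← hμ] at h
  refine h.trans ?_
  have hE0 : ∀ σ, E σ 0 0 0 = 1 := by intro σ; simp [hE]
  rw [hE0, hE0]
  -- Final count: 2v/T contributes at most 0.13 ε² and each of the two copies of B at most 0.03 ε²,
  -- together below 0.2 ε².
  have h1 : 2 * v / T ≤ 2 * v / (7.2 * L * v / ε ^ 2) := by
    gcongr
    exact Nat.le_ceil _
  have h2 : 2 * v / (7.2 * L * v / ε ^ 2) = (2 / 7.2) / L * ε ^ 2 := by field_simp
  have h3 : (2 / 7.2 : ℝ) / L ≤ 0.13 := by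
    rw [div_le_iff₀ (by positivity)]
    norm_num
    linarith
  have h4 : B = 0.9801 / (7.29 * L ^ 2) * ε ^ 2 := by
    rw [hB]
    field_simp
    norm_num
  have h5 : (0.9801 : ℝ) / (7.29 * L ^ 2) ≤ 0.03 := by
    rw [div_le_iff₀ (by positivity)]
    nlinarith
  rw [h4]
  rw [h2] at h1
  nlinarith [sq_nonneg ε, mul_le_mul_of_nonneg_right h3 (sq_nonneg ε),
    mul_le_mul_of_nonneg_right h5 (sq_nonneg ε)]

theorem second_moment_le (hn : 3 ≤ n) (hG : ∀ i, (outNbrs G i).Nonempty)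
    (hloop : ∀ i, ¬ G.Adj i i) (hε : 0 < ε) (hl : 0 < walkLength G ε) (s : Fin n) :
    expect (simulate G ε s (maxWalks G ε) 0 0 0).val (fun y => (y - returnMean G ε s) ^ 2) ≤
      0.2 * ε ^ 2 :=
  (le_total _ _).elim (second_moment_of_small_var hn hG hloop hε hl)
    (second_moment_of_large_var hn hG hloop hε hl)

end secondMoment

/-! ## Sampling without replacement -/

section maclaurin

variable {ι : Type*} [Fintype ι] [DecidableEq ι]

/-- Double counting: a set with a marked element corresponds to a smaller set with a marked element
outside it. -/
theorem sum_powersetCard_succ_sum (k : ℕ) (F : Finset ι → ι → ℝ) :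
    ∑ T ∈ Finset.powersetCard (k + 1) Finset.univ, ∑ i ∈ T, F (T.erase i) i =
      ∑ U ∈ Finset.powersetCard k Finset.univ, ∑ i ∈ Uᶜ, F U i := by
  rw [Finset.sum_sigma', Finset.sum_sigma']
  refine Finset.sum_nbij' (fun x => ⟨x.1.erase x.2, x.2⟩) (fun x => ⟨insert x.2 x.1, x.2⟩)
    ?_ ?_ ?_ ?_ ?_
  · rintro ⟨T, i⟩ h
    simp only [Finset.mem_sigma, Finset.mem_powersetCard_univ] at h
    simp only [Finset.mem_sigma, Finset.mem_powersetCard_univ, Finset.mem_compl]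
    exact ⟨by rw [Finset.card_erase_of_mem h.2, h.1]; rfl, by simp⟩
  · rintro ⟨U, i⟩ h
    simp only [Finset.mem_sigma, Finset.mem_powersetCard_univ, Finset.mem_compl] at h
    simp only [Finset.mem_sigma, Finset.mem_powersetCard_univ]
    exact ⟨by rw [Finset.card_insert_of_notMem h.2, h.1], by simp⟩
  · rintro ⟨T, i⟩ h
    simp only [Finset.mem_sigma] at h
    simp [Finset.insert_erase h.2]
  · rintro ⟨U, i⟩ h
    simp only [Finset.mem_sigma, Finset.mem_compl] at h
    simp [Finset.erase_insert h.2]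
  · rintro ⟨T, i⟩ _
    rfl

/-- The elementary symmetric sums of real numbers. -/
def elemSum (m : ι → ℝ) (k : ℕ) : ℝ := ∑ S ∈ Finset.powersetCard k Finset.univ, ∏ i ∈ S, m i

theorem succ_mul_elemSum (m : ι → ℝ) (k : ℕ) : ((k : ℝ) + 1) * elemSum m (k + 1) =
    ∑ U ∈ Finset.powersetCard k Finset.univ, (∏ i ∈ U, m i) * ∑ i ∈ Uᶜ, m i := by
  simp only [Finset.mul_sum]
  rw [← sum_powersetCard_succ_sum k fun U i => (∏ i ∈ U, m i) * m i, elemSum, Finset.mul_sum]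
  refine Finset.sum_congr rfl fun T hT => ?_
  rw [Finset.mem_powersetCard_univ] at hT
  rw [Finset.sum_congr rfl fun i hi => Finset.prod_erase_mul T m hi, Finset.sum_const, hT,
    nsmul_eq_mul]
  push_cast
  ring

/-- This is e_{k+1}/C(N,k+1) ≤ (e_1/N) · e_k/C(N,k) in cleared form. In the product e_1 e_k, the
added index is either new, giving (k+1) e_{k+1}, or repeated, giving A. It remains to bound e_{k+1}
by A. -/
theorem card_mul_elemSum_succ_le {m : ι → ℝ} (hm : ∀ i, 0 ≤ m i) {k : ℕ}
    (hk : k ≤ Fintype.card ι) :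
    (Fintype.card ι : ℝ) * (((k : ℝ) + 1) * elemSum m (k + 1)) ≤
      ((Fintype.card ι : ℝ) - k) * (∑ i, m i) * elemSum m k := by
  have hk' : (k : ℝ) ≤ Fintype.card ι := by exact_mod_cast hk
  have hsplit : (∑ i, m i) * elemSum m k = ((k : ℝ) + 1) * elemSum m (k + 1) +
      ∑ U ∈ Finset.powersetCard k Finset.univ, (∏ i ∈ U, m i) * ∑ i ∈ U, m i := by
    rw [succ_mul_elemSum, ← Finset.sum_add_distrib, elemSum, Finset.mul_sum]
    refine Finset.sum_congr rfl fun U _ => ?_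
    rw [← Finset.sum_add_sum_compl U m]
    ring
  rw [mul_assoc, hsplit]
  set A := ∑ U ∈ Finset.powersetCard k Finset.univ, (∏ i ∈ U, m i) * ∑ i ∈ U, m i with hA
  suffices h : (k : ℝ) * (((k : ℝ) + 1) * elemSum m (k + 1)) ≤ ((Fintype.card ι : ℝ) - k) * A by
    nlinarith
  cases k with
  | zero =>
    have : 0 ≤ A := Finset.sum_nonneg fun U _ =>
      mul_nonneg (Finset.prod_nonneg fun i _ => hm i) (Finset.sum_nonneg fun i _ => hm i)
    simpa using mul_nonneg (Nat.cast_nonneg (Fintype.card ι)) this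
  | succ k =>
    have hA' : A = ∑ W ∈ Finset.powersetCard k Finset.univ, (∏ i ∈ W, m i) * ∑ i ∈ Wᶜ, m i ^ 2 := by
      simp only [hA, Finset.mul_sum]
      rw [← sum_powersetCard_succ_sum k fun W i => (∏ i ∈ W, m i) * m i ^ 2]
      refine Finset.sum_congr rfl fun T _ => Finset.sum_congr rfl fun i hi => ?_
      rw [← Finset.prod_erase_mul T m hi]
      ring
    have hB : ∑ W ∈ Finset.powersetCard k Finset.univ, (∏ i ∈ W, m i) * (∑ i ∈ Wᶜ, m i) ^ 2 =
        A + ((k : ℝ) + 1) * (((k + 1 : ℕ) : ℝ) + 1) * elemSum m (k + 1 + 1) := by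
      have h1 : ((k : ℝ) + 1) * (((k + 1 : ℕ) : ℝ) + 1) * elemSum m (k + 1 + 1) =
          ∑ W ∈ Finset.powersetCard k Finset.univ, ∑ i ∈ Wᶜ,
            (∏ i ∈ W, m i) * m i * ((∑ j ∈ Wᶜ, m j) - m i) := by
        rw [mul_assoc, succ_mul_elemSum, Finset.mul_sum,
          ← sum_powersetCard_succ_sum k fun W i => (∏ i ∈ W, m i) * m i * ((∑ j ∈ Wᶜ, m j) - m i)]
        refine Finset.sum_congr rfl fun T hT => ?_
        rw [Finset.mem_powersetCard_univ] at hT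
        have : ∀ i ∈ T, (∏ i ∈ T.erase i, m i) * m i * ((∑ j ∈ (T.erase i)ᶜ, m j) - m i) =
            (∏ i ∈ T, m i) * ∑ i ∈ Tᶜ, m i := by
          intro i hi
          rw [Finset.prod_erase_mul T m hi, Finset.compl_erase,
            Finset.sum_insert (by simpa using hi)]
          ring
        rw [Finset.sum_congr rfl this, Finset.sum_const, hT, nsmul_eq_mul]
        push_cast
        ring
      rw [h1, hA', ← Finset.sum_add_distrib]
      refine Finset.sum_congr rfl fun W _ => ?_
      have : ∀ i, (∏ i ∈ W, m i) * m i * ((∑ j ∈ Wᶜ, m j) - m i) =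
          (∏ i ∈ W, m i) * (∑ j ∈ Wᶜ, m j) * m i - (∏ i ∈ W, m i) * m i ^ 2 := fun i => by ring
      simp only [this, Finset.sum_sub_distrib, ← Finset.mul_sum]
      ring
    -- Cauchy–Schwarz on the complement of W, which has N − k elements; the square is expanded in
    -- `hB` into repeated and distinct pairs.
    have hC : ∑ W ∈ Finset.powersetCard k Finset.univ, (∏ i ∈ W, m i) * (∑ i ∈ Wᶜ, m i) ^ 2 ≤
        ((Fintype.card ι : ℝ) - k) * A := by
      rw [hA', Finset.mul_sum]
      refine Finset.sum_le_sum fun W hW => ?_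
      rw [Finset.mem_powersetCard_univ] at hW
      have h1 := sq_sum_le_card_mul_sum_sq (s := Wᶜ) (f := m)
      have h2 : ((Wᶜ).card : ℝ) = (Fintype.card ι : ℝ) - k := by
        rw [Finset.card_compl, hW, Nat.cast_sub (by omega)]
      rw [h2] at h1
      have h3 : 0 ≤ ∏ i ∈ W, m i := Finset.prod_nonneg fun i _ => hm i
      nlinarith [mul_le_mul_of_nonneg_left h1 h3]
    rw [hB] at hC
    push_cast at hC ⊢
    linarith

/-- Maclaurin's inequality between an elementary symmetric mean and the arithmetic mean. -/
theorem elemSum_le {m : ι → ℝ} (hm : ∀ i, 0 ≤ m i) {k : ℕ} (hk : k ≤ Fintype.card ι) :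
    elemSum m k ≤ (Fintype.card ι).choose k * ((∑ i, m i) / Fintype.card ι) ^ k := by
  induction k with
  | zero => simp [elemSum]
  | succ k ih =>
    have hN : (0 : ℝ) < Fintype.card ι := by
      have : 0 < Fintype.card ι := by omega
      exact_mod_cast this
    have h1 := card_mul_elemSum_succ_le hm (show k ≤ Fintype.card ι by omega)
    have h2 := ih (by omega)
    have hc : ((Fintype.card ι).choose (k + 1) : ℝ) * (k + 1) =
        (Fintype.card ι).choose k * ((Fintype.card ι : ℝ) - k) := by
      have := Nat.choose_succ_right_eq (Fintype.card ι) k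
      rw [← Nat.cast_sub (by omega)]
      exact_mod_cast this
    have hs : 0 ≤ ∑ i, m i := Finset.sum_nonneg fun i _ => hm i
    have hNk : 0 ≤ (Fintype.card ι : ℝ) - k := by
      have : ((k + 1 : ℕ) : ℝ) ≤ Fintype.card ι := by exact_mod_cast hk
      push_cast at this
      linarith
    set N : ℝ := (Fintype.card ι : ℝ) with hNdef
    have h3 : N * ((k + 1) * elemSum m (k + 1)) ≤
        N * ((k + 1) * ((Fintype.card ι).choose (k + 1) * ((∑ i, m i) / N) ^ (k + 1))) := by
      calc _ ≤ (N - k) * (∑ i, m i) * elemSum m k := h1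
        _ ≤ (N - k) * (∑ i, m i) * ((Fintype.card ι).choose k * ((∑ i, m i) / N) ^ k) := by
          gcongr
        _ = ((Fintype.card ι).choose k * (N - k)) * (∑ i, m i) * ((∑ i, m i) / N) ^ k := by ring
        _ = ((Fintype.card ι).choose (k + 1) * (k + 1)) * (∑ i, m i) *
            ((∑ i, m i) / N) ^ k := by rw [hc]
        _ = _ := by rw [pow_succ]; field_simp
    exact le_of_mul_le_mul_left (le_of_mul_le_mul_left h3 hN) (by positivity)

end maclaurin

/-! ## Hoeffding's lemma -/

open MeasureTheory ProbabilityTheory in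
/-- Hoeffding's lemma for a two-point law. -/
theorem one_sub_add_mul_exp_le {p : ℝ} (hp0 : 0 ≤ p) (hp1 : p ≤ 1) (h : ℝ) :
    1 - p + p * Real.exp h ≤ Real.exp (p * h + h ^ 2 / 8) := by
  let q : PMF Bool := PMF.ofFintype (fun b => cond b (ENNReal.ofReal p) (ENNReal.ofReal (1 - p)))
    (by
      rw [Fintype.sum_bool]
      change ENNReal.ofReal p + ENNReal.ofReal (1 - p) = 1
      rw [← ENNReal.ofReal_add hp0 (by linarith)]
      simp)
  have hq1 : (q true).toReal = p := ENNReal.toReal_ofReal hp0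
  have hq0 : (q false).toReal = 1 - p := ENNReal.toReal_ofReal (by linarith)
  let X : Bool → ℝ := fun b => cond b 1 0
  have hX := hasSubgaussianMGF_of_mem_Icc (μ := q.toMeasure) (X := X) (a := 0) (b := 1)
    (measurable_of_finite X).aemeasurable (by
      refine Filter.Eventually.of_forall fun b => ?_
      cases b <;> simp [X])
  have hint : ∫ b, X b ∂q.toMeasure = p := by
    rw [PMF.integral_eq_sum]
    simp [X, hq1]
  have := hX.mgf_le h
  rw [mgf, hint, PMF.integral_eq_sum] at this
  simp only [X, Fintype.sum_bool, hq1, hq0, cond_true, cond_false, smul_eq_mul] at this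
  norm_num at this
  calc 1 - p + p * Real.exp h = Real.exp (p * h) *
        (p * Real.exp (h * (1 - p)) + (1 - p) * Real.exp (-(h * p))) := by
        rw [mul_add, mul_left_comm, ← Real.exp_add, mul_left_comm, ← Real.exp_add]
        ring_nf
        simp
        ring
    _ ≤ Real.exp (p * h) * Real.exp (1 / 4 * h ^ 2 / 2) := by
        gcongr
    _ = _ := by
        rw [← Real.exp_add]
        congr 1
        ring

section hoeffding

variable {α : Type*} {p : PMF α}

/-- By convexity the exponential lies below its chord over [0, b], so only the mean of f enters. -/
theorem expect_exp_le_of_mem_Icc (hp : p.support.Finite) {f : α → ℝ} {b : ℝ} (hb : 0 < b)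
    (hf : ∀ a ∈ p.support, 0 ≤ f a ∧ f a ≤ b) (s : ℝ) :
    expect p (fun a => Real.exp (s * f a)) ≤ 1 + expect p f / b * (Real.exp (s * b) - 1) := by
  have h : expect p (fun a => Real.exp (s * f a)) ≤
      expect p (fun a => 1 + f a * ((Real.exp (s * b) - 1) / b)) := by
    refine expect_mono hp fun a ha => ?_
    obtain ⟨h0, h1⟩ := hf a ha
    have hc := convexOn_exp.2 (Set.mem_univ (0 : ℝ)) (Set.mem_univ (s * b))
      (show 0 ≤ 1 - f a / b by rw [sub_nonneg, div_le_one hb]; exact h1)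
      (show 0 ≤ f a / b by positivity) (by ring)
    simp only [smul_eq_mul, mul_zero, zero_add, Real.exp_zero, mul_one] at hc
    have e : f a / b * (s * b) = s * f a := by field_simp
    rw [e] at hc
    refine hc.trans (le_of_eq ?_)
    ring
  rw [expect_add hp, expect_const hp, expect_mul_const] at h
  refine h.trans (le_of_eq ?_)
  ring

end hoeffding

/-! ## Concentration of the sampled sum of empirical means -/

section concentration

variable {n : ℕ} {G : Digraph (Fin n)} {ε : ℝ}

/-- The law of the empirical mean computed for one node. -/
def meanLaw (G : Digraph (Fin n)) (ε : ℝ) (i : Fin n) : PMF ℝ :=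
  (simulate G ε i (maxWalks G ε) 0 0 0).val

/-- The expectation of the empirical mean computed for one node. -/
def meanMean (G : Digraph (Fin n)) (ε : ℝ) (i : Fin n) : ℝ := expect (meanLaw G ε i) fun y => y

theorem finite_support_meanLaw (G : Digraph (Fin n)) (ε : ℝ) (i : Fin n) :
    (meanLaw G ε i).support.Finite := finite_support_simulate G ε i _ _ _ _

theorem mem_support_meanLaw (hG : ∀ i, (outNbrs G i).Nonempty) (hloop : ∀ i, ¬ G.Adj i i)
    {i : Fin n} {y : ℝ} (hy : y ∈ (meanLaw G ε i).support) :
    0 ≤ y ∧ y ≤ (walkLength G ε : ℝ) / 2 :=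
  mem_support_simulate hG hloop le_rfl (by simp) hy

theorem expect_sq_sub_meanMean (G : Digraph (Fin n)) (ε : ℝ) (i : Fin n) (c : ℝ) :
    expect (meanLaw G ε i) (fun y => (y - c) ^ 2) =
      expect (meanLaw G ε i) (fun y => (y - meanMean G ε i) ^ 2) + (meanMean G ε i - c) ^ 2 := by
  have hf := finite_support_meanLaw G ε i
  have h1 : ∀ y : ℝ, (y - c) ^ 2 = (y - meanMean G ε i) ^ 2 +
      ((2 * (meanMean G ε i - c)) * (y - meanMean G ε i) + (meanMean G ε i - c) ^ 2) :=
    fun y => by ring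
  rw [expect_congr fun y _ => h1 y, expect_add hf, expect_add hf, expect_const hf, expect_const_mul, expect_sub hf,
    expect_const hf, ← meanMean]
  ring

theorem expect_sumMeans_cons (i : Fin n) (L : List (Fin n)) (f : ℝ → ℝ) :
    expect (sumMeans G ε (i :: L)).val f =
      expect (meanLaw G ε i) fun x => expect (sumMeans G ε L).val fun y => f (x + y) := by
  rw [val_sumMeans_cons, ← meanLaw, expect_bind (finite_support_meanLaw G ε i)
    fun x _ => finite_support_map (finite_support_sumMeans G ε L) _]
  simp only [expect_map (finite_support_sumMeans G ε L)]

theorem expect_exp_sumMeans (s : ℝ) (L : List (Fin n)) :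
    expect (sumMeans G ε L).val (fun y => Real.exp (s * y)) =
      (L.map fun i => expect (meanLaw G ε i) fun y => Real.exp (s * y)).prod := by
  induction L with
  | nil => simp [val_sumMeans_nil, expect_pure]
  | cons i L ih =>
    rw [expect_sumMeans_cons]
    simp only [mul_add, Real.exp_add, expect_const_mul, expect_mul_const, ih, List.map_cons,
      List.prod_cons]

theorem expect_sub_sumMeans (L : List (Fin n)) :
    expect (sumMeans G ε L).val (fun y => y - (L.map (meanMean G ε)).sum) = 0 := by
  induction L with
  | nil => simp [val_sumMeans_nil, expect_pure]
  | cons i L ih =>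
    have hf := finite_support_meanLaw G ε i
    have hL := finite_support_sumMeans G ε L
    rw [expect_sumMeans_cons]
    have h1 : ∀ x y : ℝ, x + y - ((i :: L).map (meanMean G ε)).sum =
        (x - meanMean G ε i) + (y - (L.map (meanMean G ε)).sum) := fun x y => by
      simp only [List.map_cons, List.sum_cons]; ring
    simp only [h1, expect_add hL, expect_const hL, ih, add_zero]
    rw [expect_sub hf, expect_const hf, ← meanMean, sub_self]

theorem expect_sq_sumMeans (L : List (Fin n)) :
    expect (sumMeans G ε L).val (fun y => (y - (L.map (meanMean G ε)).sum) ^ 2) =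
      (L.map fun i => expect (meanLaw G ε i) fun y => (y - meanMean G ε i) ^ 2).sum := by
  induction L with
  | nil => simp [val_sumMeans_nil, expect_pure]
  | cons i L ih =>
    have hf := finite_support_meanLaw G ε i
    have hL := finite_support_sumMeans G ε L
    rw [expect_sumMeans_cons]
    have h1 : ∀ x y : ℝ, (x + y - ((i :: L).map (meanMean G ε)).sum) ^ 2 =
        (x - meanMean G ε i) ^ 2 + ((2 * (x - meanMean G ε i)) *
          (y - (L.map (meanMean G ε)).sum) + (y - (L.map (meanMean G ε)).sum) ^ 2) :=
      fun x y => by simp only [List.map_cons, List.sum_cons]; ring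
    simp only [h1, expect_add hL, expect_const hL, expect_const_mul, expect_sub_sumMeans, ih,
      mul_zero, zero_add]
    rw [expect_add hf, expect_const hf, List.map_cons, List.sum_cons]

theorem mem_support_sumMeans (hG : ∀ i, (outNbrs G i).Nonempty) (hloop : ∀ i, ¬ G.Adj i i)
    {L : List (Fin n)} {y : ℝ} (hy : y ∈ (sumMeans G ε L).val.support) :
    0 ≤ y ∧ y ≤ L.length * ((walkLength G ε : ℝ) / 2) := by
  induction L generalizing y with
  | nil =>
    rw [val_sumMeans_nil, PMF.mem_support_pure_iff] at hy
    simp [hy]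
  | cons i L ih =>
    rw [val_sumMeans_cons, PMF.mem_support_bind_iff] at hy
    obtain ⟨x, hx, hy⟩ := hy
    rw [PMF.mem_support_map_iff] at hy
    obtain ⟨z, hz, rfl⟩ := hy
    obtain ⟨hx0, hx1⟩ := mem_support_meanLaw hG hloop hx
    obtain ⟨hz0, hz1⟩ := ih hz
    rw [List.length_cons]
    push_cast
    constructor <;> linarith

theorem expect_uniformOfFinset {α : Type*} {s : Finset α} (hs : s.Nonempty) (f : α → ℝ) :
    expect (PMF.uniformOfFinset s hs) f = (∑ a ∈ s, f a) / s.card := by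
  rw [expect_eq_sum (s := s) (by intro a ha; simpa using ha), Finset.sum_div]
  refine Finset.sum_congr rfl fun a ha => ?_
  rw [PMF.uniformOfFinset_apply_of_mem hs ha]
  simp
  ring

/-- The law of the pair of the sampled set and the sum of its empirical means. -/
def sampleLaw (G : Digraph (Fin n)) (ε : ℝ) : PMF (Finset (Fin n) × ℝ) :=
  (drawSubset n (subsetSize G ε) (subsetSize_le G ε)).val.bind fun S =>
    (sumMeans G ε S.toList).val.map fun y => (S, y)

theorem val_improvedMC_eq_map (G : Digraph (Fin n)) (ε : ℝ) : (improvedMC G ε).val =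
    (sampleLaw G ε).map fun x =>
      (n : ℝ) - walkLength G ε - 1 + (n : ℝ) / x.1.card * x.2 := by
  rw [val_improvedMC, sampleLaw, PMF.map_bind]
  simp only [PMF.map_comp]
  rfl

theorem finite_support_sampleLaw (G : Digraph (Fin n)) (ε : ℝ) :
    (sampleLaw G ε).support.Finite :=
  finite_support_bind (Set.toFinite _) fun _ =>
    finite_support_map (finite_support_sumMeans G ε _) _

theorem mem_support_sampleLaw {x : Finset (Fin n) × ℝ} (hx : x ∈ (sampleLaw G ε).support) :
    x.1.card = subsetSize G ε ∧ x.2 ∈ (sumMeans G ε x.1.toList).val.support := by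
  rw [sampleLaw, PMF.mem_support_bind_iff] at hx
  obtain ⟨S, hS, hx⟩ := hx
  rw [PMF.mem_support_map_iff] at hx
  obtain ⟨y, hy, rfl⟩ := hx
  rw [val_drawSubset, PMF.mem_support_uniformOfFinset_iff, Finset.mem_powersetCard] at hS
  exact ⟨hS.2, hy⟩

theorem expect_sampleLaw (f : Finset (Fin n) × ℝ → ℝ) : expect (sampleLaw G ε) f =
    (∑ S ∈ Finset.powersetCard (subsetSize G ε) Finset.univ,
      expect (sumMeans G ε S.toList).val fun y => f (S, y)) / n.choose (subsetSize G ε) := by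
  rw [sampleLaw, expect_bind (Set.toFinite _)
    fun S _ => finite_support_map (finite_support_sumMeans G ε _) _, val_drawSubset,
    expect_uniformOfFinset, Finset.card_powersetCard, Finset.card_univ, Fintype.card_fin]
  simp only [expect_map (finite_support_sumMeans G ε _)]

/-- Hoeffding's bound for the moment generating function of the sampled sum. -/
theorem expect_exp_sampleLaw_le (hn : 0 < n) (hG : ∀ i, (outNbrs G i).Nonempty)
    (hloop : ∀ i, ¬ G.Adj i i) (hl : 0 < walkLength G ε) (s : ℝ) :
    expect (sampleLaw G ε) (fun x => Real.exp (s * x.2)) ≤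
      Real.exp (subsetSize G ε * (s * ((∑ i, meanMean G ε i) / n) +
        (s * ((walkLength G ε : ℝ) / 2)) ^ 2 / 8)) := by
  set b : ℝ := (walkLength G ε : ℝ) / 2 with hb
  have hb0 : 0 < b := by positivity
  have hn' : (0 : ℝ) < n := by exact_mod_cast hn
  set ν := (∑ i, meanMean G ε i) / n with hν
  set m : Fin n → ℝ := fun i => expect (meanLaw G ε i) fun y => Real.exp (s * y) with hm
  have hm0 : ∀ i, 0 ≤ m i := fun i => expect_nonneg fun y _ => (Real.exp_pos _).le
  have hmm : ∀ i, 0 ≤ meanMean G ε i ∧ meanMean G ε i ≤ b := fun i =>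
    ⟨expect_nonneg fun y hy => (mem_support_meanLaw hG hloop hy).1,
      (expect_mono (finite_support_meanLaw G ε i)
        fun y hy => (mem_support_meanLaw hG hloop hy).2).trans_eq
          (expect_const (finite_support_meanLaw G ε i) b)⟩
  have hν0 : 0 ≤ ν := div_nonneg (Finset.sum_nonneg fun i _ => (hmm i).1) hn'.le
  have hνb : ν ≤ b := by
    rw [hν, div_le_iff₀ hn']
    refine (Finset.sum_le_sum fun i _ => (hmm i).2).trans_eq ?_
    simp [mul_comm]
  have hk : subsetSize G ε ≤ Fintype.card (Fin n) := by
    rw [Fintype.card_fin]; exact subsetSize_le G ε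
  -- For a fixed set the empirical means are independent, so the exponential moment is a product;
  -- averaging over all k-sets gives an elementary symmetric mean, to which Maclaurin's inequality
  -- applies.
  have h1 : expect (sampleLaw G ε) (fun x => Real.exp (s * x.2)) =
      elemSum m (subsetSize G ε) / n.choose (subsetSize G ε) := by
    rw [expect_sampleLaw, elemSum]
    simp only [expect_exp_sumMeans, Finset.prod_map_toList, hm]
  -- The chord bound is affine in the mean, so averaging over the nodes gives a two-point law with
  -- mean ν, to which Hoeffding's lemma applies.
  have h2 : (∑ i, m i) / n ≤ Real.exp (s * ν + (s * b) ^ 2 / 8) := by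
    have h3 : ∑ i, m i ≤ ∑ i, (1 + meanMean G ε i / b * (Real.exp (s * b) - 1)) :=
      Finset.sum_le_sum fun i _ => expect_exp_le_of_mem_Icc (finite_support_meanLaw G ε i) hb0
        (fun y hy => mem_support_meanLaw hG hloop hy) s
    have h4 : ∑ i, (1 + meanMean G ε i / b * (Real.exp (s * b) - 1)) =
        n * (1 - ν / b + ν / b * Real.exp (s * b)) := by
      rw [Finset.sum_add_distrib, ← Finset.sum_mul, ← Finset.sum_div]
      simp only [Finset.sum_const, Finset.card_univ, Fintype.card_fin, nsmul_eq_mul, hν]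
      field_simp
      ring
    have h5 := one_sub_add_mul_exp_le (p := ν / b) (by positivity) ((div_le_one hb0).2 hνb) (s * b)
    rw [div_le_iff₀ hn']
    have h6 : ν / b * (s * b) = s * ν := by field_simp
    rw [h6] at h5
    rw [h4] at h3
    nlinarith
  rw [h1, div_le_iff₀ (by exact_mod_cast Nat.choose_pos (subsetSize_le G ε))]
  have h7 := elemSum_le hm0 hk
  rw [Fintype.card_fin] at h7
  refine h7.trans ?_
  rw [mul_comm]
  refine mul_le_mul_of_nonneg_right ?_ (by positivity)
  rw [Real.exp_nat_mul]
  exact pow_le_pow_left₀ (div_nonneg (Finset.sum_nonneg fun i _ => hm0 i) hn'.le) h2 _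

end concentration

/-! ### Deviation of the scaled sample sum from the total expected number of returns -/

section accuracy

variable {n : ℕ} {G : Digraph (Fin n)} {ε : ℝ}

theorem one_le_log {n : ℕ} (hn : 3 ≤ n) : 1 ≤ Real.log n := by
  have h3 : (3 : ℝ) ≤ n := by exact_mod_cast hn
  rw [Real.le_log_iff_exp_le (by linarith)]
  have := Real.exp_one_lt_d9
  linarith

/-- Chebyshev's inequality when every node is sampled. -/
theorem sample_error_of_all (hn : 3 ≤ n) (hG : ∀ i, (outNbrs G i).Nonempty)
    (hloop : ∀ i, ¬ G.Adj i i) (hε : 0 < ε) (hl : 0 < walkLength G ε)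
    (hk : subsetSize G ε = n) :
    (sampleLaw G ε).toOuterMeasure {x | ¬ |(n : ℝ) / x.1.card * x.2 - ∑ i, returnMean G ε i| ≤
      35 / 36 * ((n : ℝ) - 1) * ε} ≤ ENNReal.ofReal (1 / n) := by
  have hn3 : (3 : ℝ) ≤ n := by exact_mod_cast hn
  have hn0 : (0 : ℝ) < n := by linarith
  set N := ∑ i, meanMean G ε i with hN
  set M := ∑ i, returnMean G ε i with hM
  set X := 35 / 36 * ((n : ℝ) - 1) * ε with hX
  set V := ∑ i, expect (meanLaw G ε i) fun y => (y - meanMean G ε i) ^ 2 with hV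
  have hV0 : 0 ≤ V := Finset.sum_nonneg fun i _ => expect_nonneg fun y _ => sq_nonneg _
  -- Variance and squared bias share the budget 0.2 ε² of each node; the biases are combined by
  -- Cauchy–Schwarz.
  have hVle : V + (N - M) ^ 2 / n ≤ n * (0.2 * ε ^ 2) := by
    have h1 : ∑ i, (expect (meanLaw G ε i) (fun y => (y - meanMean G ε i) ^ 2) +
        (meanMean G ε i - returnMean G ε i) ^ 2) ≤ ∑ _i : Fin n, 0.2 * ε ^ 2 :=
      Finset.sum_le_sum fun i _ => by
        rw [← expect_sq_sub_meanMean]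
        exact second_moment_le hn hG hloop hε hl i
    rw [Finset.sum_add_distrib, Finset.sum_const, Finset.card_univ, Fintype.card_fin,
      nsmul_eq_mul] at h1
    have h2 : (N - M) ^ 2 ≤ n * ∑ i, (meanMean G ε i - returnMean G ε i) ^ 2 := by
      rw [hN, hM, ← Finset.sum_sub_distrib]
      have := sq_sum_le_card_mul_sum_sq (s := (Finset.univ : Finset (Fin n)))
        (f := fun i => meanMean G ε i - returnMean G ε i)
      simpa using this
    have h3 : (N - M) ^ 2 / n ≤ ∑ i, (meanMean G ε i - returnMean G ε i) ^ 2 := by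
      rw [div_le_iff₀ hn0]
      linarith
    linarith
  -- For n ≥ 3 one has n − 1 ≥ (2/3) n.
  have hXn : 35 / 54 * (n * ε) ≤ X := by rw [hX]; nlinarith
  have hNM : (N - M) ^ 2 ≤ 0.2 * (n * ε) ^ 2 := by
    have h1 : (N - M) ^ 2 / n ≤ n * (0.2 * ε ^ 2) := by linarith
    rw [div_le_iff₀ hn0] at h1
    linarith
  have hD : 0 < X - |N - M| := by
    have h1 : |N - M| < 35 / 54 * (n * ε) := by
      refine abs_lt_of_sq_lt_sq ?_ (by positivity)
      have : 0 < (n * ε) ^ 2 := by positivity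
      nlinarith
    linarith
  set D := X - |N - M| with hDdef
  -- From X ≤ D + |N − M| follows X²/2 ≤ D² + (N − M)², and (35/54)²/2 > 0.2. This makes the
  -- Chebyshev bound V/D² at most 1/n.
  have hVD : V * n ≤ D ^ 2 := by
    have h1 : V * n + (N - M) ^ 2 ≤ 0.2 * (n * ε) ^ 2 := by
      have := mul_le_mul_of_nonneg_right hVle hn0.le
      have e : (N - M) ^ 2 / n * n = (N - M) ^ 2 := by field_simp
      nlinarith
    have h2 : X ^ 2 / 2 ≤ D ^ 2 + (N - M) ^ 2 := by
      rw [hDdef, ← sq_abs (N - M)]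
      nlinarith [sq_nonneg (X - 2 * |N - M|)]
    have h3 : (35 / 54 * (n * ε)) ^ 2 ≤ X ^ 2 := by gcongr
    nlinarith [sq_nonneg (n * ε)]
  have hmark := toOuterMeasure_le_expect (finite_support_sampleLaw G ε)
    (E := {x | ¬ |(n : ℝ) / x.1.card * x.2 - M| ≤ X}) (f := fun x => (x.2 - N) ^ 2 * (D ^ 2)⁻¹)
    (fun x _ => by positivity)
    (by
      intro x hx hxE
      rw [Set.mem_ofPred_eq, (mem_support_sampleLaw hx).1, hk, div_self hn0.ne', one_mul,
        not_le] at hxE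
      rw [← div_eq_mul_inv, one_le_div (by positivity), ← sq_abs (x.2 - N)]
      have : |x.2 - M| ≤ |x.2 - N| + |N - M| := abs_sub_le _ _ _
      gcongr
      linarith)
  refine hmark.trans (ENNReal.ofReal_le_ofReal ?_)
  have hps : Finset.powersetCard n (Finset.univ : Finset (Fin n)) = {Finset.univ} := by
    have := Finset.powersetCard_self (Finset.univ : Finset (Fin n))
    rwa [Finset.card_univ, Fintype.card_fin] at this
  rw [expect_mul_const, expect_sampleLaw, hk, Nat.choose_self, hps, Finset.sum_singleton]
  have h4 := expect_sq_sumMeans (G := G) (ε := ε) (Finset.univ : Finset (Fin n)).toList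
  rw [Finset.sum_map_toList, Finset.sum_map_toList, ← hN, ← hV] at h4
  rw [h4, Nat.cast_one, div_one, ← div_eq_mul_inv, div_le_div_iff₀ (by positivity) hn0]
  linarith

/-- The first inequality encodes k < n, the second that the error bound is not trivial. Eliminating
l and ε gives 9 (35/36)² (n − 1)² < n³, which is false for n = 3, 4, 5. -/
theorem six_le_of_lt {l : ℝ} (hn : 3 ≤ n) (hε : 0 < ε) (hl : 0 < l)
    (h : 3 * l * √(Real.log n) < 2 * ε * √(n : ℝ))
    (h' : 35 / 36 * ((n : ℝ) - 1) * ε < n * (l / 2)) : 6 ≤ n := by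
  have hn3 : (3 : ℝ) ≤ n := by exact_mod_cast hn
  have hlog := one_le_log hn
  by_contra hlt
  have h2 : (3 * l) ^ 2 < 4 * ε ^ 2 * n := by
    have h3 : 1 ≤ √(Real.log n) := Real.one_le_sqrt.2 hlog
    have h4 : 3 * l < 2 * ε * √(n : ℝ) := lt_of_le_of_lt (by nlinarith) h
    have h5 := pow_lt_pow_left₀ h4 (by positivity) two_ne_zero
    rw [mul_pow _ (√(n : ℝ)), Real.sq_sqrt (by linarith)] at h5
    linarith
  have h3 : (2 * (35 / 36 * ((n : ℝ) - 1) * ε)) ^ 2 < (n * l) ^ 2 := by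
    have : (0 : ℝ) ≤ n - 1 := by linarith
    refine pow_lt_pow_left₀ (by linarith) (by positivity) two_ne_zero
  have h4 : (n : ℝ) ^ 2 * (3 * l) ^ 2 < (n : ℝ) ^ 2 * (4 * ε ^ 2 * n) := by gcongr
  have h5 : 9 * (35 / 36 * ((n : ℝ) - 1)) ^ 2 < (n : ℝ) ^ 3 := by
    have hε2 : 0 < 4 * ε ^ 2 := by positivity
    refine lt_of_mul_lt_mul_left (a := 4 * ε ^ 2) ?_ hε2.le
    linarith
  have h6 : n = 3 ∨ n = 4 ∨ n = 5 := by omega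
  rcases h6 with rfl | rfl | rfl <;> norm_num at h5

set_option maxHeartbeats 600000 in
/-- Hoeffding's inequality for sampling without replacement. -/
theorem sample_error_of_lt (hn : 3 ≤ n) (hG : ∀ i, (outNbrs G i).Nonempty)
    (hloop : ∀ i, ¬ G.Adj i i) (hε : 0 < ε) (hl : 0 < walkLength G ε)
    (hk : subsetSize G ε < n) :
    (sampleLaw G ε).toOuterMeasure {x | ¬ |(n : ℝ) / x.1.card * x.2 - ∑ i, returnMean G ε i| ≤
      35 / 36 * ((n : ℝ) - 1) * ε} ≤ ENNReal.ofReal (1 / n) := by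
  have hn3 : (3 : ℝ) ≤ n := by exact_mod_cast hn
  have hn0 : (0 : ℝ) < n := by linarith
  have hlog := one_le_log hn
  have hl0 : (0 : ℝ) < walkLength G ε := by exact_mod_cast hl
  set l : ℝ := (walkLength G ε : ℝ) with hldef
  set k := subsetSize G ε with hkdef
  have hkc : 3 * ε⁻¹ * l * √(n : ℝ) * √(Real.log n) / 2 ≤ k := by
    have h1 : k = ⌈3 * ε⁻¹ * l * √(n : ℝ) * √(Real.log n) / 2⌉₊ := by
      rw [hkdef, subsetSize] at hk ⊢
      exact min_eq_left (by
        by_contra h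
        rw [min_eq_right (not_le.1 h).le] at hk
        exact lt_irrefl _ hk)
    rw [h1]
    exact Nat.le_ceil _
  have hsn : 0 < √(n : ℝ) := Real.sqrt_pos.2 hn0
  have hsl : 0 < √(Real.log n) := Real.sqrt_pos.2 (by linarith)
  have hsn2 : √(n : ℝ) ^ 2 = n := Real.sq_sqrt hn0.le
  have hsl2 : √(Real.log n) ^ 2 = Real.log n := Real.sq_sqrt (by linarith)
  have hk0 : (0 : ℝ) < k := lt_of_lt_of_le (by positivity) hkc
  have hkn : (k : ℝ) < n := by exact_mod_cast hk
  have hlε : 3 * l * √(Real.log n) < 2 * ε * √(n : ℝ) := by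
    have h1 : 3 * ε⁻¹ * l * √(n : ℝ) * √(Real.log n) / 2 < √(n : ℝ) ^ 2 := by
      rw [hsn2]; exact hkc.trans_lt hkn
    have e : 3 * ε⁻¹ * l * √(n : ℝ) * √(Real.log n) / 2 =
        (3 * l * √(Real.log n)) * (√(n : ℝ) / (2 * ε)) := by field_simp
    have e2 : √(n : ℝ) ^ 2 = (2 * ε * √(n : ℝ)) * (√(n : ℝ) / (2 * ε)) := by field_simp
    rw [e, e2] at h1
    exact lt_of_mul_lt_mul_right h1 (by positivity)
  clear_value l k
  set N := ∑ i, meanMean G ε i with hN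
  set M := ∑ i, returnMean G ε i with hM
  set X := 35 / 36 * ((n : ℝ) - 1) * ε with hX
  have hM0 : 0 ≤ M := Finset.sum_nonneg fun i _ => returnMean_nonneg G ε i
  have hMle : M ≤ n * (l / 2) := by
    refine (Finset.sum_le_sum fun i _ => returnMean_le hG hloop ε i).trans_eq ?_
    simp [hldef]
  -- Both the scaled sample sum and M lie in [0, nl/2]; if this range is at most X, the bad event is
  -- empty.
  rcases le_or_gt (n * (l / 2)) X with htriv | htriv
  · refine le_of_eq_of_le ((PMF.toOuterMeasure_apply_eq_zero_iff _ _).2 ?_) zero_le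
    rw [Set.disjoint_left]
    intro x hx hxE
    refine hxE ?_
    obtain ⟨h1, h2⟩ := mem_support_sampleLaw hx
    obtain ⟨h3, h4⟩ := mem_support_sumMeans hG hloop h2
    rw [Finset.length_toList, h1, ← hkdef, ← hldef] at h4
    rw [h1, ← hkdef]
    have h5 : 0 ≤ (n : ℝ) / k * x.2 := by positivity
    have h6 : (n : ℝ) / k * x.2 ≤ n * (l / 2) := by
      rw [div_mul_eq_mul_div, div_le_iff₀ hk0]
      nlinarith
    rw [abs_le]
    constructor <;> linarith
  have hn6 : 6 ≤ n := six_le_of_lt hn hε hl0 hlε htriv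
  have hn6' : (6 : ℝ) ≤ n := by exact_mod_cast hn6
  have hbias : |N - M| ≤ n * (0.4473 * ε) := by
    rw [hN, hM, ← Finset.sum_sub_distrib]
    refine (Finset.abs_sum_le_sum_abs _ _).trans ?_
    have h1 : ∀ i, |meanMean G ε i - returnMean G ε i| ≤ 0.4473 * ε := by
      intro i
      refine abs_le_of_sq_le_sq ?_ (by positivity)
      have h2 : expect (meanLaw G ε i) _ ≤ _ := second_moment_le hn hG hloop hε hl i
      rw [expect_sq_sub_meanMean] at h2
      have h3 : 0 ≤ expect (meanLaw G ε i) fun y => (y - meanMean G ε i) ^ 2 :=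
        expect_nonneg fun y _ => sq_nonneg _
      nlinarith [sq_nonneg ε]
    refine (Finset.sum_le_sum fun i _ => h1 i).trans_eq ?_
    simp
  -- This needs n ≥ 6: then (35/36)(n − 1)/n ≥ 0.81 > 1/3 + 0.4473. The bias takes 0.4473, just
  -- above √0.2, and ε/3 per node is left for the fluctuation.
  have hXb : n * (ε / 3) + n * (0.4473 * ε) ≤ X := by
    rw [hX]
    nlinarith
  -- The minimiser of (σl/2)²/8 − σε/3.
  set σ : ℝ := 16 / 3 * ε / l ^ 2 with hσ
  have hσ0 : 0 < σ := by positivity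
  have hmark := toOuterMeasure_le_expect (finite_support_sampleLaw G ε)
    (E := {x | ¬ |(n : ℝ) / x.1.card * x.2 - M| ≤ X})
    (f := fun x => Real.exp (σ * x.2) * Real.exp (-(σ * k * (N / n) + σ * k * (ε / 3))) +
      Real.exp (-σ * x.2) * Real.exp (σ * k * (N / n) - σ * k * (ε / 3)))
    (fun x _ => by positivity)
    (by
      intro x hx hxE
      rw [Set.mem_ofPred_eq, (mem_support_sampleLaw hx).1, ← hkdef, not_le] at hxE
      rw [← Real.exp_add, ← Real.exp_add]
      have h1 : |(n : ℝ) / k * x.2 - M| ≤ |(n : ℝ) / k * x.2 - N| + |N - M| := abs_sub_le _ _ _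
      have h2 : n * (ε / 3) < |(n : ℝ) / k * x.2 - N| := by linarith
      have h3 : (n : ℝ) / k * x.2 - N = (n / k) * (x.2 - k * (N / n)) := by field_simp
      rw [h3, abs_mul, abs_of_pos (by positivity)] at h2
      have h4 : k * (ε / 3) < |x.2 - k * (N / n)| := by
        have : (n : ℝ) * (ε / 3) = n / k * (k * (ε / 3)) := by field_simp
        rw [this] at h2
        exact lt_of_mul_lt_mul_left h2 (by positivity)
      rcases lt_abs.1 h4 with h5 | h5
      · have : 1 ≤ Real.exp (σ * x.2 + -(σ * k * (N / n) + σ * k * (ε / 3))) := by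
          rw [Real.one_le_exp_iff]
          have := mul_lt_mul_of_pos_left h5 hσ0
          linarith
        have h6 := Real.exp_pos (-σ * x.2 + (σ * k * (N / n) - σ * k * (ε / 3)))
        linarith
      · have : 1 ≤ Real.exp (-σ * x.2 + (σ * k * (N / n) - σ * k * (ε / 3))) := by
          rw [Real.one_le_exp_iff]
          have := mul_lt_mul_of_pos_left h5 hσ0
          linarith
        have h6 := Real.exp_pos (σ * x.2 + -(σ * k * (N / n) + σ * k * (ε / 3)))
        linarith)
  refine hmark.trans (ENNReal.ofReal_le_ofReal ?_)
  have hf := finite_support_sampleLaw G ε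
  have hmgf := expect_exp_sampleLaw_le (by omega) hG hloop hl (n := n) (G := G) (ε := ε)
  rw [← hldef, ← hkdef, ← hN] at hmgf
  rw [expect_add hf, expect_mul_const, expect_mul_const]
  have hexpo : k * ((σ * (l / 2)) ^ 2 / 8) - σ * k * (ε / 3) ≤ -(2 * Real.log n) := by
    have e : k * ((σ * (l / 2)) ^ 2 / 8) - σ * k * (ε / 3) = -(8 / 9 * (k * ε ^ 2 / l ^ 2)) := by
      rw [hσ]
      field_simp
      ring
    -- One factor comes from the lower bound for k, the other from the bound √n > 3l√(log n)/(2ε)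
    -- that k < n provides. Each tail is then at most 1/n².
    have h1 : 9 / 4 * Real.log n ≤ k * ε ^ 2 / l ^ 2 := by
      rw [le_div_iff₀ (by positivity)]
      have h2 : (3 * ε⁻¹ * l * √(n : ℝ) * √(Real.log n) / 2) * ε ^ 2 ≤ k * ε ^ 2 := by gcongr
      have e2 : (3 * ε⁻¹ * l * √(n : ℝ) * √(Real.log n) / 2) * ε ^ 2 =
          3 / 4 * l * √(Real.log n) * (2 * ε * √(n : ℝ)) := by field_simp; ring
      have h3 : 3 / 4 * l * √(Real.log n) * (3 * l * √(Real.log n)) ≤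
          3 / 4 * l * √(Real.log n) * (2 * ε * √(n : ℝ)) := by gcongr
      nlinarith
    rw [e]
    linarith
  have hone : Real.exp (-(2 * Real.log n)) = 1 / (n : ℝ) ^ 2 := by
    rw [Real.exp_neg, show 2 * Real.log (n : ℝ) = Real.log ((n : ℝ) ^ 2) by
      rw [Real.log_pow]; push_cast; ring, Real.exp_log (by positivity), one_div]
  have hA : expect (sampleLaw G ε) (fun x => Real.exp (σ * x.2)) *
      Real.exp (-(σ * k * (N / n) + σ * k * (ε / 3))) ≤ 1 / (n : ℝ) ^ 2 := by
    refine (mul_le_mul_of_nonneg_right (hmgf σ) (Real.exp_pos _).le).trans ?_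
    rw [← hone, ← Real.exp_add, Real.exp_le_exp]
    linarith
  have hB : expect (sampleLaw G ε) (fun x => Real.exp (-σ * x.2)) *
      Real.exp (σ * k * (N / n) - σ * k * (ε / 3)) ≤ 1 / (n : ℝ) ^ 2 := by
    refine (mul_le_mul_of_nonneg_right (hmgf (-σ)) (Real.exp_pos _).le).trans ?_
    rw [← hone, ← Real.exp_add, Real.exp_le_exp]
    linarith
  refine (add_le_add hA hB).trans ?_
  rw [← two_mul, mul_one_div, div_le_div_iff₀ (by positivity) hn0]
  nlinarith

theorem sample_error (hn : 3 ≤ n) (hG : ∀ i, (outNbrs G i).Nonempty)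
    (hloop : ∀ i, ¬ G.Adj i i) (hε : 0 < ε) (hl : 0 < walkLength G ε) :
    (sampleLaw G ε).toOuterMeasure {x | ¬ |(n : ℝ) / x.1.card * x.2 - ∑ i, returnMean G ε i| ≤
      35 / 36 * ((n : ℝ) - 1) * ε} ≤ ENNReal.ofReal (1 / n) :=
  (subsetSize_le G ε).eq_or_lt.elim (sample_error_of_all hn hG hloop hε hl)
    (sample_error_of_lt hn hG hloop hε hl)

end accuracy

/-! ## Characteristic polynomials and traces of powers -/

section charpoly

open Polynomial

variable {ι : Type*} [Fintype ι] [DecidableEq ι]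

theorem card_roots_charpoly (A : Matrix ι ι ℂ) : A.charpoly.roots.card = Fintype.card ι := by
  rw [← A.charpoly_natDegree_eq_dim]
  exact (IsAlgClosed.splits A.charpoly).natDegree_eq_card_roots.symm

/-- Both sides are multiplicative in q, and q splits over ℂ; so constants and linear factors X − r
suffice. -/
theorem det_aeval (A : Matrix ι ι ℂ) (q : ℂ[X]) :
    (aeval A q).det = (A.charpoly.roots.map fun z => q.eval z).prod := by
  let f : ℂ[X] →* ℂ := (Matrix.detMonoidHom).comp (aeval A : ℂ[X] →ₐ[ℂ] Matrix ι ι ℂ).toMonoidHom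
  let g : ℂ[X] →* ℂ :=
    { toFun := fun q => (A.charpoly.roots.map fun z => q.eval z).prod
      map_one' := by simp
      map_mul' := fun p q => by simp [Multiset.prod_map_mul] }
  have hC : ∀ c : ℂ, f (C c) = g (C c) := by
    intro c
    change (aeval A (C c)).det = (A.charpoly.roots.map fun z => (C c).eval z).prod
    rw [aeval_C, Matrix.algebraMap_eq_diagonal, Matrix.det_diagonal]
    simp [card_roots_charpoly]
  have hX : ∀ r : ℂ, f (X - C r) = g (X - C r) := by
    intro r
    change (aeval A (X - C r)).det = (A.charpoly.roots.map fun z => (X - C r).eval z).prod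
    have h1 : (aeval A (X - C r)).det = (-1) ^ Fintype.card ι * A.charpoly.eval r := by
      rw [Matrix.eval_charpoly, ← Matrix.det_neg]
      congr 1
      simp [Matrix.algebraMap_eq_diagonal, Matrix.scalar_apply, Pi.algebraMap_def]
    rw [h1]
    have h2 := (IsAlgClosed.splits A.charpoly).eq_prod_roots_of_monic A.charpoly_monic
    have h3 : A.charpoly.eval r = (A.charpoly.roots.map fun z => r - z).prod := by
      conv_lhs => rw [h2]
      rw [eval_multiset_prod, Multiset.map_map]
      simp
    have h4 : (A.charpoly.roots.map fun z => (X - C r).eval z) =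
        A.charpoly.roots.map fun z => (-1) * (r - z) := by simp
    rw [h3, h4, Multiset.prod_map_mul, Multiset.map_const', Multiset.prod_replicate,
      card_roots_charpoly]
  change f q = g q
  rw [(IsAlgClosed.splits q).eq_prod_roots, map_mul, map_mul, hC, map_multiset_prod,
    map_multiset_prod, Multiset.map_map, Multiset.map_map]
  congr 2
  exact Multiset.map_congr rfl fun r _ => hX r

/-- Apply `det_aeval` to q = x − X^t: the two monic polynomials agree at every x, so multiplicities
are included. -/
theorem roots_charpoly_pow (A : Matrix ι ι ℂ) (t : ℕ) :
    (A ^ t).charpoly.roots = A.charpoly.roots.map fun z => z ^ t := by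
  have h : (A ^ t).charpoly = ((A.charpoly.roots.map fun z => z ^ t).map fun a => X - C a).prod := by
    refine Polynomial.funext fun x => ?_
    rw [Matrix.eval_charpoly, eval_multiset_prod, Multiset.map_map, Multiset.map_map]
    have h1 := det_aeval A (C x - X ^ t)
    simp only [map_sub, aeval_C, map_pow, aeval_X, eval_sub, eval_C, eval_pow, eval_X] at h1
    simp only [Function.comp_def, eval_sub, eval_C, eval_X]
    rw [← h1]
    simp [Matrix.algebraMap_eq_diagonal, Matrix.scalar_apply, Pi.algebraMap_def]
  rw [h, roots_multiset_prod_X_sub_C]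

theorem trace_pow_eq_sum_roots (A : Matrix ι ι ℂ) (t : ℕ) :
    (A ^ t).trace = (A.charpoly.roots.map fun z => z ^ t).sum := by
  rw [Matrix.trace_eq_sum_roots_charpoly, roots_charpoly_pow]

theorem sub_mul_sub_eq {R : Type*} [Ring R] {x p u : R} (huu : u * u = u) (hpu : p * u = u)
    (hxu : x * u = u * x) (hxp : x * p = p * x) : (x - (p - u)) * (x - u) = x * (x - p) := by
  simp only [sub_mul, mul_sub, huu, hpu, hxu, hxp]
  abel

/-- Take determinants in (X − (P − U))(X − U) = X (X − P). The rank-one projection U has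
characteristic polynomial X^N − X^(N−1), where N is the dimension, and the common power of X
cancels. -/
theorem charpoly_sub_mul {P U : Matrix ι ι ℂ} (hPU : P * U = U) (hUU : U * U = U)
    {u v : ι → ℂ} (hU : U = Matrix.vecMulVec u v) (huv : u ⬝ᵥ v = 1) [Nonempty ι] :
    (P - U).charpoly * (X - 1) = X * P.charpoly := by
  have hmap : (P - U).charmatrix * U.charmatrix = Matrix.scalar ι (X : ℂ[X]) * P.charmatrix := by
    simp only [Matrix.charmatrix, map_sub]
    have e1 : (C.mapMatrix U : Matrix ι ι ℂ[X]) * C.mapMatrix U = C.mapMatrix U := by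
      rw [← map_mul, hUU]
    have e2 : (C.mapMatrix P : Matrix ι ι ℂ[X]) * C.mapMatrix U = C.mapMatrix U := by
      rw [← map_mul, hPU]
    have hc := fun M : Matrix ι ι ℂ[X] =>
      (Matrix.scalar_commute (n := ι) (X : ℂ[X]) (fun r => Commute.all _ _) M).eq
    exact sub_mul_sub_eq e1 e2 (hc _) (hc _)
  have hdet := congrArg Matrix.det hmap
  rw [Matrix.det_mul, Matrix.det_mul] at hdet
  change (P - U).charpoly * U.charpoly = _ * P.charpoly at hdet
  rw [hU, Matrix.charpoly_vecMulVec, huv, one_smul, ← hU] at hdet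
  have hc : Fintype.card ι = Fintype.card ι - 1 + 1 := (Nat.succ_pred_eq_of_pos Fintype.card_pos).symm
  have hs : (Matrix.scalar ι (X : ℂ[X])).det = X ^ (Fintype.card ι - 1) * X := by
    rw [← pow_succ, ← hc]; simp
  have h2 : (X : ℂ[X]) ^ Fintype.card ι - X ^ (Fintype.card ι - 1) =
      X ^ (Fintype.card ι - 1) * (X - 1) := by
    rw [mul_sub, ← pow_succ, ← hc, mul_one]
  rw [hs, h2] at hdet
  have hX : (X : ℂ[X]) ^ (Fintype.card ι - 1) ≠ 0 := pow_ne_zero _ X_ne_zero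
  refine mul_left_cancel₀ hX ?_
  linear_combination hdet

end charpoly

/-! ## Powers of the transition matrix -/

section powers

variable {n : ℕ} {G : Digraph (Fin n)}

theorem outNbrs_nonempty (hn : 2 ≤ n) (hG : StronglyConnected G) (i : Fin n) :
    (outNbrs G i).Nonempty := by
  have : Nontrivial (Fin n) := Fin.nontrivial_iff_two_le.2 hn
  obtain ⟨j, hj⟩ := exists_ne i
  rcases Relation.ReflTransGen.cases_head (hG i j) with h | ⟨v, hv, -⟩
  · exact absurd h.symm hj
  · exact ⟨v, mem_outNbrs.2 hv⟩

theorem transition_pow_nonneg (G : Digraph (Fin n)) (k : ℕ) (i j : Fin n) :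
    0 ≤ (transition G ^ k) i j := by
  induction k generalizing i j with
  | zero => rw [pow_zero, Matrix.one_apply]; split_ifs <;> norm_num
  | succ k ih =>
    rw [pow_succ', Matrix.mul_apply]
    exact Finset.sum_nonneg fun v _ => mul_nonneg (transition_nonneg G i v) (ih v j)

theorem sum_transition_pow (hG : ∀ i, (outNbrs G i).Nonempty) (k : ℕ) (i : Fin n) :
    ∑ j, (transition G ^ k) i j = 1 := by
  induction k generalizing i with
  | zero => simp [Matrix.one_apply]
  | succ k ih =>
    simp only [pow_succ', Matrix.mul_apply]
    rw [Finset.sum_comm]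
    simp only [← Finset.mul_sum, ih, mul_one, sum_transition hG]

theorem transition_pow_add_pos {a b : ℕ} {i j k : Fin n} (h1 : 0 < (transition G ^ a) i j)
    (h2 : 0 < (transition G ^ b) j k) : 0 < (transition G ^ (a + b)) i k := by
  rw [pow_add, Matrix.mul_apply]
  exact lt_of_lt_of_le (mul_pos h1 h2) (Finset.single_le_sum (f := fun v =>
    (transition G ^ a) i v * (transition G ^ b) v k)
    (fun v _ => mul_nonneg (transition_pow_nonneg G a i v) (transition_pow_nonneg G b v k))
    (Finset.mem_univ j))

theorem exists_transition_pow_pos (hG : StronglyConnected G) (i j : Fin n) :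
    ∃ k, 0 < (transition G ^ k) i j := by
  induction hG i j with
  | refl => exact ⟨0, by simp⟩
  | tail _ h ih =>
    obtain ⟨k, hk⟩ := ih
    exact ⟨k + 1, transition_pow_add_pos hk (by simpa using transition_pos h)⟩

/-- Return times are closed under addition and have gcd 1, so the semigroup they generate contains
all large integers. -/
theorem exists_return_pos_of_ge (hA : Aperiodic G) (i : Fin n) :
    ∃ m, ∀ k ≥ m, 0 < (transition G ^ k) i i := by
  set s : Set ℕ := {k | 1 ≤ k ∧ 0 < (transition G ^ k) i i} with hs
  have hgcd : Nat.setGcd s = 1 := hA i _ fun k hk h => Nat.setGcd_dvd_of_mem ⟨hk, h⟩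
  obtain ⟨m, hm⟩ := Nat.exists_mem_closure_of_ge s
  refine ⟨m, fun k hk => ?_⟩
  have hmem := hm k hk (by rw [hgcd]; exact one_dvd k)
  clear hk
  induction hmem using AddSubmonoid.closure_induction with
  | mem x hx => exact hx.2
  | zero => simp
  | add x y _ _ hx hy => exact transition_pow_add_pos hx hy

/-- The walk is primitive: all entries of some power of the transition matrix are positive. -/
theorem exists_pow_pos (hG : StronglyConnected G) (hA : Aperiodic G) :
    ∃ N, ∀ i j, 0 < (transition G ^ N) i j := by
  choose m hm using exists_return_pos_of_ge hA
  choose e he using exists_transition_pow_pos hG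
  refine ⟨∑ i, ∑ j, (m i + e i j), fun i j => ?_⟩
  have h1 : m i + e i j ≤ ∑ i, ∑ j, (m i + e i j) :=
    (Finset.single_le_sum (f := fun j => m i + e i j) (fun _ _ => Nat.zero_le _)
      (Finset.mem_univ j)).trans
    (Finset.single_le_sum (f := fun i => ∑ j, (m i + e i j)) (fun _ _ => Nat.zero_le _)
      (Finset.mem_univ i))
  obtain ⟨c, hc⟩ := Nat.exists_eq_add_of_le h1
  rw [hc, show m i + e i j + c = (m i + c) + e i j by ring]
  exact transition_pow_add_pos (hm i _ (Nat.le_add_right _ _)) (he i j)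

/-- A loop-free walk on two nodes alternates between them. -/
theorem three_le_of_aperiodic (hn : 2 ≤ n) (hloop : ∀ i, ¬ G.Adj i i) (hA : Aperiodic G) :
    3 ≤ n := by
  by_contra h
  obtain rfl : n = 2 := by omega
  have key : ∀ (k : ℕ) (i j : Fin 2), 0 < (transition G ^ k) i j → (Even k ↔ i = j) := by
    intro k
    induction k with
    | zero =>
      intro i j hij
      by_contra hne
      simp only [Even.zero, true_iff] at hne
      rw [pow_zero, Matrix.one_apply_ne hne] at hij
      exact lt_irrefl _ hij
    | succ k ih =>
      intro i j hij
      rw [pow_succ', Matrix.mul_apply] at hij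
      obtain ⟨v, -, hv⟩ := Finset.exists_lt_of_sum_lt
        (show ∑ v : Fin 2, (0 : ℝ) < ∑ v, transition G i v * (transition G ^ k) v j by rwa [Finset.sum_const_zero])
      have h1 : transition G i v ≠ 0 := fun h0 => by simp [h0] at hv
      have h2 : 0 < (transition G ^ k) v j :=
        lt_of_le_of_ne (transition_pow_nonneg G k v j) fun h0 => by simp [← h0] at hv
      have h3 : i ≠ v := by
        rintro rfl
        refine h1 ?_
        rw [transition, Matrix.of_apply, if_neg (hloop i)]
      rw [Nat.even_add_one, ih v j h2]
      omega
  have := hA 0 2 fun k _ hk => even_iff_two_dvd.1 ((key k 0 0 hk).2 rfl)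
  omega

/-- Doeblin's contraction: every row of P^N carries mass δ at j, the same for all starting nodes,
and the remaining weights are nonnegative of total 1 − δ. A block of N steps therefore shrinks the
range of the column by the factor 1 − δ. -/
theorem exists_bounds_transition_pow (hG : ∀ i, (outNbrs G i).Nonempty) {N : ℕ} {δ : ℝ}
    (hδ : ∀ i j, δ ≤ (transition G ^ N) i j) (j : Fin n) (t d : ℕ) :
    ∃ m M : ℝ, M - m = (1 - δ) ^ t ∧
      ∀ i, m ≤ (transition G ^ (N * t + d)) i j ∧ (transition G ^ (N * t + d)) i j ≤ M := by
  induction t with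
  | zero =>
    refine ⟨0, 1, by simp, fun i => ⟨transition_pow_nonneg G _ i j, ?_⟩⟩
    rw [← sum_transition_pow hG (N * 0 + d) i]
    exact Finset.single_le_sum (fun v _ => transition_pow_nonneg G _ i v) (Finset.mem_univ j)
  | succ t ih =>
    obtain ⟨m, M, hmM, h⟩ := ih
    set f : Fin n → ℝ := fun v => (transition G ^ (N * t + d)) v j with hf
    refine ⟨δ * f j + (1 - δ) * m, δ * f j + (1 - δ) * M, by rw [pow_succ, ← hmM]; ring,
      fun i => ?_⟩
    have e : (transition G ^ (N * (t + 1) + d)) i j =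
        δ * f j + ∑ v, ((transition G ^ N) i v - if v = j then δ else 0) * f v := by
      rw [show N * (t + 1) + d = N + (N * t + d) by ring, pow_add, Matrix.mul_apply]
      simp only [sub_mul, Finset.sum_sub_distrib, ite_mul, zero_mul, Finset.sum_ite_eq',
        Finset.mem_univ, if_true]
      ring
    have hw0 : ∀ v, 0 ≤ (transition G ^ N) i v - if v = j then δ else 0 := by
      intro v
      split_ifs
      · exact sub_nonneg.2 (hδ i v)
      · simpa using transition_pow_nonneg G N i v
    have hw1 : ∑ v, ((transition G ^ N) i v - if v = j then δ else 0) = 1 - δ := by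
      rw [Finset.sum_sub_distrib, sum_transition_pow hG]
      simp
    rw [e, ← hw1, Finset.sum_mul, Finset.sum_mul]
    exact ⟨add_le_add_right (Finset.sum_le_sum fun v _ =>
        mul_le_mul_of_nonneg_left (h v).1 (hw0 v)) _,
      add_le_add_right (Finset.sum_le_sum fun v _ =>
        mul_le_mul_of_nonneg_left (h v).2 (hw0 v)) _⟩

theorem stationary_pow {π : Fin n → ℝ} (hπ : IsStationary G π) (k : ℕ) (j : Fin n) :
    ∑ i, π i * (transition G ^ k) i j = π j := by
  have h : Matrix.vecMul π (transition G ^ k) = π := by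
    induction k with
    | zero => simp
    | succ k ih => rw [pow_succ, ← Matrix.vecMul_vecMul, ih, hπ.vecMul_eq]
  exact congrFun h j

/-- The powers of the transition matrix converge to the stationary distribution. -/
theorem tendsto_transition_pow (hn : 2 ≤ n) (hG : StronglyConnected G) (hA : Aperiodic G)
    {π : Fin n → ℝ} (hπ : IsStationary G π) (i j : Fin n) :
    Filter.Tendsto (fun k => (transition G ^ k) i j) Filter.atTop (nhds (π j)) := by
  have hout := outNbrs_nonempty hn hG
  obtain ⟨N, hN⟩ := exists_pow_pos hG hA
  have hne : (Finset.univ : Finset (Fin n × Fin n)).Nonempty := ⟨(i, j), Finset.mem_univ _⟩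
  obtain ⟨p, -, hp⟩ := Finset.exists_min_image Finset.univ
    (fun p : Fin n × Fin n => (transition G ^ N) p.1 p.2) hne
  set δ := (transition G ^ N) p.1 p.2 with hδ
  have hδ0 : 0 < δ := hN _ _
  have hδ1 : δ ≤ 1 := by
    rw [hδ, ← sum_transition_pow hout N p.1]
    exact Finset.single_le_sum (fun v _ => transition_pow_nonneg G _ p.1 v) (Finset.mem_univ p.2)
  have hle : ∀ i j, δ ≤ (transition G ^ N) i j := fun i j => hp (i, j) (Finset.mem_univ _)
  rw [Metric.tendsto_atTop]
  intro η hη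
  obtain ⟨t, ht⟩ := exists_pow_lt_of_lt_one hη (show 1 - δ < 1 by linarith)
  refine ⟨N * t, fun k hk => ?_⟩
  obtain ⟨d, rfl⟩ := Nat.exists_eq_add_of_le hk
  obtain ⟨m, M, hmM, h⟩ := exists_bounds_transition_pow hout hle j t d
  have h1 : m ≤ π j := by
    rw [← stationary_pow hπ (N * t + d) j, ← one_mul m, ← hπ.sum_eq_one, Finset.sum_mul]
    exact Finset.sum_le_sum fun v _ => mul_le_mul_of_nonneg_left (h v).1 (hπ.nonneg v)
  have h2 : π j ≤ M := by
    rw [← stationary_pow hπ (N * t + d) j, ← one_mul M, ← hπ.sum_eq_one, Finset.sum_mul]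
    exact Finset.sum_le_sum fun v _ => mul_le_mul_of_nonneg_left (h v).2 (hπ.nonneg v)
  rw [Real.dist_eq]
  refine lt_of_le_of_lt (abs_le.2 ⟨?_, ?_⟩) ht <;> linarith [(h i).1, (h i).2]

/-- The transition matrix minus its limit. -/
def deviation (G : Digraph (Fin n)) (π : Fin n → ℝ) : Matrix (Fin n) (Fin n) ℝ :=
  transition G - Matrix.vecMulVec 1 π

theorem transition_mul_vecMulVec (hG : ∀ i, (outNbrs G i).Nonempty) (π : Fin n → ℝ) :
    transition G * Matrix.vecMulVec 1 π = Matrix.vecMulVec 1 π := by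
  ext i j
  simp [Matrix.mul_apply, Matrix.vecMulVec_apply, ← Finset.sum_mul, sum_transition hG]

theorem vecMulVec_mul_transition {π : Fin n → ℝ} (hπ : IsStationary G π) :
    Matrix.vecMulVec (1 : Fin n → ℝ) π * transition G = Matrix.vecMulVec 1 π := by
  ext i j
  simpa [Matrix.mul_apply, Matrix.vecMulVec_apply] using stationary_pow hπ 1 j

theorem vecMulVec_mul_self {π : Fin n → ℝ} (hπ : IsStationary G π) :
    Matrix.vecMulVec (1 : Fin n → ℝ) π * Matrix.vecMulVec 1 π = Matrix.vecMulVec 1 π := by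
  ext i j
  simp [Matrix.mul_apply, Matrix.vecMulVec_apply, ← Finset.sum_mul, hπ.sum_eq_one]

/-- With U = 1π, PU = UP = UU = U, so the mixed terms collapse. The exponent has to be positive,
since D⁰ = 1 while P⁰ − U = 1 − U. -/
theorem deviation_pow (hG : ∀ i, (outNbrs G i).Nonempty) {π : Fin n → ℝ}
    (hπ : IsStationary G π) (k : ℕ) :
    deviation G π ^ (k + 1) = transition G ^ (k + 1) - Matrix.vecMulVec 1 π := by
  induction k with
  | zero => simp [deviation]
  | succ k ih =>
    have h1 : transition G ^ (k + 1) * Matrix.vecMulVec 1 π = Matrix.vecMulVec 1 π := by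
      clear ih
      induction k with
      | zero => simpa using transition_mul_vecMulVec hG π
      | succ k ih => rw [pow_succ, mul_assoc, transition_mul_vecMulVec hG, ih]
    rw [pow_succ _ (k + 1), ih, deviation, sub_mul, mul_sub, mul_sub, h1,
      vecMulVec_mul_transition hπ, vecMulVec_mul_self hπ, ← pow_succ, sub_self, sub_zero]

theorem tendsto_deviation_pow (hn : 2 ≤ n) (hG : StronglyConnected G) (hA : Aperiodic G)
    {π : Fin n → ℝ} (hπ : IsStationary G π) :
    Filter.Tendsto (fun k => deviation G π ^ k) Filter.atTop (nhds 0) := by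
  rw [← Filter.tendsto_add_atTop_iff_nat 1]
  simp only [deviation_pow (outNbrs_nonempty hn hG) hπ]
  refine tendsto_pi_nhds.2 fun i => tendsto_pi_nhds.2 fun j => ?_
  have h := (tendsto_transition_pow hn hG hA hπ i j).sub_const (π j)
  rw [sub_self, ← Filter.tendsto_add_atTop_iff_nat 1] at h
  simpa [Matrix.vecMulVec_apply] using h

end powers

/-! ## Hitting times and the fundamental matrix -/

section hitting

variable {n : ℕ} {G : Digraph (Fin n)}

/-- The probability that the walk from `i` does not meet `j` within `k` steps. -/
def hitTail (G : Digraph (Fin n)) (j : Fin n) : ℕ → Fin n → ℝ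
  | 0, i => if i = j then 0 else 1
  | k + 1, i => if i = j then 0 else ∑ v, transition G i v * hitTail G j k v

theorem hitTail_nonneg (G : Digraph (Fin n)) (j : Fin n) (k : ℕ) (i : Fin n) :
    0 ≤ hitTail G j k i := by
  induction k generalizing i with
  | zero => rw [hitTail]; split_ifs <;> norm_num
  | succ k ih =>
    rw [hitTail]
    split_ifs
    · exact le_rfl
    · exact Finset.sum_nonneg fun v _ => mul_nonneg (transition_nonneg G i v) (ih v)

theorem hitTail_self (G : Digraph (Fin n)) (j : Fin n) (k : ℕ) : hitTail G j k j = 0 := by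
  cases k <;> simp [hitTail]

theorem walk_avoid (hG : ∀ i, (outNbrs G i).Nonempty) (j : Fin n) (k : ℕ) (i : Fin n) :
    (walk G k i).toOuterMeasure {w | j ∉ w} = ENNReal.ofReal (hitTail G j k i) := by
  induction k generalizing i with
  | zero =>
    rw [walk, hitTail, PMF.toOuterMeasure_pure_apply]
    by_cases h : i = j
    · simp [h]
    · simp [h, Ne.symm h]
  | succ k ih =>
    rw [walk, hitTail, PMF.toOuterMeasure_bind_apply, tsum_fintype]
    simp only [PMF.toOuterMeasure_map_apply]
    by_cases h : i = j
    · have : (fun w : List (Fin n) => i :: w) ⁻¹' {w | j ∉ w} = ∅ := by ext w; simp [h]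
      simp [h]
    · have : (fun w : List (Fin n) => i :: w) ⁻¹' {w | j ∉ w} = {w | j ∉ w} := by
        ext w; simp [Ne.symm h]
      rw [if_neg h, this, ENNReal.ofReal_sum_of_nonneg fun v _ =>
        mul_nonneg (transition_nonneg G i v) (hitTail_nonneg G j k v)]
      refine Finset.sum_congr rfl fun v _ => ?_
      rw [ih, ENNReal.ofReal_mul (transition_nonneg G i v), ← nextNode_toReal (hG i),
        ENNReal.ofReal_toReal (PMF.apply_ne_top _ _)]

theorem hitTail_add_pow_le (hG : ∀ i, (outNbrs G i).Nonempty) (j : Fin n) (k : ℕ) (i : Fin n) :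
    hitTail G j k i + (transition G ^ k) i j ≤ 1 := by
  induction k generalizing i with
  | zero =>
    rw [hitTail, pow_zero, Matrix.one_apply]
    split_ifs <;> norm_num
  | succ k ih =>
    rw [hitTail]
    split_ifs with h
    · rw [zero_add, ← sum_transition_pow hG (k + 1) i]
      exact Finset.single_le_sum (fun v _ => transition_pow_nonneg G _ i v) (Finset.mem_univ j)
    · rw [pow_succ', Matrix.mul_apply, ← Finset.sum_add_distrib, ← sum_transition hG i]
      refine Finset.sum_le_sum fun v _ => ?_
      rw [← mul_add]
      exact mul_le_of_le_one_right (transition_nonneg G i v) (ih v)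

theorem hitTail_add_le {j : Fin n} {a : ℝ} {N : ℕ} (h : ∀ i, hitTail G j N i ≤ a) (k : ℕ)
    (i : Fin n) : hitTail G j (k + N) i ≤ a * hitTail G j k i := by
  induction k generalizing i with
  | zero =>
    by_cases hi : i = j
    · simp [hi, hitTail_self]
    · simpa [hitTail, hi] using h i
  | succ k ih =>
    rw [Nat.add_right_comm, hitTail, hitTail]
    split_ifs
    · simp
    · rw [Finset.mul_sum]
      refine Finset.sum_le_sum fun v _ => ?_
      rw [mul_left_comm]
      exact mul_le_mul_of_nonneg_left (ih v) (transition_nonneg G i v)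

/-- From every node the walk misses j during N steps with probability at most a < 1, so the tails
decay geometrically in blocks of length N, and their sum is at most N/(1 − a). -/
theorem summable_hitTail (hG : ∀ i, (outNbrs G i).Nonempty) {N : ℕ}
    (hN : ∀ i j, 0 < (transition G ^ N) i j) (j i : Fin n) :
    Summable fun k => hitTail G j k i := by
  obtain ⟨p, -, hp⟩ := Finset.exists_max_image Finset.univ (fun p => hitTail G j N p)
    ⟨i, Finset.mem_univ _⟩
  set a := hitTail G j N p with ha
  have ha1 : a < 1 := by linarith [hitTail_add_pow_le hG j N p, hN p j]
  have hstep := hitTail_add_le (G := G) (j := j) (a := a) (N := N)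
    fun i => hp i (Finset.mem_univ _)
  refine summable_of_sum_range_le (c := N / (1 - a)) (fun k => hitTail_nonneg G j k i) fun m => ?_
  rw [le_div_iff₀ (by linarith)]
  have h1 : ∑ k ∈ Finset.range m, hitTail G j k i ≤
      ∑ k ∈ Finset.range (N + m), hitTail G j k i :=
    Finset.sum_le_sum_of_subset_of_nonneg (Finset.range_mono (by omega))
      fun k _ _ => hitTail_nonneg G j k i
  have h2 : ∑ k ∈ Finset.range N, hitTail G j k i ≤ N := by
    refine (Finset.sum_le_sum (g := fun _ => (1 : ℝ)) fun k _ => ?_).trans_eq (by simp)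
    linarith [hitTail_add_pow_le hG j k i, transition_pow_nonneg G k i j]
  have h3 : ∑ k ∈ Finset.range m, hitTail G j (N + k) i ≤
      a * ∑ k ∈ Finset.range m, hitTail G j k i := by
    rw [Finset.mul_sum]
    exact Finset.sum_le_sum fun k _ => by rw [add_comm]; exact hstep k i
  rw [Finset.sum_range_add] at h1
  linarith

/-- The hitting time as a real number. -/
def hitReal (G : Digraph (Fin n)) (j i : Fin n) : ℝ := ∑' k, hitTail G j k i

theorem hittingTime_eq (hG : ∀ i, (outNbrs G i).Nonempty) {N : ℕ}
    (hN : ∀ i j, 0 < (transition G ^ N) i j) (i j : Fin n) :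
    hittingTime G i j = ENNReal.ofReal (hitReal G j i) := by
  rw [hittingTime, hitReal, ENNReal.ofReal_tsum_of_nonneg (fun k => hitTail_nonneg G j k i)
    (summable_hitTail hG hN j i)]
  simp only [walk_avoid hG]

theorem hitReal_nonneg (G : Digraph (Fin n)) (j i : Fin n) : 0 ≤ hitReal G j i :=
  tsum_nonneg fun k => hitTail_nonneg G j k i

theorem hitReal_self (G : Digraph (Fin n)) (j : Fin n) : hitReal G j j = 0 := by
  simp [hitReal, hitTail_self]

theorem hitReal_of_ne (hG : ∀ i, (outNbrs G i).Nonempty) {N : ℕ}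
    (hN : ∀ i j, 0 < (transition G ^ N) i j) {i j : Fin n} (hij : i ≠ j) :
    hitReal G j i = 1 + ∑ v, transition G i v * hitReal G j v := by
  rw [hitReal, (summable_hitTail hG hN j i).tsum_eq_zero_add]
  simp only [hitTail, if_neg hij]
  rw [Summable.tsum_finsetSum fun v _ => (summable_hitTail hG hN j v).mul_left _]
  simp only [tsum_mul_left, hitReal]

/-- First-step analysis gives (1 − P)h = 1 − c e_j, where c is the mean return time to j. Replacing
P by D adds a constant vector, which Z fixes. So h equals a constant minus c times column j of Z;
h_j = 0 determines the constant. -/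
theorem stationary_mul_hitReal (hG : ∀ i, (outNbrs G i).Nonempty) {N : ℕ}
    (hN : ∀ i j, 0 < (transition G ^ N) i j) {π : Fin n → ℝ} (hπ : IsStationary G π)
    {Z : Matrix (Fin n) (Fin n) ℝ} (hZ : Z * (1 - deviation G π) = 1)
    (hZ1 : ∀ i, ∑ j, Z i j = 1) (i j : Fin n) :
    π j * hitReal G j i = Z j j - Z i j := by
  set h : Fin n → ℝ := hitReal G j with hh
  set c : ℝ := 1 + ∑ v, transition G j v * h v with hc
  have h1 : ∀ i, h i - ∑ v, transition G i v * h v = 1 - if i = j then c else 0 := by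
    intro i
    by_cases hij : i = j
    · subst hij
      rw [if_pos rfl, hc, hh, hitReal_self]
      ring
    · have h2 : h i = 1 + ∑ v, transition G i v * h v := hitReal_of_ne hG hN hij
      rw [if_neg hij]
      linarith
  -- Kac's formula, obtained by pairing (1 − P)h with π, which P fixes.
  have hcπ : π j * c = 1 := by
    have h2 : ∑ i, π i * (h i - ∑ v, transition G i v * h v) = 0 := by
      simp only [mul_sub, Finset.sum_sub_distrib, Finset.mul_sum, ← mul_assoc]
      rw [Finset.sum_comm (f := fun i v => π i * transition G i v * h v)]
      simp only [← Finset.sum_mul]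
      have h3 : ∀ v, ∑ i, π i * transition G i v = π v := fun v => by
        simpa using stationary_pow hπ 1 v
      simp only [h3, sub_self]
    simp only [h1, mul_sub, mul_one, Finset.sum_sub_distrib, hπ.sum_eq_one, mul_ite, mul_zero,
      Finset.sum_ite_eq', Finset.mem_univ, if_true] at h2
    linarith
  have h4 : ∀ i, ((1 - deviation G π).mulVec h) i =
      (1 + ∑ v, π v * h v) - if i = j then c else 0 := by
    intro i
    rw [deviation, Matrix.sub_mulVec, Matrix.sub_mulVec, Matrix.one_mulVec]
    have h5 := h1 i
    simp only [Pi.sub_apply, Matrix.mulVec, dotProduct, Matrix.vecMulVec_apply, Pi.one_apply,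
      one_mul]
    linarith
  have h6 : ∀ i, h i = (1 + ∑ v, π v * h v) - Z i j * c := by
    intro i
    have h7 : (Z.mulVec ((1 - deviation G π).mulVec h)) i = h i := by
      rw [Matrix.mulVec_mulVec, hZ, Matrix.one_mulVec]
    rw [← h7]
    simp only [Matrix.mulVec, dotProduct] at h4 ⊢
    simp only [h4, mul_sub, Finset.sum_sub_distrib, ← Finset.sum_mul, hZ1, mul_ite, mul_zero,
      Finset.sum_ite_eq', Finset.mem_univ, if_true, one_mul]
  have h8 := h6 i
  have h9 := h6 j
  rw [show h j = 0 from hitReal_self G j] at h9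
  have h10 : h i = (Z j j - Z i j) * c := by linarith
  rw [h10, mul_left_comm, hcπ, mul_one]

theorem kemeny_eq (hG : ∀ i, (outNbrs G i).Nonempty) {N : ℕ}
    (hN : ∀ i j, 0 < (transition G ^ N) i j) {π : Fin n → ℝ} (hπ : IsStationary G π)
    {Z : Matrix (Fin n) (Fin n) ℝ} (hZ : Z * (1 - deviation G π) = 1) (u : Fin n) :
    kemeny G π u ≠ ⊤ ∧ (kemeny G π u).toReal = Z.trace - 1 := by
  have hZ1 : ∀ i, ∑ j, Z i j = 1 := by
    have h1 : (1 - deviation G π).mulVec 1 = 1 := by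
      ext i
      simp [deviation, Matrix.mulVec, dotProduct, Matrix.one_apply, sum_transition hG,
        hπ.sum_eq_one]
    have h2 : Z.mulVec ((1 - deviation G π).mulVec 1) = 1 := by
      rw [Matrix.mulVec_mulVec, hZ, Matrix.one_mulVec]
    rw [h1] at h2
    intro i
    have := congrFun h2 i
    simpa [Matrix.mulVec, dotProduct] using this
  have h3 : kemeny G π u = ENNReal.ofReal (∑ j, π j * hitReal G j u) := by
    rw [kemeny, ENNReal.ofReal_sum_of_nonneg fun j _ =>
      mul_nonneg (hπ.nonneg j) (hitReal_nonneg G j u)]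
    refine Finset.sum_congr rfl fun j _ => ?_
    rw [hittingTime_eq hG hN, ENNReal.ofReal_mul (hπ.nonneg j)]
  refine ⟨by rw [h3]; exact ENNReal.ofReal_ne_top, ?_⟩
  rw [h3, ENNReal.toReal_ofReal (Finset.sum_nonneg fun j _ =>
    mul_nonneg (hπ.nonneg j) (hitReal_nonneg G j u))]
  simp only [stationary_mul_hitReal hG hN hπ hZ hZ1, Finset.sum_sub_distrib, hZ1]
  rfl

end hitting

/-! ## Kemeny's constant and the eigenvalues -/

section spectral

variable {n : ℕ} {G : Digraph (Fin n)}

theorem sum_multiset_sum_map {ι α β : Type*} [AddCommMonoid β] (s : Finset ι) (M : Multiset α)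
    (f : ι → α → β) :
    ∑ t ∈ s, (M.map fun z => f t z).sum = (M.map fun z => ∑ t ∈ s, f t z).sum := by
  induction M using Multiset.induction_on with
  | empty => simp
  | cons a M ih => simp [Finset.sum_add_distrib, ih]

/-- The transition matrix with complex entries. -/
def transitionC (G : Digraph (Fin n)) : Matrix (Fin n) (Fin n) ℂ :=
  (transition G).map (algebraMap ℝ ℂ)

/-- The deviation matrix with complex entries. -/
def deviationC (G : Digraph (Fin n)) (π : Fin n → ℝ) : Matrix (Fin n) (Fin n) ℂ :=
  (deviation G π).map (algebraMap ℝ ℂ)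

/-- The eigenvalues of the transition matrix with one copy of `1` removed. -/
def otherEigenvalues (G : Digraph (Fin n)) : Multiset ℂ := (transitionC G).charpoly.roots.erase 1

theorem trace_map_pow (A : Matrix (Fin n) (Fin n) ℝ) (t : ℕ) :
    (((A ^ t).trace : ℝ) : ℂ) = ((A.map (algebraMap ℝ ℂ)).charpoly.roots.map
      fun z => z ^ t).sum := by
  rw [← trace_pow_eq_sum_roots]
  have : A.map (algebraMap ℝ ℂ) ^ t = (A ^ t).map (algebraMap ℝ ℂ) :=
    (map_pow (algebraMap ℝ ℂ).mapMatrix A t).symm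
  rw [this]
  simp [Matrix.trace]

theorem roots_deviationC (hn : 0 < n) (hG : ∀ i, (outNbrs G i).Nonempty) {π : Fin n → ℝ}
    (hπ : IsStationary G π) :
    (transitionC G).charpoly.roots = 1 ::ₘ otherEigenvalues G ∧
      (deviationC G π).charpoly.roots = 0 ::ₘ otherEigenvalues G := by
  have : Nonempty (Fin n) := ⟨⟨0, hn⟩⟩
  set U : Matrix (Fin n) (Fin n) ℂ := (Matrix.vecMulVec 1 π).map (algebraMap ℝ ℂ) with hU
  have hPU : transitionC G * U = U := by
    rw [transitionC, hU, ← Matrix.map_mul, transition_mul_vecMulVec hG]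
  have hUU : U * U = U := by rw [hU, ← Matrix.map_mul, vecMulVec_mul_self hπ]
  have hUv : U = Matrix.vecMulVec 1 (fun j => (π j : ℂ)) := by
    ext i j
    simp [hU, Matrix.vecMulVec_apply]
  have h1 : (1 : Fin n → ℂ) ⬝ᵥ (fun j => (π j : ℂ)) = 1 := by
    have := hπ.sum_eq_one
    simp only [dotProduct, Pi.one_apply, one_mul]
    exact_mod_cast this
  have hdev : deviationC G π = transitionC G - U := by
    rw [deviationC, deviation, hU, transitionC]
    ext i j
    simp
  have h2 := charpoly_sub_mul hPU hUU hUv h1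
  rw [← hdev] at h2
  have h3 := congrArg Polynomial.roots h2
  have hm1 := (deviationC G π).charpoly_monic
  have hm2 := (transitionC G).charpoly_monic
  have hX1 : (Polynomial.X - 1 : Polynomial ℂ) ≠ 0 := by
    have := Polynomial.X_sub_C_ne_zero (1 : ℂ)
    simpa using this
  have hr1 : (Polynomial.X - 1 : Polynomial ℂ).roots = {1} := by
    have := Polynomial.roots_X_sub_C (1 : ℂ)
    simpa using this
  rw [Polynomial.roots_mul (mul_ne_zero hm1.ne_zero hX1),
    Polynomial.roots_mul (mul_ne_zero Polynomial.X_ne_zero hm2.ne_zero), hr1,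
    Polynomial.roots_X] at h3
  have hmem : (1 : ℂ) ∈ (transitionC G).charpoly.roots := by
    have : (1 : ℂ) ∈ ({0} : Multiset ℂ) + (transitionC G).charpoly.roots := by
      rw [← h3]
      simp
    rw [Multiset.mem_add] at this
    exact this.resolve_left (by simp)
  have h4 : (transitionC G).charpoly.roots = 1 ::ₘ otherEigenvalues G :=
    (Multiset.cons_erase hmem).symm
  refine ⟨h4, ?_⟩
  rw [h4, add_comm, Multiset.singleton_add, Multiset.singleton_add, Multiset.cons_swap] at h3
  exact (Multiset.cons_inj_right 1).1 h3

theorem tendsto_deviationC_pow (hn : 2 ≤ n) (hG : StronglyConnected G) (hA : Aperiodic G)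
    {π : Fin n → ℝ} (hπ : IsStationary G π) (i j : Fin n) :
    Filter.Tendsto (fun k => (deviationC G π ^ k) i j) Filter.atTop (nhds 0) := by
  have h1 := tendsto_pi_nhds.1 (tendsto_pi_nhds.1 (tendsto_deviation_pow hn hG hA hπ) i) j
  have h2 : ∀ k, (deviationC G π ^ k) i j = (((deviation G π ^ k) i j : ℝ) : ℂ) := by
    intro k
    have : deviationC G π ^ k = (deviation G π ^ k).map (algebraMap ℝ ℂ) :=
      (map_pow (algebraMap ℝ ℂ).mapMatrix (deviation G π) k).symm
    rw [this]
    rfl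
  simp only [h2]
  have h3 := (Complex.continuous_ofReal.tendsto 0).comp h1
  simpa [Function.comp_def] using h3

/-- On an eigenvector D^k acts as z^k, and D^k tends to 0. -/
theorem norm_lt_one_of_mem_roots (hn : 2 ≤ n) (hG : StronglyConnected G) (hA : Aperiodic G)
    {π : Fin n → ℝ} (hπ : IsStationary G π) {z : ℂ}
    (hz : z ∈ (deviationC G π).charpoly.roots) : ‖z‖ < 1 := by
  have h1 : (deviationC G π).charpoly.eval z = 0 := (Polynomial.mem_roots'.1 hz).2
  rw [Matrix.eval_charpoly] at h1
  obtain ⟨v, hv0, hv⟩ := Matrix.exists_mulVec_eq_zero_iff.2 h1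
  have hv1 : (deviationC G π).mulVec v = z • v := by
    rw [Matrix.sub_mulVec, sub_eq_zero] at hv
    rw [← hv]
    ext i
    simp [Matrix.scalar_apply, Matrix.mulVec_diagonal]
  have hvk : ∀ k : ℕ, (deviationC G π ^ k).mulVec v = z ^ k • v := by
    intro k
    induction k with
    | zero => simp
    | succ k ih =>
      rw [pow_succ, ← Matrix.mulVec_mulVec, hv1, Matrix.mulVec_smul, ih, smul_smul, pow_succ']
  obtain ⟨i, hi⟩ := Function.ne_iff.1 hv0
  have h2 : Filter.Tendsto (fun k => ∑ j, (deviationC G π ^ k) i j * v j) Filter.atTop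
      (nhds (∑ j, 0 * v j)) :=
    tendsto_finsetSum _ fun j _ => (tendsto_deviationC_pow hn hG hA hπ i j).mul_const _
  have h3 : ∀ k, ∑ j, (deviationC G π ^ k) i j * v j = z ^ k * v i := fun k => congrFun (hvk k) i
  simp only [h3, zero_mul, Finset.sum_const_zero] at h2
  have h4 : Filter.Tendsto (fun k => z ^ k * v i * (v i)⁻¹) Filter.atTop (nhds (0 * (v i)⁻¹)) :=
    h2.mul_const _
  have hi' : v i ≠ 0 := hi
  simp only [mul_assoc, mul_inv_cancel₀ hi', mul_one, zero_mul] at h4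
  exact tendsto_pow_atTop_nhds_zero_iff_norm_lt_one.1 h4

/-- The partial sums ∑_{t < m} tr D^t converge to tr Z by telescoping and, through the eigenvalues,
to the sum of the geometric series 1/(1 − z). -/
theorem exists_fundamental (hn : 2 ≤ n) (hG : StronglyConnected G) (hA : Aperiodic G)
    {π : Fin n → ℝ} (hπ : IsStationary G π) :
    ∃ Z : Matrix (Fin n) (Fin n) ℝ, Z * (1 - deviation G π) = 1 ∧
      ((Z.trace : ℝ) : ℂ) = ((deviationC G π).charpoly.roots.map fun z => (1 - z)⁻¹).sum := by
  have hlt := fun z => norm_lt_one_of_mem_roots hn hG hA hπ (z := z)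
  have hdet : (1 - deviation G π).det ≠ 0 := by
    intro h0
    have h1 : (deviationC G π).charpoly.eval 1 = 0 := by
      rw [Matrix.eval_charpoly]
      have : Matrix.scalar (Fin n) (1 : ℂ) - deviationC G π =
          (algebraMap ℝ ℂ).mapMatrix (1 - deviation G π) := by
        rw [map_sub, map_one, map_one]
        rfl
      rw [this, ← RingHom.map_det, h0, map_zero]
    have h2 := hlt 1 (Polynomial.mem_roots'.2 ⟨(Matrix.charpoly_monic _).ne_zero, h1⟩)
    simp at h2
  set Z := (1 - deviation G π)⁻¹ with hZ
  have hZ1 : Z * (1 - deviation G π) = 1 :=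
    Matrix.nonsing_inv_mul _ (isUnit_iff_ne_zero.2 hdet)
  refine ⟨Z, hZ1, ?_⟩
  have h3 : ∀ m : ℕ, ∑ t ∈ Finset.range m, (deviation G π ^ t).trace =
      Z.trace - (Z * deviation G π ^ m).trace := by
    intro m
    rw [← Matrix.trace_sum, ← Matrix.trace_sub]
    congr 1
    rw [← mul_one_sub, ← mul_neg_geom_sum, ← mul_assoc, hZ1, one_mul]
  have h4 : Filter.Tendsto (fun m => ∑ t ∈ Finset.range m, (deviation G π ^ t).trace)
      Filter.atTop (nhds Z.trace) := by
    simp only [h3]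
    have h5 : Filter.Tendsto (fun m => (Z * deviation G π ^ m).trace) Filter.atTop (nhds 0) := by
      have h6 : Continuous fun A : Matrix (Fin n) (Fin n) ℝ => (Z * A).trace := by fun_prop
      have := (h6.tendsto 0).comp (tendsto_deviation_pow hn hG hA hπ)
      simpa [Function.comp_def] using this
    simpa using h5.const_sub Z.trace
  have h7 : Filter.Tendsto (fun m : ℕ => ((deviationC G π).charpoly.roots.map
      fun z => ∑ t ∈ Finset.range m, z ^ t).sum) Filter.atTop
      (nhds ((deviationC G π).charpoly.roots.map fun z => (1 - z)⁻¹).sum) :=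
    tendsto_multiset_sum _ fun z hz => (hasSum_geometric_of_norm_lt_one (hlt z hz)).tendsto_sum_nat
  have h8 := (Complex.continuous_ofReal.tendsto Z.trace).comp h4
  refine tendsto_nhds_unique h8 ?_
  convert h7 using 2 with m
  simp only [Function.comp_apply, Complex.ofReal_sum, trace_map_pow]
  exact sum_multiset_sum_map _ _ _

/-- Kemeny's constant in terms of the eigenvalues. -/
theorem kemeny_eq_sum (hn : 2 ≤ n) (hG : StronglyConnected G) (hA : Aperiodic G)
    {π : Fin n → ℝ} (hπ : IsStationary G π) (u : Fin n) :
    kemeny G π u ≠ ⊤ ∧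
      (((kemeny G π u).toReal : ℝ) : ℂ) = ((otherEigenvalues G).map fun z => (1 - z)⁻¹).sum := by
  have hout := outNbrs_nonempty hn hG
  obtain ⟨N, hN⟩ := exists_pow_pos hG hA
  obtain ⟨Z, hZ, hZt⟩ := exists_fundamental hn hG hA hπ
  obtain ⟨h1, h2⟩ := kemeny_eq hout hN hπ hZ u
  refine ⟨h1, ?_⟩
  rw [h2, Complex.ofReal_sub, hZt, (roots_deviationC (by omega) hout hπ).2]
  simp

theorem norm_le_secondModulus {z : ℂ} (hz : z ∈ otherEigenvalues G) : ‖z‖ ≤ secondModulus G := by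
  have : ‖z‖₊ ≤ ((otherEigenvalues G).map fun z => ‖z‖₊).sup :=
    Multiset.le_sup (Multiset.mem_map_of_mem _ hz)
  exact_mod_cast this

theorem multiset_sup_lt_one {s : Multiset ℝ≥0} (h : ∀ x ∈ s, x < 1) : s.sup < 1 := by
  induction s using Multiset.induction_on with
  | empty => simp
  | cons a s ih =>
    rw [Multiset.sup_cons, sup_lt_iff]
    exact ⟨h a (Multiset.mem_cons_self a s), ih fun x hx => h x (Multiset.mem_cons_of_mem hx)⟩

theorem secondModulus_lt_one (hn : 2 ≤ n) (hG : StronglyConnected G) (hA : Aperiodic G)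
    {π : Fin n → ℝ} (hπ : IsStationary G π) : secondModulus G < 1 := by
  have h : ((otherEigenvalues G).map fun z => ‖z‖₊).sup < 1 := by
    refine multiset_sup_lt_one fun x hx => ?_
    obtain ⟨z, hz, rfl⟩ := Multiset.mem_map.1 hx
    have := norm_lt_one_of_mem_roots hn hG hA hπ (z := z) (by
      rw [(roots_deviationC (by omega) (outNbrs_nonempty hn hG) hπ).2]
      exact Multiset.mem_cons_of_mem hz)
    exact_mod_cast this
  exact_mod_cast h

theorem trace_transition_pow (hn : 2 ≤ n) (hG : StronglyConnected G) {π : Fin n → ℝ}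
    (hπ : IsStationary G π) (t : ℕ) :
    (((transition G ^ t).trace : ℝ) : ℂ) = 1 + ((otherEigenvalues G).map fun z => z ^ t).sum := by
  rw [trace_map_pow, ← transitionC, (roots_deviationC (by omega) (outNbrs_nonempty hn hG) hπ).1]
  simp

theorem card_otherEigenvalues (hn : 2 ≤ n) (hG : StronglyConnected G) {π : Fin n → ℝ}
    (hπ : IsStationary G π) : ((otherEigenvalues G).card : ℝ) = n - 1 := by
  have h1 := card_roots_charpoly (transitionC G)
  rw [(roots_deviationC (by omega) (outNbrs_nonempty hn hG) hπ).1, Multiset.card_cons,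
    Fintype.card_fin] at h1
  have h2 : ((otherEigenvalues G).card : ℝ) + 1 = n := by exact_mod_cast h1
  linarith

/-- The eigenvalue 1 has a left eigenvector v. In |v_j| ≤ ∑ |v_i| P_ij both sides have the same sum
over j, so equality holds for every j and |v| can be normalised. The running time bound uses this to
obtain 0 < λ < 1, as no π is given there. -/
theorem exists_isStationary (hn : 2 ≤ n) (hG : StronglyConnected G) :
    ∃ π : Fin n → ℝ, IsStationary G π := by
  have hout := outNbrs_nonempty hn hG
  have : Nonempty (Fin n) := ⟨⟨0, by omega⟩⟩
  have h1 : (transition G - 1).mulVec 1 = 0 := by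
    ext i
    rw [Matrix.sub_mulVec, Matrix.one_mulVec]
    simp [Matrix.mulVec, dotProduct, sum_transition hout]
  have hdet : (transition G - 1).det = 0 :=
    Matrix.exists_mulVec_eq_zero_iff.1 ⟨1, one_ne_zero, h1⟩
  obtain ⟨v, hv0, hv⟩ := Matrix.exists_vecMul_eq_zero_iff.2 hdet
  rw [Matrix.vecMul_sub, Matrix.vecMul_one, sub_eq_zero] at hv
  have hle : ∀ j ∈ Finset.univ, |v j| ≤ ∑ i, |v i| * transition G i j := by
    intro j _
    have : v j = ∑ i, v i * transition G i j := (congrFun hv j).symm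
    rw [this]
    refine (Finset.abs_sum_le_sum_abs _ _).trans_eq (Finset.sum_congr rfl fun i _ => ?_)
    rw [abs_mul, abs_of_nonneg (transition_nonneg G i j)]
  have hsum : ∑ j, |v j| = ∑ j, ∑ i, |v i| * transition G i j := by
    rw [Finset.sum_comm]
    simp [← Finset.mul_sum, sum_transition hout]
  have heq := (Finset.sum_eq_sum_iff_of_le hle).1 hsum
  have hpos : 0 < ∑ j, |v j| := by
    obtain ⟨i, hi⟩ := Function.ne_iff.1 hv0
    exact Finset.sum_pos' (fun _ _ => abs_nonneg _) ⟨i, Finset.mem_univ i, abs_pos.2 hi⟩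
  refine ⟨fun i => |v i| / ∑ j, |v j|, fun i => by positivity, ?_, ?_⟩
  · rw [← Finset.sum_div, div_self hpos.ne']
  · ext j
    simp only [Matrix.vecMul, dotProduct]
    rw [heq j (Finset.mem_univ j), Finset.sum_div]
    exact Finset.sum_congr rfl fun i _ => by ring

/-- Without loops tr P = 0, but tr P = 1 + ∑ z would be 1 if all other eigenvalues vanished. -/
theorem secondModulus_pos (hn : 2 ≤ n) (hG : StronglyConnected G) (hloop : ∀ i, ¬ G.Adj i i)
    {π : Fin n → ℝ} (hπ : IsStationary G π) : 0 < secondModulus G := by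
  by_contra h
  have h1 := trace_transition_pow hn hG hπ 1
  have h2 : (transition G ^ 1).trace = 0 := by
    rw [pow_one]
    refine Finset.sum_eq_zero fun i _ => ?_
    simp [transition, hloop i]
  have h3 : ((otherEigenvalues G).map fun z => z ^ 1).sum = 0 := by
    refine Multiset.sum_eq_zero fun x hx => ?_
    obtain ⟨z, hz, rfl⟩ := Multiset.mem_map.1 hx
    have h4 := norm_le_secondModulus hz
    rw [pow_one, ← norm_le_zero_iff]
    linarith
  rw [h2, h3] at h1
  simp at h1

theorem secondModulus_pow_walkLength_le (hn : 2 ≤ n) (hG : StronglyConnected G)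
    (hloop : ∀ i, ¬ G.Adj i i) (hA : Aperiodic G) {π : Fin n → ℝ} (hπ : IsStationary G π)
    {ε : ℝ} (hε : 0 < ε) :
    secondModulus G ^ walkLength G ε ≤ ε * (1 - secondModulus G) / 3 := by
  have h0 := secondModulus_pos hn hG hloop hπ
  have h1 := secondModulus_lt_one hn hG hA hπ
  have hl : Real.log (3 / (ε - ε * secondModulus G)) / Real.log (1 / secondModulus G) ≤
    walkLength G ε := Nat.le_ceil _
  set lam := secondModulus G with hlam
  have hlog : 0 < Real.log (1 / lam) := Real.log_pos (by rw [lt_div_iff₀ h0]; linarith)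
  have hx : 0 < ε - ε * lam := by nlinarith
  rw [div_le_iff₀ hlog, ← Real.log_pow, Real.log_le_log_iff (by positivity) (by positivity),
    one_div, inv_pow, div_le_iff₀ hx] at hl
  have h2 : 0 < lam ^ walkLength G ε := by positivity
  have h3 := mul_le_mul_of_nonneg_left hl h2.le
  rw [← mul_assoc, mul_inv_cancel₀ h2.ne', one_mul] at h3
  linarith

/-- With w = 1 − z the real part of 1/w is Re w/|w|², and 2 Re w = 1 − |z|² + |w|² ≥ 1 − λ² + |w|².
Hence 2ε Re 1/w exceeds ε by a multiple of (1 − λ²)/|w|², which together with a thirty-sixth of ε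
covers the truncation term. -/
theorem norm_pow_div_add_le {z : ℂ} {lam ε : ℝ} {l : ℕ} (h1 : lam < 1) (hz : ‖z‖ ≤ lam)
    (hε : 0 < ε) (hl : lam ^ l ≤ ε * (1 - lam) / 3) :
    ‖z ^ (l + 1) * (1 - z)⁻¹‖ + 35 / 36 * ε ≤ 2 * ε * ((1 - z)⁻¹).re := by
  have h0 : 0 ≤ lam := (norm_nonneg z).trans hz
  set w := 1 - z with hw
  set N := ‖w‖ with hN
  have hN0 : 0 < N := by
    have h2 : 1 - ‖z‖ ≤ N := by
      have := norm_sub_norm_le (1 : ℂ) z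
      rwa [norm_one] at this
    linarith
  have hN2 : N ^ 2 = w.re ^ 2 + w.im ^ 2 := by
    rw [hN, Complex.sq_norm, Complex.normSq_apply]; ring
  have hz2 : ‖z‖ ^ 2 = (1 - w.re) ^ 2 + w.im ^ 2 := by
    rw [Complex.sq_norm, Complex.normSq_apply, hw]
    simp
    ring
  have hre : 1 - lam ^ 2 + N ^ 2 ≤ 2 * w.re := by
    have : ‖z‖ ^ 2 ≤ lam ^ 2 := by gcongr
    nlinarith
  have hpow : ‖z ^ (l + 1)‖ ≤ ε * (1 - lam) / 3 := by
    rw [norm_pow, pow_succ]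
    refine le_trans ?_ hl
    have h3 : ‖z‖ ^ l ≤ lam ^ l := by gcongr
    have h4 : 0 ≤ ‖z‖ ^ l := by positivity
    nlinarith [norm_nonneg z]
  rw [norm_mul, norm_inv, ← hN, Complex.inv_re, Complex.normSq_eq_norm_sq, ← hN]
  have h5 : ‖z ^ (l + 1)‖ * N⁻¹ ≤ ε * (1 - lam) / 3 * N⁻¹ := by gcongr
  have h6 : ε * (1 - lam) / 3 * N⁻¹ + 35 / 36 * ε =
      ε * ((1 - lam) * N / 3 + 35 / 36 * N ^ 2) / N ^ 2 := by field_simp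
  have h7 : 2 * ε * (w.re / N ^ 2) = ε * (2 * w.re) / N ^ 2 := by ring
  have h8 : ε * ((1 - lam) * N / 3 + 35 / 36 * N ^ 2) / N ^ 2 ≤ ε * (2 * w.re) / N ^ 2 := by
    gcongr
    -- The square yields (1 − λ)N/3 ≤ N²/36 + (1 − λ)², and (1 − λ)² ≤ 1 − λ². This is the origin of
    -- 35/36.
    nlinarith [sq_nonneg (N / 6 - (1 - lam))]
  linarith

/-- The truncation error together with the allowance for the sampling error. -/
theorem truncation_error (hn : 2 ≤ n) (hG : StronglyConnected G) (hloop : ∀ i, ¬ G.Adj i i)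
    (hA : Aperiodic G) {π : Fin n → ℝ} (hπ : IsStationary G π) (u : Fin n) {ε : ℝ}
    (hε : 0 < ε) :
    |(n : ℝ) - walkLength G ε - 1 + ∑ i, returnMean G ε i - (kemeny G π u).toReal| +
      35 / 36 * ((n : ℝ) - 1) * ε ≤ 2 * ε * (kemeny G π u).toReal := by
  have hK := (kemeny_eq_sum hn hG hA hπ u).2
  have hlt := secondModulus_lt_one hn hG hA hπ
  have hl := secondModulus_pow_walkLength_le hn hG hloop hA hπ hε
  have hcard := card_otherEigenvalues hn hG hπ
  set K := (kemeny G π u).toReal with hKdef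
  set l := walkLength G ε with hldef
  set M := otherEigenvalues G with hM
  set T := (n : ℝ) - l - 1 + ∑ i, returnMean G ε i with hT
  -- Since tr P^t = 1 + ∑ z^t, the l traces contribute l extra ones, removed by −l; the term t = 0
  -- on the right equals the number n − 1 of eigenvalues.
  have hTC : (T : ℂ) = (M.map fun z => ∑ t ∈ Finset.range (l + 1), z ^ t).sum := by
    have h1 : ∑ i, returnMean G ε i = ∑ t ∈ Finset.range l, (transition G ^ (t + 1)).trace := by
      simp only [returnMean_eq (outNbrs_nonempty hn hG), Matrix.trace, Matrix.diag_apply]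
      rw [Finset.sum_comm]
    have h2 : (M.map fun z => ∑ t ∈ Finset.range (l + 1), z ^ t).sum =
        ∑ t ∈ Finset.range (l + 1), (M.map fun z => z ^ t).sum :=
      (sum_multiset_sum_map _ _ _).symm
    rw [h2, Finset.sum_range_succ', hT, h1]
    push_cast
    simp only [trace_transition_pow hn hG hπ, ← hM, Finset.sum_add_distrib]
    have h3 : (M.card : ℂ) = n - 1 := by exact_mod_cast congrArg (fun x : ℝ => (x : ℂ)) hcard
    simp [h3]
    ring
  have hdiff : ((T - K : ℝ) : ℂ) = -(M.map fun z => z ^ (l + 1) * (1 - z)⁻¹).sum := by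
    rw [Complex.ofReal_sub, hTC, hK, sub_eq_iff_eq_add, neg_add_eq_sub, eq_sub_iff_add_eq,
      ← Multiset.sum_map_add]
    refine congrArg Multiset.sum (Multiset.map_congr rfl fun z hz => ?_)
    have hz1 : z ≠ 1 := by
      rintro rfl
      have := norm_le_secondModulus hz
      rw [norm_one] at this
      linarith
    have hz2 : 1 - z ≠ 0 := sub_ne_zero.2 hz1.symm
    refine eq_inv_of_mul_eq_one_left ?_
    rw [add_mul, inv_mul_cancel_right₀ hz2, geom_sum_mul_neg]
    ring
  have habs : |T - K| ≤ (M.map fun z => ‖z ^ (l + 1) * (1 - z)⁻¹‖).sum := by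
    rw [← Real.norm_eq_abs, ← Complex.norm_real, hdiff, norm_neg]
    refine (norm_multiset_sum_le _).trans_eq ?_
    rw [Multiset.map_map]
    rfl
  have hKre : K = (M.map fun z => ((1 - z)⁻¹).re).sum := by
    have h1 := congrArg Complex.re hK
    rw [Complex.ofReal_re] at h1
    rw [h1, ← Complex.coe_reAddGroupHom, map_multiset_sum, Multiset.map_map]
    rfl
  calc |T - K| + 35 / 36 * ((n : ℝ) - 1) * ε
      ≤ (M.map fun z => ‖z ^ (l + 1) * (1 - z)⁻¹‖).sum + (M.map fun _ => 35 / 36 * ε).sum := by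
        refine add_le_add habs (le_of_eq ?_)
        rw [Multiset.map_const', Multiset.sum_replicate, nsmul_eq_mul, hcard]
        ring
    _ = (M.map fun z => ‖z ^ (l + 1) * (1 - z)⁻¹‖ + 35 / 36 * ε).sum :=
        Multiset.sum_map_add.symm
    _ ≤ (M.map fun z => 2 * ε * ((1 - z)⁻¹).re).sum :=
        Multiset.sum_map_le_sum_map _ _ fun z hz =>
          norm_pow_div_add_le hlt (norm_le_secondModulus hz) hε hl
    _ = 2 * ε * K := by rw [Multiset.sum_map_mul_left, ← hKre]

end spectral

/-! ## Running time -/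

section time

variable {n : ℕ} {G : Digraph (Fin n)}

theorem countReturns_time {s : Fin n} {k : ℕ} {i : Fin n} {c : ℕ} {x : ℕ × ℕ}
    (hx : x ∈ (countReturns G s k i c).outcomes) : x.2 = 3 * k := by
  induction k generalizing i c x with
  | zero =>
    rw [countReturns, RandAlg.mem_outcomes_pure] at hx
    simp [hx]
  | succ k ih =>
    rw [countReturns, RandAlg.mem_outcomes_bind] at hx
    obtain ⟨y, hy, z, hz, rfl⟩ := hx
    rw [RandAlg.mem_outcomes_bind] at hz
    obtain ⟨y', hy', z', hz', rfl⟩ := hz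
    rw [RandAlg.mem_outcomes_tick] at hy'
    have h1 := ih hz'
    have h2 : y.2 = 1 := by
      obtain ⟨v, -, rfl⟩ := (PMF.mem_support_map_iff _ _ _).1 hy
      rfl
    subst hy'
    simp only [h1, h2]
    ring

theorem simulate_time {ε : ℝ} {s : Fin n} {m j : ℕ} {a b : ℝ} {x : ℝ × ℕ}
    (hx : x ∈ (simulate G ε s m j a b).outcomes) :
    x.2 ≤ m * (3 * walkLength G ε + 31) + 1 := by
  induction m generalizing j a b x with
  | zero =>
    rw [simulate, RandAlg.mem_outcomes_bind] at hx
    obtain ⟨y, hy, z, hz, rfl⟩ := hx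
    rw [RandAlg.mem_outcomes_tick] at hy
    rw [RandAlg.mem_outcomes_pure] at hz
    subst hy hz
    simp
  | succ m ih =>
    rw [simulate, RandAlg.mem_outcomes_bind] at hx
    obtain ⟨y, hy, z, hz, rfl⟩ := hx
    rw [RandAlg.mem_outcomes_bind] at hz
    obtain ⟨y', hy', z', hz', rfl⟩ := hz
    rw [RandAlg.mem_outcomes_tick] at hy'
    subst hy'
    have h1 := countReturns_time hy
    simp only at hz' ⊢
    split_ifs at hz'
    · rw [RandAlg.mem_outcomes_bind] at hz'
      obtain ⟨w, hw, w', hw', rfl⟩ := hz'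
      rw [RandAlg.mem_outcomes_tick] at hw
      rw [RandAlg.mem_outcomes_pure] at hw'
      subst hw hw'
      simp only [h1]
      rw [add_mul, one_mul]
      omega
    · have h2 := ih hz'
      rw [add_mul, one_mul]
      omega

theorem sumMeans_time {ε : ℝ} {L : List (Fin n)} {x : ℝ × ℕ}
    (hx : x ∈ (sumMeans G ε L).outcomes) :
    x.2 ≤ L.length * (maxWalks G ε * (3 * walkLength G ε + 31) + 6) := by
  induction L generalizing x with
  | nil =>
    rw [sumMeans, RandAlg.mem_outcomes_pure] at hx
    simp [hx]
  | cons i L ih =>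
    rw [sumMeans, RandAlg.mem_outcomes_bind] at hx
    obtain ⟨y, hy, z, hz, rfl⟩ := hx
    rw [RandAlg.mem_outcomes_bind] at hz
    obtain ⟨y', hy', z', hz', rfl⟩ := hz
    rw [RandAlg.mem_outcomes_tick] at hy'
    rw [RandAlg.mem_outcomes_bind] at hz'
    obtain ⟨w, hw, w', hw', rfl⟩ := hz'
    rw [RandAlg.mem_outcomes_pure] at hw'
    subst hy' hw'
    have h1 := simulate_time hy
    have h2 := ih hw
    rw [List.length_cons, add_mul, one_mul]
    simp only
    omega

theorem improvedMC_time {ε : ℝ} {x : ℝ × ℕ} (hx : x ∈ (improvedMC G ε).outcomes) :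
    x.2 ≤ 50 + subsetSize G ε * (maxWalks G ε * (3 * walkLength G ε + 31) + 7) := by
  rw [improvedMC, RandAlg.mem_outcomes_bind] at hx
  obtain ⟨y, hy, z, hz, rfl⟩ := hx
  rw [RandAlg.mem_outcomes_tick] at hy
  rw [RandAlg.mem_outcomes_bind] at hz
  obtain ⟨y', hy', z', hz', rfl⟩ := hz
  rw [RandAlg.mem_outcomes_bind] at hz'
  obtain ⟨w, hw, w', hw', rfl⟩ := hz'
  rw [RandAlg.mem_outcomes_pure] at hw'
  subst hy hw'
  obtain ⟨S, hS, rfl⟩ := (PMF.mem_support_map_iff _ _ _).1 hy'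
  have hS' : S.card = subsetSize G ε :=
    (Finset.mem_powersetCard.1 (PMF.mem_support_uniformOfFinset_iff _ _ |>.1 hS)).2
  have h1 := sumMeans_time hw
  rw [Finset.length_toList, hS'] at h1
  simp only
  rw [mul_add] at h1 ⊢
  omega

/-- For ε ≤ 1 both logarithms are positive. A walk length of at least 1 lets the additive constants
of the step count be absorbed. -/
theorem one_le_walkLength (hn : 2 ≤ n) (hG : StronglyConnected G)
    (hloop : ∀ i, ¬ G.Adj i i) (hA : Aperiodic G) {ε : ℝ} (hε : 0 < ε) (hε1 : ε ≤ 1) :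
    1 ≤ walkLength G ε := by
  obtain ⟨π, hπ⟩ := exists_isStationary hn hG
  have h0 := secondModulus_pos hn hG hloop hπ
  have h1 := secondModulus_lt_one hn hG hA hπ
  refine Nat.one_le_ceil_iff.2 (div_pos (Real.log_pos ?_) (Real.log_pos ?_))
  · rw [lt_div_iff₀ (by nlinarith)]
    nlinarith
  · rw [lt_div_iff₀ h0]
    linarith

theorem maxWalks_le (hn : 3 ≤ n) {ε : ℝ} (hε : 0 < ε) (hε1 : ε ≤ 1)
    (hl : 1 ≤ walkLength G ε) :
    (maxWalks G ε : ℝ) ≤ 11 / 2 * (ε⁻¹ ^ 2 * (walkLength G ε : ℝ) ^ 2 * Real.log n) := by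
  have hn3 : (3 : ℝ) ≤ n := by exact_mod_cast hn
  have h1 : 1 ≤ ε⁻¹ := (one_le_inv₀ hε).2 hε1
  have h2 : (1 : ℝ) ≤ walkLength G ε := by exact_mod_cast hl
  have h3 := one_le_log hn
  have h4 : Real.log (2 * n) ≤ 2 * Real.log n := by
    rw [Real.log_mul two_ne_zero (by positivity)]
    have : Real.log 2 ≤ Real.log n := Real.log_le_log two_pos (by linarith)
    linarith
  have h5 : 0 ≤ Real.log (2 * n) := Real.log_nonneg (by linarith)
  have h6 : 1 ≤ ε⁻¹ ^ 2 * (walkLength G ε : ℝ) ^ 2 * Real.log n :=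
    one_le_mul_of_one_le_of_one_le
      (one_le_mul_of_one_le_of_one_le (one_le_pow₀ h1) (one_le_pow₀ h2)) h3
  have h7 : (maxWalks G ε : ℝ) < 9 * ε⁻¹ ^ 2 * (walkLength G ε : ℝ) ^ 2 * Real.log (2 * n) / 4 + 1 :=
    Nat.ceil_lt_add_one (by positivity)
  have h8 : ε⁻¹ ^ 2 * (walkLength G ε : ℝ) ^ 2 * Real.log (2 * n) ≤
      ε⁻¹ ^ 2 * (walkLength G ε : ℝ) ^ 2 * (2 * Real.log n) := by gcongr
  linarith

theorem subsetSize_le_mul (hn : 3 ≤ n) {ε : ℝ} (hε : 0 < ε) (hε1 : ε ≤ 1)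
    (hl : 1 ≤ walkLength G ε) :
    (subsetSize G ε : ℝ) ≤ 5 / 2 * (ε⁻¹ * walkLength G ε * √(n : ℝ) * √(Real.log n)) := by
  have hn3 : (1 : ℝ) ≤ n := by exact_mod_cast (by omega : 1 ≤ n)
  have h1 : 1 ≤ ε⁻¹ := (one_le_inv₀ hε).2 hε1
  have h2 : (1 : ℝ) ≤ walkLength G ε := by exact_mod_cast hl
  have h6 : 1 ≤ ε⁻¹ * walkLength G ε * √(n : ℝ) * √(Real.log n) :=
    one_le_mul_of_one_le_of_one_le (one_le_mul_of_one_le_of_one_le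
      (one_le_mul_of_one_le_of_one_le h1 h2) (Real.one_le_sqrt.2 hn3))
      (Real.one_le_sqrt.2 (one_le_log hn))
  have h7 : (⌈3 * ε⁻¹ * (walkLength G ε : ℝ) * √(n : ℝ) * √(Real.log n) / 2⌉₊ : ℝ) <
      3 * ε⁻¹ * (walkLength G ε : ℝ) * √(n : ℝ) * √(Real.log n) / 2 + 1 :=
    Nat.ceil_lt_add_one (by positivity)
  have h8 : (subsetSize G ε : ℝ) ≤
      (⌈3 * ε⁻¹ * (walkLength G ε : ℝ) * √(n : ℝ) * √(Real.log n) / 2⌉₊ : ℝ) := by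
    exact_mod_cast min_le_left _ _
  linarith

theorem improvedMC_time_le (hn : 2 ≤ n) (hloop : ∀ i, ¬ G.Adj i i) (hG : StronglyConnected G)
    (hA : Aperiodic G) {ε : ℝ} (hε : 0 < ε) (hε1 : ε ≤ 1) {x : ℝ × ℕ}
    (hx : x ∈ (improvedMC G ε).outcomes) :
    (x.2 : ℝ) ≤ 535 * (ε⁻¹ ^ 3 * (walkLength G ε : ℝ) ^ 4 * (n : ℝ) ^ (1 / 2 : ℝ) *
      Real.log n ^ (3 / 2 : ℝ)) := by
  have hn3 := three_le_of_aperiodic hn hloop hA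
  have hl := one_le_walkLength hn hG hloop hA hε hε1
  have hr := maxWalks_le hn3 hε hε1 hl
  have hk := subsetSize_le_mul hn3 hε hε1 hl
  have hL := one_le_log hn3
  have ht : (x.2 : ℝ) ≤
      50 + subsetSize G ε * (maxWalks G ε * (3 * walkLength G ε + 31) + 7) := by
    exact_mod_cast improvedMC_time hx
  have hs : 1 ≤ √(n : ℝ) := Real.one_le_sqrt.2 (by exact_mod_cast (by omega : 1 ≤ n))
  have hq : 1 ≤ √(Real.log n) := Real.one_le_sqrt.2 hL
  have he : 1 ≤ ε⁻¹ := (one_le_inv₀ hε).2 hε1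
  have hl' : (1 : ℝ) ≤ walkLength G ε := by exact_mod_cast hl
  have hpow : Real.log n ^ (3 / 2 : ℝ) = Real.log n * √(Real.log n) := by
    rw [Real.sqrt_eq_rpow, show (3 / 2 : ℝ) = 1 + 1 / 2 by norm_num,
      Real.rpow_add (by linarith), Real.rpow_one]
  rw [hpow, ← Real.sqrt_eq_rpow]
  have hr0 : (0 : ℝ) ≤ maxWalks G ε := Nat.cast_nonneg _
  generalize (walkLength G ε : ℝ) = l at *
  generalize (subsetSize G ε : ℝ) = k at *
  generalize (maxWalks G ε : ℝ) = r at *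
  generalize Real.log n = y at *
  generalize √(n : ℝ) = s at *
  generalize √y = q at *
  generalize ε⁻¹ = e at *
  have h1 : 1 ≤ e * l * s * q :=
    one_le_mul_of_one_le_of_one_le (one_le_mul_of_one_le_of_one_le
      (one_le_mul_of_one_le_of_one_le he hl') hs) hq
  have h2 : 1 ≤ e ^ 2 * l ^ 2 * y * l :=
    one_le_mul_of_one_le_of_one_le (one_le_mul_of_one_le_of_one_le
      (one_le_mul_of_one_le_of_one_le (one_le_pow₀ he) (one_le_pow₀ hl')) hL) hl'
  -- The constant is 11/2 · 34 + 7 = 194.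
  have h3 : r * (3 * l + 31) + 7 ≤ 194 * (e ^ 2 * l ^ 2 * y * l) := by
    have : r * (3 * l + 31) ≤ 11 / 2 * (e ^ 2 * l ^ 2 * y) * (34 * l) := by
      gcongr
      linarith
    linarith
  have h4 : k * (r * (3 * l + 31) + 7) ≤
      5 / 2 * (e * l * s * q) * (194 * (e ^ 2 * l ^ 2 * y * l)) := by
    refine (mul_le_mul_of_nonneg_right hk ?_).trans (mul_le_mul_of_nonneg_left h3 (by linarith))
    positivity
  -- The initial 50 units are absorbed as well: 50 + 5/2 · 194 = 535.
  have h5 := one_le_mul_of_one_le_of_one_le h1 h2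
  calc (x.2 : ℝ)
      ≤ 535 * ((e * l * s * q) * (e ^ 2 * l ^ 2 * y * l)) := by linarith
    _ = _ := by ring

end time

/-! ## Accuracy -/

section output

variable {n : ℕ} {G : Digraph (Fin n)} {ε : ℝ}

theorem sample_error_of_walkLength_eq_zero (hn : 0 < n) (hG : ∀ i, (outNbrs G i).Nonempty)
    (hε : 0 < ε) (hl : walkLength G ε = 0) :
    (sampleLaw G ε).toOuterMeasure {x | ¬ |(n : ℝ) / x.1.card * x.2 - ∑ i, returnMean G ε i| ≤
      35 / 36 * ((n : ℝ) - 1) * ε} = 0 := by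
  rw [PMF.toOuterMeasure_apply_eq_zero_iff, Set.disjoint_left]
  rintro x hx hbad
  refine hbad ?_
  -- For l = 0 the sampled set is empty. The factor n/0 is 0 by default, as the output requires, and
  -- there are no returns to estimate, so the error is 0.
  have h1 : x.1.card = 0 := by
    rw [(mem_support_sampleLaw hx).1]
    simp [subsetSize, hl]
  have h2 : (1 : ℝ) ≤ n := by exact_mod_cast hn
  simp only [returnMean_eq hG, hl, h1]
  simp only [Nat.cast_zero, div_zero, zero_mul, Finset.range_zero, Finset.sum_empty,
    Finset.sum_const_zero, sub_self, abs_zero]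
  have : 0 ≤ (n : ℝ) - 1 := by linarith
  positivity

theorem improvedMC_accuracy (hn : 2 ≤ n) (hloop : ∀ i, ¬ G.Adj i i) (hG : StronglyConnected G)
    (hA : Aperiodic G) (hε : 0 < ε) {π : Fin n → ℝ} (hπ : IsStationary G π) (u : Fin n) :
    ENNReal.ofReal (1 - 1 / (n : ℝ)) ≤ (improvedMC G ε).prob
      {x | |x.1 - (kemeny G π u).toReal| ≤ 2 * ε * (kemeny G π u).toReal} := by
  have hout := outNbrs_nonempty hn hG
  have htr := truncation_error hn hG hloop hA hπ u hε
  have hse : (sampleLaw G ε).toOuterMeasure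
      {x | ¬ |(n : ℝ) / x.1.card * x.2 - ∑ i, returnMean G ε i| ≤
        35 / 36 * ((n : ℝ) - 1) * ε} ≤ ENNReal.ofReal (1 / n) := by
    rcases Nat.eq_zero_or_pos (walkLength G ε) with hl | hl
    · rw [sample_error_of_walkLength_eq_zero (by omega) hout hε hl]
      exact zero_le
    · exact sample_error (three_le_of_aperiodic hn hloop hA) hout hloop hε hl
  have h1 := RandAlg.prob_fst (improvedMC G ε)
    {y | |y - (kemeny G π u).toReal| ≤ 2 * ε * (kemeny G π u).toReal}
  rw [val_improvedMC_eq_map, PMF.toOuterMeasure_map_apply] at h1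
  refine le_of_le_of_eq ?_ h1.symm
  refine (one_sub_le_toOuterMeasure (E := {x : Finset (Fin n) × ℝ |
    |(n : ℝ) / x.1.card * x.2 - ∑ i, returnMean G ε i| ≤ 35 / 36 * ((n : ℝ) - 1) * ε})
    (by positivity) hse).trans
    ((sampleLaw G ε).toOuterMeasure.mono fun x hx => ?_)
  change |(n : ℝ) - walkLength G ε - 1 + (n : ℝ) / x.1.card * x.2 - (kemeny G π u).toReal| ≤ _
  refine le_trans ?_ htr
  refine le_trans (le_of_eq_of_le ?_ (abs_add_le _ _)) (add_le_add le_rfl hx)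
  congr 1
  ring

end output

end

end KemenyMC

theorem mainTheorem2 :
    ∃ C : ℝ, 0 < C ∧
      ∀ (n : ℕ) (G : Digraph (Fin n)) (ε : ℝ),
        2 ≤ n →
        (∀ i, ¬ G.Adj i i) →
        KemenyMC.StronglyConnected G →
        KemenyMC.Aperiodic G →
        0 < ε →
        -- running time, in every run
        (ε ≤ 1 →
          ∀ x ∈ (KemenyMC.improvedMC G ε).outcomes,
            (x.2 : ℝ) ≤ C * (ε⁻¹ ^ 3 * (KemenyMC.walkLength G ε : ℝ) ^ 4 *
              (n : ℝ) ^ (1 / 2 : ℝ) * Real.log n ^ (3 / 2 : ℝ))) ∧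
        -- accuracy
        (∀ (π : Fin n → ℝ) (u : Fin n), KemenyMC.IsStationary G π →
          KemenyMC.kemeny G π u ≠ ⊤ ∧
          ENNReal.ofReal (1 - 1 / (n : ℝ)) ≤
            (KemenyMC.improvedMC G ε).prob
              {x | |x.1 - (KemenyMC.kemeny G π u).toReal| ≤
                2 * ε * (KemenyMC.kemeny G π u).toReal}) := by
  refine ⟨535, by norm_num, fun n G ε hn hloop hG hA hε =>
    ⟨fun hε1 x hx => KemenyMC.improvedMC_time_le hn hloop hG hA hε hε1 hx, fun π u hπ =>
      ⟨(KemenyMC.kemeny_eq_sum hn hG hA hπ u).1,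
        KemenyMC.improvedMC_accuracy hn hloop hG hA hε hπ u⟩⟩⟩
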